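/- **Setting.** Let $d\in\{2,3\}$ and let $\Omega\subset\mathbb R^d$ be a bounded polytopal domain (open, connected, nonempty) with Lipschitz boundary. Let $\alpha,\beta>0$, $a<0<b$ and $f,y_\Omega\in L^2(\Omega)$. Put $$\mathbb U_{ad}=\{v\in L^2(\Omega): a\le v\le b \text{ a.e.}\},\qquad \psi(u)=\|u\|_{L^1(\Omega)},\qquad \Pi_{[r,s]}(t)=\min\{s,\max\{r,t\}\}.$$ Let $(\bar y,\bar p,\bar u)\in H^1_0(\Omega)\times H^1_0(\Omega)\times\mathbb U_{ad}$ and $\bar\lambda\in\partial\psi(\bar u)\subset L^\infty(\Omega)$ satisfy $$(\nabla\bar y,\nabla v)=(\bar u+f,v),\quad (\nabla w,\nabla\bar p)=(\bar y-y_\Omega,w)\quad\forall v,w\in H^1_0(\Omega),$$ $$(\bar p+\alpha\bar u+\beta\bar\lambda,u-\bar u)\ge0\quad\forall u\in\mathbb U_{ad},$$ with all inner products in $L^2(\Omega)$. Let $\mathscr T$ be a conforming partition of $\bar\Omega$ into closed simplices $K$ of diameter $h_K$, shape regular with constant $\sigma$: every $K$ contains a ball of some diameter $\rho_K>0$ with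 $h_K\le\sigma\rho_K$. Let $\mathbb V(\mathscr T)$ be the space of continuous functions on $\bar\Omega$ that are affine on every $K$ and vanish on $\partial\Omega$, let $\mathbb U_0(\mathscr T)$ be the space of functions that are constant on every $K$, and let $\mathbb U_{ad,0}(\mathscr T)=\mathbb U_0(\mathscr T)\cap\mathbb U_{ad}$. Let $(\bar y_{\mathscr T},\bar p_{\mathscr T},\bar u_{\mathscr T})\in\mathbb V(\mathscr T)\times\mathbb V(\mathscr T)\times\mathbb U_{ad,0}(\mathscr T)$ and $\bar\lambda_{\mathscr T}\in\mathbb U_0(\mathscr T)$ satisfy $$(\nabla\bar y_{\mathscr T},\nabla v)=(\bar u_{\mathscr T}+f,v),\quad(\nabla w,\nabla\bar p_{\mathscr T})=(\bar y_{\mathscr T}-y_\Omega,w)\quad\forall v,w\in\mathbb V(\mathscr T),$$ $$(\bar p_{\mathscr T}+\alpha\bar u_{\mathscr T}+\beta\bar\lambda_{\mathscr T},u-\bar u_{\mathscr T})\ge0\quad\forall u\in\mathbb U_{ad,0}(\mathscr T),$$ where $\bar\lambda_{\mathscr T}$ represents, through the $L^2(\Omega)$ inner product, an element of the subdifferential at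 $\bar u_{\mathscr T}$ of $\psi$ restricted to $\mathbb U_0(\mathscr T)$. **Estimator.** Set $\tilde\lambda=\Pi_{[-1,1]}(-\tfrac1\beta\bar p_{\mathscr T})$ and $\tilde u=\Pi_{[a,b]}(-\tfrac1\alpha(\bar p_{\mathscr T}+\beta\tilde\lambda))$. For $K\in\mathscr T$ put $$\mathcal E_{y,K}^2=h_K^2\|\bar u_{\mathscr T}+f\|_{L^2(K)}^2+h_K\|[\![\nabla\bar y_{\mathscr T}\cdot\nu]\!]\|_{L^2(\partial K\setminus\partial\Omega)}^2,\quad \mathcal E_{p,K}^2=h_K^2\|\bar y_{\mathscr T}-y_\Omega\|_{L^2(K)}^2+h_K\|[\![\nabla\bar p_{\mathscr T}\cdot\nu]\!]\|_{L^2(\partial K\setminus\partial\Omega)}^2,$$ $$E_{u,K}=\|\tilde u-\bar u_{\mathscr T}\|_{L^2(K)},\qquad E_{\lambda,K}=\|\tilde\lambda-\bar\lambda_{\mathscr T}\|_{L^2(K)}.$$ Here, on a side shared by two elements $K^+$ and $K^-$ with outward unit normals $\nu^\pm$, $[\![\nabla z\cdot\nu]\!]=\nu^+\cdot\nabla z|_{K^+}+\nu^-\cdot\nabla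 z|_{K^-}$. For weights $\mathscr C_{st},\mathscr C_{ad},\mathscr C_{ct},\mathscr C_{sg}\ge0$ put $$\mathcal E=\Big(\sum_{K\in\mathscr T}\big(\mathscr C_{st}\mathcal E_{y,K}^2+\mathscr C_{ad}\mathcal E_{p,K}^2+\mathscr C_{ct}E_{u,K}^2+\mathscr C_{sg}E_{\lambda,K}^2\big)\Big)^{1/2}.$$ **Error and oscillation.** Put $$|||e|||_\Omega^2=|\bar y-\bar y_{\mathscr T}|_{H^1(\Omega)}^2+|\bar p-\bar p_{\mathscr T}|_{H^1(\Omega)}^2+\|\bar u-\bar u_{\mathscr T}\|_{L^2(\Omega)}^2+\|\bar\lambda-\bar\lambda_{\mathscr T}\|_{L^2(\Omega)}^2.$$ For $\ell\in\{0,1\}$ and $g\in L^2(\Omega)$ put $$\mathrm{osc}_{\mathscr T,0}(g;\mathscr T)=\Big(\sum_{K\in\mathscr T}h_K^2\|g-\Pi_K^\ell g\|_{L^2(K)}^2\Big)^{1/2},$$ where $\Pi^\ell_K$ is the $L^2(K)$-orthogonal projection onto the polynomials of degree at most $\ell$. **Theorem (global efficiency of $\mathcal E$).** There is a constant $C>0$,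 depending only on $\Omega$ (and so on $d$), the shape regularity constant $\sigma$, $\alpha$, $\beta$ and the weights $\mathscr C_{st},\mathscr C_{ad},\mathscr C_{ct},\mathscr C_{sg}$, such that for all $a,b,f,y_\Omega$, $\ell$, $\mathscr T$, and all continuous and discrete solutions as above, $$\mathcal E\le C\big(|||e|||_\Omega+\mathrm{osc}_{\mathscr T,0}(f;\mathscr T)+\mathrm{osc}_{\mathscr T,0}(y_\Omega;\mathscr T)\big).$$ In particular $C$ is independent of the optimal variables, their approximations, the sizes of the elements and $\#\mathscr T$. -/

import Mathlib

open MeasureTheory Set Topology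
open scoped ENNReal NNReal ContDiff RealInnerProductSpace

noncomputable section

namespace SparseControl

/-- The Euclidean space `ℝᵈ`. -/
abbrev Pt (d : ℕ) : Type := EuclideanSpace ℝ (Fin d)

variable {d : ℕ}

/-! ### The domain -/

/-- The boundary of `Ω` is Lipschitz: near each boundary point, and in suitable orthonormal
coordinates with last axis `e`, the set `Ω` is the strict epigraph of a Lipschitz function `g` of
the remaining coordinates `y - ⟪e, y⟫ e`. -/
def HasLipschitzBoundary (Ω : Set (Pt d)) : Prop :=
  ∀ x ∈ frontier Ω, ∃ (e : Pt d) (g : Pt d → ℝ) (L : ℝ≥0) (r : ℝ),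
    ‖e‖ = 1 ∧ LipschitzWith L g ∧ 0 < r ∧
    ∀ y ∈ Metric.ball x r, (y ∈ Ω ↔ g (y - ⟪e, y⟫ • e) < ⟪e, y⟫)

/-- Open bounded polytopal domain (nonempty and connected) with Lipschitz boundary. -/
structure IsLipschitzPolytope (Ω : Set (Pt d)) : Prop where
  isOpen : IsOpen Ω
  isConnected : IsConnected Ω
  isBounded : Bornology.IsBounded Ω
  polytopal : ∃ S : Finset (Finset (Pt d)), closure Ω = ⋃ s ∈ S, convexHull ℝ (s : Set (Pt d))
  lipschitz : HasLipschitzBoundary Ω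

/-! ### Lebesgue and Sobolev spaces -/

/-- Membership of a real function in `L²(Ω)`. -/
def MemL2 (Ω : Set (Pt d)) (u : Pt d → ℝ) : Prop := MemLp u 2 (volume.restrict Ω)

/-- The norm of `L²(S)`. -/
def normL2 (S : Set (Pt d)) (u : Pt d → ℝ) : ℝ := lpNorm u 2 (volume.restrict S)

/-- Test functions on `Ω`: the space `C_c^∞(Ω)`. -/
def IsTestFunction (Ω : Set (Pt d)) (φ : Pt d → ℝ) : Prop :=
  ContDiff ℝ ∞ φ ∧ HasCompactSupport φ ∧ tsupport φ ⊆ Ω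

/-- `G` is square integrable on `Ω` and is the weak gradient of `u` on `Ω`. -/
def HasWeakGradient (Ω : Set (Pt d)) (u : Pt d → ℝ) (G : Pt d → Pt d) : Prop :=
  MemLp G 2 (volume.restrict Ω) ∧
  ∀ φ, IsTestFunction Ω φ → ∫ x in Ω, u x • gradient φ x = -∫ x in Ω, φ x • G x

/-- The Sobolev space `H¹(Ω)`. -/
def MemH1 (Ω : Set (Pt d)) (u : Pt d → ℝ) : Prop :=
  MemL2 Ω u ∧ ∃ G, HasWeakGradient Ω u G

open scoped Classical in
/-- The weak gradient `∇u` on `Ω` of a function `u ∈ H¹(Ω)` (well defined up to null sets). -/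
def weakGrad (Ω : Set (Pt d)) (u : Pt d → ℝ) : Pt d → Pt d :=
  if h : ∃ G, HasWeakGradient Ω u G then h.choose else 0

/-- The seminorm `|u|_{H¹(Ω)} = ‖∇u‖_{L²(Ω)}`. -/
def seminormH1 (Ω : Set (Pt d)) (u : Pt d → ℝ) : ℝ :=
  lpNorm (weakGrad Ω u) 2 (volume.restrict Ω)

/-- The space `H¹₀(Ω)`: the closure of `C_c^∞(Ω)` in `H¹(Ω)`, which for a bounded Lipschitz domain
is the space of the functions in `H¹(Ω)` with zero trace. -/
def MemH10 (Ω : Set (Pt d)) (u : Pt d → ℝ) : Prop :=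
  MemH1 Ω u ∧ ∀ ε : ℝ, 0 < ε → ∃ φ, IsTestFunction Ω φ ∧
    normL2 Ω (u - φ) < ε ∧ seminormH1 Ω (u - φ) < ε

/-- The inner product `(u, v)_{L²(Ω)}`. -/
def innerL2 (Ω : Set (Pt d)) (u v : Pt d → ℝ) : ℝ := ∫ x in Ω, u x * v x

/-- The form `(∇u, ∇v)_{L²(Ω)}`. -/
def dirichletForm (Ω : Set (Pt d)) (u v : Pt d → ℝ) : ℝ :=
  ∫ x in Ω, ⟪weakGrad Ω u x, weakGrad Ω v x⟫

/-! ### The continuous optimality system -/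

/-- The projection `Π_{[a,b]}` of a real number. -/
def proj (a b t : ℝ) : ℝ := min b (max a t)

/-- The admissible set `U_ad`. -/
def MemUad (Ω : Set (Pt d)) (a b : ℝ) (u : Pt d → ℝ) : Prop :=
  MemL2 Ω u ∧ ∀ᵐ x ∂volume.restrict Ω, a ≤ u x ∧ u x ≤ b

/-- `lam ∈ ∂ψ(u)` for `ψ : L¹(Ω) → ℝ`, `ψ(u) = ‖u‖_{L¹(Ω)}`; a continuous functional on `L¹(Ω)` is
identified with a function of `L^∞(Ω)`. -/
def IsSubgradient (Ω : Set (Pt d)) (lam u : Pt d → ℝ) : Prop :=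
  MemLp lam ∞ (volume.restrict Ω) ∧
  ∀ w, MemLp w 1 (volume.restrict Ω) →
    innerL2 Ω lam (w - u) ≤ (∫ x in Ω, |w x|) - ∫ x in Ω, |u x|

/-- `(y, p, u)`, with subgradient `lam ∈ ∂ψ(u)`, solves the optimality system of the control
problem. -/
structure IsOptimal (Ω : Set (Pt d)) (α β a b : ℝ) (f yΩ y p u lam : Pt d → ℝ) : Prop where
  memY : MemH10 Ω y
  memP : MemH10 Ω p
  memU : MemUad Ω a b u
  subgradient : IsSubgradient Ω lam u
  state : ∀ v, MemH10 Ω v → dirichletForm Ω y v = innerL2 Ω (u + f) v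
  adjoint : ∀ w, MemH10 Ω w → dirichletForm Ω w p = innerL2 Ω (y - yΩ) w
  variational : ∀ w, MemUad Ω a b w → 0 ≤ innerL2 Ω (p + α • u + β • lam) (w - u)

/-! ### Meshes and discrete spaces -/

/-- The closed simplex with vertex set `s`. -/
def simplex (s : Finset (Pt d)) : Set (Pt d) := convexHull ℝ (s : Set (Pt d))

/-- A conforming partition of `closure Ω` into (finitely many) nondegenerate simplices, each given
by its set of vertices: any two elements meet in their common face, spanned by the common vertices
(possibly empty). -/
structure Mesh (Ω : Set (Pt d)) where
  elements : Finset (Finset (Pt d))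
  card_eq : ∀ s ∈ elements, s.card = d + 1
  indep : ∀ s ∈ elements, AffineIndependent ℝ ((↑) : s → Pt d)
  covers : ⋃ s ∈ elements, simplex s = closure Ω
  conforming : ∀ s ∈ elements, ∀ t ∈ elements,
    simplex s ∩ simplex t = convexHull ℝ ((s : Set (Pt d)) ∩ t)

/-- The mesh size `h_K = diam K`. -/
def size (s : Finset (Pt d)) : ℝ := Metric.diam (simplex s)

/-- Shape regularity with constant `σ`: each element contains a ball of diameter `ρ` with
`h_K ≤ σ ρ`. -/
def Mesh.ShapeRegular {Ω : Set (Pt d)} (T : Mesh Ω) (σ : ℝ) : Prop :=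
  ∀ s ∈ T.elements, ∃ (c : Pt d) (ρ : ℝ), 0 < ρ ∧
    Metric.closedBall c (ρ / 2) ⊆ simplex s ∧ size s ≤ σ * ρ

/-- Polynomial functions of degree at most `ℓ ∈ {0, 1}`. -/
def IsPoly (ℓ : Fin 2) (q : Pt d → ℝ) : Prop :=
  ∃ (c : ℝ) (g : Pt d), (ℓ = 0 → g = 0) ∧ ∀ x, q x = c + ⟪g, x⟫

/-- The space `V(T)` of continuous piecewise linear functions vanishing on `∂Ω`. -/
def Mesh.MemV {Ω : Set (Pt d)} (T : Mesh Ω) (v : Pt d → ℝ) : Prop :=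
  ContinuousOn v (closure Ω) ∧
  (∀ s ∈ T.elements, ∃ q, IsPoly 1 q ∧ EqOn v q (simplex s)) ∧
  ∀ x ∈ frontier Ω, v x = 0

/-- The space `U₀(T)` of piecewise constant functions. -/
def Mesh.MemU0 {Ω : Set (Pt d)} (T : Mesh Ω) (u : Pt d → ℝ) : Prop :=
  MemL2 Ω u ∧
  ∀ s ∈ T.elements, ∃ q, IsPoly 0 q ∧ ∀ᵐ x ∂volume.restrict (simplex s), u x = q x

/-- `lam ∈ ∂ψ(u)` for the restriction `ψ : U₀(T) → ℝ` of the `L¹(Ω)` norm; a functional on `U₀(T)` is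
identified with an element of `U₀(T)` through the `L²(Ω)` inner product. -/
def Mesh.IsDiscreteSubgradient {Ω : Set (Pt d)} (T : Mesh Ω) (lam u : Pt d → ℝ) : Prop :=
  T.MemU0 lam ∧
  ∀ w, T.MemU0 w → innerL2 Ω lam (w - u) ≤ (∫ x in Ω, |w x|) - ∫ x in Ω, |u x|

/-- `(yT, pT, uT)`, with subgradient `lamT ∈ ∂ψ(uT)`, solves the discrete optimality system of the
scheme with piecewise constant controls. -/
structure Mesh.IsDiscreteOptimal {Ω : Set (Pt d)} (T : Mesh Ω) (α β a b : ℝ)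
    (f yΩ yT pT uT lamT : Pt d → ℝ) : Prop where
  memY : T.MemV yT
  memP : T.MemV pT
  memU0 : T.MemU0 uT
  memUad : MemUad Ω a b uT
  subgradient : T.IsDiscreteSubgradient lamT uT
  state : ∀ v, T.MemV v → dirichletForm Ω yT v = innerL2 Ω (uT + f) v
  adjoint : ∀ w, T.MemV w → dirichletForm Ω w pT = innerL2 Ω (yT - yΩ) w
  variational : ∀ w, T.MemU0 w → MemUad Ω a b w →
    0 ≤ innerL2 Ω (pT + α • uT + β • lamT) (w - uT)

/-! ### Error estimators -/

open scoped Classical in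
/-- The elements of the mesh that share a side (a face with `d` vertices) with the element `s`.
The internal sides of `s` are its intersections with these elements. -/
def Mesh.neighbors {Ω : Set (Pt d)} (T : Mesh Ω) (s : Finset (Pt d)) : Finset (Finset (Pt d)) :=
  T.elements.filter fun t => ((s : Set (Pt d)) ∩ t).ncard = d

/-- The side shared by the neighboring elements `s` and `t`. -/
def side (s t : Finset (Pt d)) : Set (Pt d) := convexHull ℝ ((s : Set (Pt d)) ∩ t)

/-- `ν` is a unit normal to the side `γ` of `K` pointing outward `K`. -/
def IsOuterUnitNormal (K γ : Set (Pt d)) (ν : Pt d) : Prop :=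
  ‖ν‖ = 1 ∧ ∀ x ∈ γ, ∀ z ∈ K, ⟪ν, z - x⟫ ≤ 0

open scoped Classical in
/-- The unit normal to the side `γ` of the simplex `K` pointing outward `K` (it is unique). -/
def outerNormal (K γ : Set (Pt d)) : Pt d :=
  if h : ∃ ν, IsOuterUnitNormal K γ ν then h.choose else 0

/-- The jump `⟦∇z · ν⟧` at points of the side shared by `s` and `t`. On the closed simplex `K` the
gradient of `z|_K` is taken, so the value is the trace of the gradient from inside `K`. -/
def jump (z : Pt d → ℝ) (s t : Finset (Pt d)) (x : Pt d) : ℝ :=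
  ⟪outerNormal (simplex s) (side s t), gradientWithin z (simplex s) x⟫ +
  ⟪outerNormal (simplex t) (side s t), gradientWithin z (simplex t) x⟫

/-- `‖⟦∇z · ν⟧‖²_{L²(∂K ∖ ∂Ω)}`, with respect to the `(d-1)`-dimensional surface measure. -/
def Mesh.jumpSq {Ω : Set (Pt d)} (T : Mesh Ω) (z : Pt d → ℝ) (s : Finset (Pt d)) : ℝ :=
  ∑ t ∈ T.neighbors s,
    lpNorm (jump z s t) 2 ((Measure.euclideanHausdorffMeasure (d - 1)).restrict (side s t)) ^ 2

/-- The squared residual indicator `h_K² ‖g‖²_{L²(K)} + h_K ‖⟦∇z · ν⟧‖²_{L²(∂K ∖ ∂Ω)}`. -/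
def Mesh.residualSq {Ω : Set (Pt d)} (T : Mesh Ω) (g z : Pt d → ℝ) (s : Finset (Pt d)) : ℝ :=
  size s ^ 2 * normL2 (simplex s) g ^ 2 + size s * T.jumpSq z s

/-- The auxiliary function `λ̃`, as a function of the discrete adjoint state. -/
def lamTilde (β : ℝ) (pT : Pt d → ℝ) : Pt d → ℝ :=
  fun x => proj (-1) 1 (-(1 / β) * pT x)

/-- The auxiliary function `ũ`, as a function of the discrete adjoint state. -/
def uTilde (α β a b : ℝ) (pT : Pt d → ℝ) : Pt d → ℝ :=
  fun x => proj a b (-(1 / α) * (pT x + β * lamTilde β pT x))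

/-- The squared local indicator `𝓔_K²`, with the weights `Cst, Cad, Cct, Csg`. -/
def Mesh.indicatorSq {Ω : Set (Pt d)} (T : Mesh Ω) (Cst Cad Cct Csg α β a b : ℝ)
    (f yΩ yT pT uT lamT : Pt d → ℝ) (s : Finset (Pt d)) : ℝ :=
  Cst * T.residualSq (uT + f) yT s + Cad * T.residualSq (yT - yΩ) pT s +
  Cct * normL2 (simplex s) (uTilde α β a b pT - uT) ^ 2 +
  Csg * normL2 (simplex s) (lamTilde β pT - lamT) ^ 2

/-- The error estimator `𝓔`. -/
def Mesh.estimator {Ω : Set (Pt d)} (T : Mesh Ω) (Cst Cad Cct Csg α β a b : ℝ)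
    (f yΩ yT pT uT lamT : Pt d → ℝ) : ℝ :=
  Real.sqrt (∑ s ∈ T.elements, T.indicatorSq Cst Cad Cct Csg α β a b f yΩ yT pT uT lamT s)

/-- The energy norm `|||e|||_Ω` of the error `e = (ey, ep, eu, elam)`. -/
def energyNorm (Ω : Set (Pt d)) (ey ep eu elam : Pt d → ℝ) : ℝ :=
  Real.sqrt (seminormH1 Ω ey ^ 2 + seminormH1 Ω ep ^ 2 + normL2 Ω eu ^ 2 + normL2 Ω elam ^ 2)

/-! ### Data oscillation -/

/-- `q` is the `L²(K)`-orthogonal projection of `g` onto the polynomials of degree at most `ℓ`. -/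
def IsL2Projection (ℓ : Fin 2) (K : Set (Pt d)) (g q : Pt d → ℝ) : Prop :=
  IsPoly ℓ q ∧ ∀ r, IsPoly ℓ r → ∫ x in K, (g x - q x) * r x = 0

open scoped Classical in
/-- The projection `Π_K^ℓ(g)` of `g ∈ L²(K)` (it exists and is unique for a simplex `K`). -/
def polyProj (ℓ : Fin 2) (K : Set (Pt d)) (g : Pt d → ℝ) : Pt d → ℝ :=
  if h : ∃ q, IsL2Projection ℓ K g q then h.choose else 0

/-- The oscillation `osc_{T,κ}(g; M)` over a set `M` of elements. -/
def osc (κ : ℕ) (ℓ : Fin 2) (g : Pt d → ℝ) (M : Finset (Finset (Pt d))) : ℝ :=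
  Real.sqrt (∑ s ∈ M,
    size s ^ (2 * (κ + 1)) * normL2 (simplex s) (g - polyProj ℓ (simplex s) g) ^ 2)

end SparseControl

end

open MeasureTheory Set Topology
open scoped ENNReal NNReal ContDiff RealInnerProductSpace

noncomputable section

namespace SparseControl

variable {d : ℕ} {Ω : Set (Pt d)}

/-! ### The `L²` norm -/

section L2
variable {X E : Type*} [MeasurableSpace X] {μ ν : Measure X} [NormedAddCommGroup E]

/-! The estimator splits into two residual indicators, for the state and for the adjoint state, and
two distances `ũ - uT`, `λ̃ - lamT`.

Residuals. State and adjoint state are both weak solutions `z` of a Poisson problem `-Δz = g`,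
approximated by a continuous piecewise affine `zT` with source `gT` (`IsPoissonPair`). For a test
function `η` the weak equation turns `∫ gT η - ∫ ∇zT·∇η` into `∫ ∇(z - zT)·∇η - ∫ (g - gT) η`, which
the error controls (`IsPoissonPair.abs_residual_le`). The functions `η` are translates and dilates
of one smooth radial bump rather than polynomial bubbles. They are therefore genuine test functions,
and all constants scale explicitly, with no reference element. For the element residual the ball
lies inside one simplex: `∇zT` is constant there and `∇η` has mean zero, so only the source remains.
The ball is chosen so that an affine approximation `P` of `gT` has one sign on it and is comparable
to its maximum on the simplex (`exists_ball_sign`, `exists_element_residual_le`). For the jump the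
ball is centered at the barycenter of a facet and is covered by the two neighbors. The gradient
differs between its halves by a multiple of the normal, so testing gives the jump times the flux of
`∇η` through a half-ball (`IsFacetPair.exists_jump_eq`, `exists_jump_residual_le`). The two bounds
are summed over the mesh, each element having at most `d + 1` neighbors
(`exists_sum_residualSq_le`).

Control and subgradient. The continuous optimality conditions hold pointwise: `u` and `lam` are
projections of expressions in `p` (`IsOptimal.pointwise`), and `ũ`, `λ̃` are the same expressions in
`pT`. Projections are 1-Lipschitz, so `ũ - u` and `λ̃ - lam` are bounded by `|p - pT|`, and the
triangle inequality finishes.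

`L²` norms of `p - pT` and `y - yT` are absorbed into `H¹` seminorms by Poincaré's inequality
(`poincare_sub`). The theorem is `estimator_le`. -/

theorem lpNorm_two_sq {f : X → E} (hf : AEStronglyMeasurable f μ) :
    lpNorm f 2 μ ^ 2 = ∫ x, ‖f x‖ ^ 2 ∂μ := by
  rw [lpNorm_eq_integral_norm_rpow_toReal (by simp) (by simp) hf]
  have h0 : 0 ≤ ∫ x, ‖f x‖ ^ (2 : ℝ) ∂μ := integral_nonneg fun x => by positivity
  simp only [ENNReal.toReal_ofNat]
  rw [← Real.rpow_natCast, ← Real.rpow_mul h0]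
  norm_num

theorem lpNorm_two_congr {f g : X → E} (h : f =ᵐ[μ] g) : lpNorm f 2 μ = lpNorm g 2 μ := by
  by_cases hf : AEStronglyMeasurable f μ
  · rw [← toReal_eLpNorm hf, ← toReal_eLpNorm (hf.congr h), eLpNorm_congr_ae h]
  · rw [lpNorm_of_not_aestronglyMeasurable hf,
      lpNorm_of_not_aestronglyMeasurable fun hg => hf (hg.congr h.symm)]

theorem lpNorm_two_mono_ae {F : Type*} [NormedAddCommGroup F] {f : X → E} {g : X → F}
    (hg : MemLp g 2 μ) (h : ∀ᵐ x ∂μ, ‖f x‖ ≤ ‖g x‖) : lpNorm f 2 μ ≤ lpNorm g 2 μ := by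
  by_cases hf : AEStronglyMeasurable f μ
  · rw [← toReal_eLpNorm hf, ← toReal_eLpNorm hg.1]
    exact ENNReal.toReal_mono hg.2.ne (eLpNorm_mono_ae h)
  -- By convention `lpNorm` is `0` on functions that are not a.e. strongly measurable.
  · rw [lpNorm_of_not_aestronglyMeasurable hf]; exact lpNorm_nonneg

theorem lpNorm_two_mono_measure {f : X → E} (hf : MemLp f 2 ν) (h : μ ≤ ν) :
    lpNorm f 2 μ ≤ lpNorm f 2 ν := by
  rw [← toReal_eLpNorm (hf.mono_measure h).1, ← toReal_eLpNorm hf.1]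
  exact ENNReal.toReal_mono hf.2.ne (eLpNorm_mono_measure f h)

theorem integral_norm_mul_norm_le {F : Type*} [NormedAddCommGroup F] {f : X → E} {g : X → F}
    (hf : MemLp f 2 μ) (hg : MemLp g 2 μ) :
    ∫ x, ‖f x‖ * ‖g x‖ ∂μ ≤ lpNorm f 2 μ * lpNorm g 2 μ := by
  have h := integral_mul_norm_le_Lp_mul_Lq (μ := μ) (f := fun x => ‖f x‖) (g := fun x => ‖g x‖)
    Real.HolderConjugate.two_two (by simpa using hf.norm) (by simpa using hg.norm)
  rw [lpNorm_eq_integral_norm_rpow_toReal (by simp) (by simp) hf.1,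
    lpNorm_eq_integral_norm_rpow_toReal (by simp) (by simp) hg.1]
  simpa using h

theorem integrable_inner_of_memLp {F : Type*} [NormedAddCommGroup F] [InnerProductSpace ℝ F]
    {f g : X → F} (hf : MemLp f 2 μ) (hg : MemLp g 2 μ) : Integrable (fun x => ⟪f x, g x⟫) μ :=
  (hf.norm.integrable_mul hg.norm).mono' (hf.1.inner hg.1)
    (.of_forall fun _ => abs_real_inner_le_norm _ _)

theorem abs_integral_inner_le {F : Type*} [NormedAddCommGroup F] [InnerProductSpace ℝ F]
    {f g : X → F} (hf : MemLp f 2 μ) (hg : MemLp g 2 μ) :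
    |∫ x, ⟪f x, g x⟫ ∂μ| ≤ lpNorm f 2 μ * lpNorm g 2 μ := by
  refine le_trans ?_ (integral_norm_mul_norm_le hf hg)
  refine (abs_integral_le_integral_abs).trans ?_
  refine integral_mono_of_nonneg (.of_forall fun x => abs_nonneg _) ?_
    (.of_forall fun x => abs_real_inner_le_norm _ _)
  exact hf.norm.integrable_mul hg.norm

theorem abs_integral_mul_le {f g : X → ℝ} (hf : MemLp f 2 μ) (hg : MemLp g 2 μ) :
    |∫ x, f x * g x ∂μ| ≤ lpNorm f 2 μ * lpNorm g 2 μ := by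
  have := abs_integral_inner_le hf hg
  simpa [mul_comm] using this

/-- A function bounded by `M` on a set of measure at most `m`. -/
theorem lpNorm_two_le_of_bound {f : X → E} [IsFiniteMeasure μ] {M : ℝ}
    (h : ∀ᵐ x ∂μ, ‖f x‖ ≤ M) : lpNorm f 2 μ ^ 2 ≤ M ^ 2 * μ.real univ := by
  by_cases hf : AEStronglyMeasurable f μ
  · rw [lpNorm_two_sq hf]
    calc ∫ x, ‖f x‖ ^ 2 ∂μ ≤ ∫ _x, M ^ 2 ∂μ :=
          integral_mono_of_nonneg (.of_forall fun x => sq_nonneg _) (integrable_const _)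
            (h.mono fun x hx => pow_le_pow_left₀ (norm_nonneg _) hx 2)
      _ = M ^ 2 * μ.real univ := by simp [mul_comm]
  · rw [lpNorm_of_not_aestronglyMeasurable hf, zero_pow two_ne_zero]; positivity

end L2


/-! ### Weak gradients -/

theorem gradient_continuous {φ : Pt d → ℝ} (h : ContDiff ℝ ∞ φ) : Continuous (gradient φ) := by
  have : Continuous (fderiv ℝ φ) := h.continuous_fderiv (by simp)
  exact (InnerProductSpace.toDual ℝ (Pt d)).symm.continuous.comp this

theorem support_gradient_subset (φ : Pt d → ℝ) :
    Function.support (gradient φ) ⊆ tsupport φ := by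
  intro x hx
  by_contra h
  apply hx
  have := fderiv_of_notMem_tsupport (𝕜 := ℝ) h
  simp [gradient, this]

theorem hasCompactSupport_gradient {φ : Pt d → ℝ} (h : HasCompactSupport φ) :
    HasCompactSupport (gradient φ) :=
  HasCompactSupport.intro h fun x hx => by
    by_contra h'
    exact hx (support_gradient_subset φ h')

/-- Fundamental lemma of the calculus of variations: `G - G'` integrates to zero against every test
function. The integral of `u ∇φ` is the same number on both sides, so no integrability of `u` is
needed. -/
theorem HasWeakGradient.unique (hΩ : IsOpen Ω) {u : Pt d → ℝ} {G G' : Pt d → Pt d}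
    (h : HasWeakGradient Ω u G) (h' : HasWeakGradient Ω u G') :
    G =ᵐ[volume.restrict Ω] G' := by
  have hD : MemLp (G - G') 2 (volume.restrict Ω) := h.1.sub h'.1
  have hloc : LocallyIntegrableOn (G - G') Ω volume :=
    locallyIntegrableOn_of_locallyIntegrable_restrict (hD.locallyIntegrable (by norm_num))
  have key := hΩ.ae_eq_zero_of_integral_contDiff_smul_eq_zero hloc fun φ h1 h2 h3 => by
    have hφ : IsTestFunction Ω φ := ⟨h1, h2, h3⟩
    have i2 : ∀ {K : Pt d → Pt d}, MemLp K 2 (volume.restrict Ω) →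
        Integrable (fun x => φ x • K x) (volume.restrict Ω) := fun hK =>
      memLp_one_iff_integrable.1
        (hK.smul (h1.continuous.memLp_of_hasCompactSupport (p := 2) h2))
    rw [← setIntegral_eq_integral_of_forall_compl_eq_zero (s := Ω)]
    · simp_rw [Pi.sub_apply, smul_sub]
      rw [integral_sub (i2 h.1) (i2 h'.1), sub_eq_zero, ← neg_inj, ← h.2 φ hφ, ← h'.2 φ hφ]
    · intro x hx
      rw [image_eq_zero_of_notMem_tsupport fun hx' => hx (h3 hx'), zero_smul]
  rw [Filter.EventuallyEq, ae_restrict_iff' hΩ.measurableSet]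
  filter_upwards [key] with x hx hxΩ
  exact sub_eq_zero.1 (hx hxΩ)

theorem HasWeakGradient.weakGrad_ae_eq (hΩ : IsOpen Ω) {u : Pt d → ℝ} {G : Pt d → Pt d}
    (h : HasWeakGradient Ω u G) : weakGrad Ω u =ᵐ[volume.restrict Ω] G := by
  have hex : ∃ G, HasWeakGradient Ω u G := ⟨G, h⟩
  rw [weakGrad, dif_pos hex]
  exact HasWeakGradient.unique hΩ hex.choose_spec h

theorem MemH1.hasWeakGradient {u : Pt d → ℝ} (h : MemH1 Ω u) :
    HasWeakGradient Ω u (weakGrad Ω u) := by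
  rw [weakGrad, dif_pos h.2]
  exact h.2.choose_spec

theorem HasWeakGradient.congr (hm : MeasurableSet Ω) {u v : Pt d → ℝ} {G : Pt d → Pt d}
    (h : HasWeakGradient Ω u G) (huv : ∀ x ∈ Ω, u x = v x) : HasWeakGradient Ω v G := by
  refine ⟨h.1, fun φ hφ => ?_⟩
  rw [← h.2 φ hφ]
  exact setIntegral_congr_fun hm fun x hx => by simp only [huv x hx]

theorem memLp_gradient_of_test {φ : Pt d → ℝ} (h : IsTestFunction Ω φ) (p : ℝ≥0∞)
    (μ : Measure (Pt d)) [IsFiniteMeasureOnCompacts μ] : MemLp (gradient φ) p μ :=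
  (gradient_continuous h.1).memLp_of_hasCompactSupport (hasCompactSupport_gradient h.2.1)

theorem memLp_of_test {φ : Pt d → ℝ} (h : IsTestFunction Ω φ) (p : ℝ≥0∞)
    (μ : Measure (Pt d)) [IsFiniteMeasureOnCompacts μ] : MemLp φ p μ :=
  h.1.continuous.memLp_of_hasCompactSupport h.2.1

/-- `HasWeakGradient` does not contain the integrability of `u`, and integrals of non-integrable
functions are `0`; the `L²` assumptions make the integral additive. -/
theorem HasWeakGradient.sub {u v : Pt d → ℝ} {G H : Pt d → Pt d}
    (hu : MemL2 Ω u) (hv : MemL2 Ω v)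
    (h : HasWeakGradient Ω u G) (h' : HasWeakGradient Ω v H) :
    HasWeakGradient Ω (u - v) (G - H) := by
  refine ⟨h.1.sub h'.1, fun φ hφ => ?_⟩
  have i1 : ∀ {w : Pt d → ℝ}, MemL2 Ω w →
      Integrable (fun x => w x • gradient φ x) (volume.restrict Ω) := fun hw =>
    memLp_one_iff_integrable.1 ((memLp_gradient_of_test hφ 2 _).smul hw)
  have i2 : ∀ {K : Pt d → Pt d}, MemLp K 2 (volume.restrict Ω) →
      Integrable (fun x => φ x • K x) (volume.restrict Ω) := fun hK =>
    memLp_one_iff_integrable.1 (hK.smul (memLp_of_test hφ 2 _))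
  have e1 : ∀ x, (u - v) x • gradient φ x = u x • gradient φ x - v x • gradient φ x := fun x => by
    simp [sub_smul]
  have e2 : ∀ x, φ x • (G - H) x = φ x • G x - φ x • H x := fun x => by simp [smul_sub]
  simp_rw [e1, e2]
  rw [integral_sub (i1 hu) (i1 hv), integral_sub (i2 h.1) (i2 h'.1), h.2 φ hφ, h'.2 φ hφ]
  abel

theorem norm_gradient_le_of_lipschitz {w : Pt d → ℝ} {C : ℝ≥0} (hw : LipschitzWith C w)
    (x : Pt d) : ‖gradient w x‖ ≤ C := by
  rw [gradient, LinearIsometryEquiv.norm_map]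
  exact norm_fderiv_le_of_lipschitz ℝ hw

theorem measurable_gradient (w : Pt d → ℝ) : Measurable (gradient w) :=
  (InnerProductSpace.toDual ℝ (Pt d)).symm.continuous.measurable.comp (measurable_fderiv ℝ w)

theorem lineDeriv_ae_eq_inner_gradient {w : Pt d → ℝ} {C : ℝ≥0} (hw : LipschitzWith C w)
    (e : Pt d) : ∀ᵐ x, lineDeriv ℝ w x e = ⟪gradient w x, e⟫ := by
  filter_upwards [hw.ae_differentiableAt] with x hx
  rw [hx.lineDeriv_eq_fderiv]
  simp [gradient]

theorem IsTestFunction.lipschitz {φ : Pt d → ℝ} (h : IsTestFunction Ω φ) :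
    ∃ C : ℝ≥0, LipschitzWith C φ :=
  h.1.lipschitzWith_of_hasCompactSupport h.2.1 (by simp)

/-- A Lipschitz function on a bounded open set has its (Rademacher) gradient as weak gradient. -/
theorem hasWeakGradient_of_lipschitz (hb : Bornology.IsBounded Ω)
    {w : Pt d → ℝ} {C : ℝ≥0} (hw : LipschitzWith C w) : HasWeakGradient Ω w (gradient w) := by
  have : IsFiniteMeasure (volume.restrict Ω) := ⟨by simpa using hb.measure_lt_top⟩
  have hG : MemLp (gradient w) 2 (volume.restrict Ω) :=
    MemLp.of_bound (measurable_gradient w).aestronglyMeasurable C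
      (.of_forall (norm_gradient_le_of_lipschitz hw))
  refine ⟨hG, fun φ hφ => ?_⟩
  obtain ⟨D, hD⟩ := hφ.lipschitz
  have hwc := hw.continuous
  have i1 : Integrable (fun x => w x • gradient φ x) (volume.restrict Ω) :=
    ((hwc.smul (gradient_continuous hφ.1)).integrable_of_hasCompactSupport
      (hasCompactSupport_gradient hφ.2.1).smul_left).restrict
  have i2 : Integrable (fun x => φ x • gradient w x) (volume.restrict Ω) :=
    memLp_one_iff_integrable.1 (hG.smul (memLp_of_test hφ 2 _))
  -- Against a fixed direction `e` the vector identity becomes integration by parts for line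
  -- derivatives of Lipschitz functions. The integrals extend to the whole space because `φ` is
  -- supported in `Ω`.
  refine ext_inner_right ℝ fun e => ?_
  rw [inner_neg_left, real_inner_comm, ← integral_inner i1, real_inner_comm, ← integral_inner i2,
    setIntegral_eq_integral_of_forall_compl_eq_zero, setIntegral_eq_integral_of_forall_compl_eq_zero]
  · have h := LipschitzWith.integral_lineDeriv_mul_eq (μ := volume) hw hD hφ.2.1 e
    calc ∫ x, ⟪e, w x • gradient φ x⟫ = ∫ x, -(lineDeriv ℝ φ x (-e) * w x) := by
          refine integral_congr_ae ((lineDeriv_ae_eq_inner_gradient hD (-e)).mono fun x hx => ?_)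
          simp only [hx, inner_smul_right, inner_neg_right, real_inner_comm]; ring
      _ = -∫ x, lineDeriv ℝ w x e * φ x := by rw [integral_neg, h]
      _ = -∫ x, ⟪e, φ x • gradient w x⟫ := by
          congr 1
          refine integral_congr_ae ((lineDeriv_ae_eq_inner_gradient hw e).mono fun x hx => ?_)
          simp only [hx, inner_smul_right, real_inner_comm]; ring
  · intro x hx
    have : x ∉ tsupport φ := fun h => hx (hφ.2.2 h)
    simp [image_eq_zero_of_notMem_tsupport this]
  · intro x hx
    have : gradient φ x = 0 := by
      by_contra h
      exact hx (hφ.2.2 (support_gradient_subset φ h))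
    simp [this]

theorem IsTestFunction.hasWeakGradient (hb : Bornology.IsBounded Ω) {φ : Pt d → ℝ}
    (h : IsTestFunction Ω φ) : HasWeakGradient Ω φ (gradient φ) :=
  hasWeakGradient_of_lipschitz hb h.lipschitz.choose_spec

theorem memL2_of_lipschitz (hb : Bornology.IsBounded Ω) {w : Pt d → ℝ} {C : ℝ≥0}
    (hw : LipschitzWith C w) : MemL2 Ω w := by
  have : IsFiniteMeasure (volume.restrict Ω) := ⟨by simpa using hb.measure_lt_top⟩
  obtain ⟨M, hM⟩ := (hb.isCompact_closure.image hw.continuous).isBounded.exists_norm_le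
  suffices h : MemLp w 2 (volume.restrict (closure Ω)) from
    h.mono_measure (Measure.restrict_mono subset_closure le_rfl)
  have : IsFiniteMeasure (volume.restrict (closure Ω)) :=
    ⟨by simpa using hb.isCompact_closure.measure_lt_top⟩
  refine MemLp.of_bound hw.continuous.aestronglyMeasurable M ?_
  rw [ae_restrict_iff' isClosed_closure.measurableSet]
  exact .of_forall fun x hx => hM _ (mem_image_of_mem w hx)

theorem seminormH1_eq (hΩ : IsOpen Ω) {u : Pt d → ℝ} {G : Pt d → Pt d}
    (h : HasWeakGradient Ω u G) : seminormH1 Ω u = lpNorm G 2 (volume.restrict Ω) :=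
  lpNorm_two_congr (h.weakGrad_ae_eq hΩ)

theorem IsTestFunction.memH10 (hΩ : IsOpen Ω) (hb : Bornology.IsBounded Ω) {φ : Pt d → ℝ}
    (h : IsTestFunction Ω φ) : MemH10 Ω φ := by
  have h2 := memLp_of_test h 2 (volume.restrict Ω)
  refine ⟨⟨h2, _, h.hasWeakGradient hb⟩, fun ε hε => ⟨φ, h, ?_, ?_⟩⟩
  · simp [normL2, hε]
  · have := (h.hasWeakGradient hb).sub h2 h2 (h.hasWeakGradient hb)
    rw [seminormH1_eq hΩ this]
    simp [hε]

/-- Poincaré's inequality for Lipschitz functions that vanish off `Ω`. -/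
theorem poincare_lipschitz (hd : 0 < d) (hΩ : IsOpen Ω) {D : ℝ} (hD : 0 ≤ D)
    (hΩD : Ω ⊆ Metric.closedBall 0 D) {w : Pt d → ℝ} {C : ℝ≥0} (hw : LipschitzWith C w)
    (hw0 : ∀ x ∉ Ω, w x = 0) :
    normL2 Ω w ≤ 2 * D * lpNorm (gradient w) 2 (volume.restrict Ω) := by
  have hb : Bornology.IsBounded Ω := Metric.isBounded_closedBall.subset hΩD
  have hc : HasCompactSupport w := HasCompactSupport.intro (isCompact_closedBall (0 : Pt d) D)
    fun x hx => hw0 x fun h => hx (hΩD h)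
  obtain ⟨M, hM⟩ := hw.continuous.bounded_above_of_compact_support hc
  -- The linear function `⟪e, x⟫` has derivative `1` along `e` and is at most `D` on `Ω`.
  -- Integrating `w²` by parts against it gives `‖w‖² ≤ 2D ‖w‖ ‖∇w‖`.
  set e : Pt d := EuclideanSpace.single ⟨0, hd⟩ 1 with he
  have hen : ‖e‖ = 1 := by simp [he]
  have hsq : LipschitzWith (Real.toNNReal (C * (M + M))) fun x => w x ^ 2 := by
    refine LipschitzWith.of_dist_le_mul fun x y => ?_
    have hM0 : 0 ≤ M := (norm_nonneg _).trans (hM 0)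
    rw [Real.coe_toNNReal _ (by positivity), Real.dist_eq, sq_sub_sq, abs_mul, mul_comm (C : ℝ),
      mul_assoc]
    gcongr
    · exact (abs_add_le _ _).trans (add_le_add (hM x) (hM y))
    · exact hw.dist_le_mul x y
  have hin : LipschitzWith 1 fun x : Pt d => ⟪e, x⟫ := by
    refine LipschitzWith.of_dist_le_mul fun x y => ?_
    rw [Real.dist_eq, ← inner_sub_right, NNReal.coe_one, one_mul, dist_eq_norm]
    simpa [hen] using abs_real_inner_le_norm e (x - y)
  have hparts := LipschitzWith.integral_lineDeriv_mul_eq (μ := (volume : Measure (Pt d))) hin hsq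
    (hc.comp_left (g := fun t : ℝ => t ^ 2) (by simp)) e
  have hG := (hasWeakGradient_of_lipschitz hb hw).1
  have hwL : MemL2 Ω w := memL2_of_lipschitz hb hw
  have e1 : ∀ x, lineDeriv ℝ (fun x : Pt d => ⟪e, x⟫) x e = 1 := fun x => by
    have hf : HasFDerivAt (fun x : Pt d => ⟪e, x⟫) (innerSL ℝ e) x := (innerSL ℝ e).hasFDerivAt
    rw [hf.hasLineDerivAt e |>.lineDeriv]
    simp [hen]
  have e2 : ∀ᵐ x, lineDeriv ℝ (fun x => w x ^ 2) x (-e) = -(2 * w x * ⟪gradient w x, e⟫) := by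
    filter_upwards [hw.ae_differentiableAt] with x hx
    have hf : HasFDerivAt (fun x => w x ^ 2) _ x := hx.hasFDerivAt.pow 2
    rw [hf.hasLineDerivAt (-e) |>.lineDeriv]
    simp [gradient]
  have key : lpNorm w 2 (volume.restrict Ω) ^ 2 ≤
      2 * D * (lpNorm w 2 (volume.restrict Ω) * lpNorm (gradient w) 2 (volume.restrict Ω)) := by
    rw [lpNorm_two_sq hwL.1]
    calc ∫ x in Ω, ‖w x‖ ^ 2 = ∫ x, lineDeriv ℝ (fun x : Pt d => ⟪e, x⟫) x e * w x ^ 2 := by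
          rw [setIntegral_eq_integral_of_forall_compl_eq_zero fun x hx => by simp [hw0 x hx]]
          simp [e1]
      _ = ∫ x, -(2 * w x * ⟪gradient w x, e⟫) * ⟪e, x⟫ := by
          rw [hparts]
          exact integral_congr_ae (e2.mono fun x hx => by simp only [hx])
      _ = ∫ x in Ω, -(2 * w x * ⟪gradient w x, e⟫) * ⟪e, x⟫ := by
          rw [setIntegral_eq_integral_of_forall_compl_eq_zero fun x hx => by simp [hw0 x hx]]
      _ ≤ ∫ x in Ω, 2 * D * (‖w x‖ * ‖gradient w x‖) := by
          refine (le_abs_self _).trans (abs_integral_le_integral_abs.trans ?_)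
          refine integral_mono_of_nonneg (.of_forall fun x => abs_nonneg _)
            ((hwL.norm.integrable_mul hG.norm).const_mul _) ?_
          refine (ae_restrict_iff' hΩ.measurableSet).2 (.of_forall fun x hx => ?_)
          have h1 : |⟪gradient w x, e⟫| ≤ ‖gradient w x‖ := by
            simpa [hen] using abs_real_inner_le_norm (gradient w x) e
          have h2 : |⟪e, x⟫| ≤ D := by
            have := hΩD hx
            rw [mem_closedBall_zero_iff] at this
            exact (abs_real_inner_le_norm e x).trans (by simpa [hen] using this)
          calc |-(2 * w x * ⟪gradient w x, e⟫) * ⟪e, x⟫|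
              = 2 * ‖w x‖ * |⟪gradient w x, e⟫| * |⟪e, x⟫| := by
                simp [abs_mul]
            _ ≤ 2 * ‖w x‖ * ‖gradient w x‖ * D := by gcongr
            _ = 2 * D * (‖w x‖ * ‖gradient w x‖) := by ring
      _ = 2 * D * ∫ x in Ω, ‖w x‖ * ‖gradient w x‖ := by rw [integral_const_mul]
      _ ≤ _ := by gcongr; exact integral_norm_mul_norm_le hwL hG
  change lpNorm w 2 (volume.restrict Ω) ≤ _
  -- `key` is quadratic in the norm of `w`; one factor cancels unless it is zero.
  rcases (lpNorm_nonneg (f := w) (p := 2) (μ := volume.restrict Ω)).eq_or_lt with h0 | h0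
  · rw [← h0]; have := lpNorm_nonneg (f := gradient w) (p := 2) (μ := volume.restrict Ω); positivity
  · refine le_of_mul_le_mul_left ?_ h0
    nlinarith [key]

/-- Poincaré's inequality for the difference of a function in `H¹₀(Ω)` and a Lipschitz function
that vanishes off `Ω`. -/
theorem poincare_sub (hd : 0 < d) (hΩ : IsOpen Ω) {D : ℝ} (hD : 0 ≤ D)
    (hΩD : Ω ⊆ Metric.closedBall 0 D) {w : Pt d → ℝ} {C : ℝ≥0} (hw : LipschitzWith C w)
    (hw0 : ∀ x ∉ Ω, w x = 0) {y : Pt d → ℝ} (hy : MemH10 Ω y) :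
    normL2 Ω (y - w) ≤ 2 * D * seminormH1 Ω (y - w) := by
  have hb : Bornology.IsBounded Ω := Metric.isBounded_closedBall.subset hΩD
  refine le_of_forall_pos_le_add fun ε hε => ?_
  -- Replacing `y` by `φ` costs `‖y - φ‖` once and `2D` times the seminorm of `y - φ`, hence the
  -- denominator `1 + 2D`. The function `φ - w` is Lipschitz and vanishes off `Ω`, so the previous
  -- inequality applies to it.
  obtain ⟨φ, hφ, h1, h2⟩ := hy.2 (ε / (1 + 2 * D)) (by positivity)
  obtain ⟨K, hK⟩ := hφ.lipschitz
  have hφw : LipschitzWith (K + C) (φ - w) := hK.sub hw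
  have hP := poincare_lipschitz hd hΩ hD hΩD hφw fun x hx => by
    simp [hw0 x hx, image_eq_zero_of_notMem_tsupport fun h => hx (hφ.2.2 h)]
  rw [← seminormH1_eq hΩ (hasWeakGradient_of_lipschitz hb hφw)] at hP
  have gy := hy.1.hasWeakGradient
  have gw := hasWeakGradient_of_lipschitz hb hw
  have mw := memL2_of_lipschitz hb hw
  have gφ := hφ.hasWeakGradient hb
  have mφ := memLp_of_test hφ 2 (volume.restrict Ω)
  have s1 : normL2 Ω (y - w) ≤ normL2 Ω (y - φ) + normL2 Ω (φ - w) :=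
    lpNorm_sub_le_lpNorm_sub_add_lpNorm_sub hy.1.1 mφ (by norm_num)
  have s2 : seminormH1 Ω (φ - w) ≤ seminormH1 Ω (y - φ) + seminormH1 Ω (y - w) := by
    rw [seminormH1_eq hΩ (gφ.sub mφ mw gw), seminormH1_eq hΩ (gy.sub hy.1.1 mφ gφ),
      seminormH1_eq hΩ (gy.sub hy.1.1 mw gw), lpNorm_sub_comm (weakGrad Ω y)]
    exact lpNorm_sub_le_lpNorm_sub_add_lpNorm_sub gφ.1 gy.1 (by norm_num)
  have h3 : ε / (1 + 2 * D) * (1 + 2 * D) = ε := div_mul_cancel₀ _ (by positivity)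
  nlinarith [mul_le_mul_of_nonneg_left s2 hD, mul_le_mul_of_nonneg_left h2.le hD]

/-! ### Barycentric coordinates -/

/-- The affine functions `x ↦ c v + ⟪G v, x⟫`, `v ∈ s`, are the barycentric coordinates of the
simplex with vertex set `s`. -/
structure IsBary (s : Finset (Pt d)) (c : Pt d → ℝ) (G : Pt d → Pt d) : Prop where
  self : ∀ v ∈ s, c v + ⟪G v, v⟫ = 1
  other : ∀ v ∈ s, ∀ w ∈ s, v ≠ w → c v + ⟪G v, w⟫ = 0
  sum_eq : ∀ x, ∑ v ∈ s, (c v + ⟪G v, x⟫) = 1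
  sum_smul : ∀ x, ∑ v ∈ s, (c v + ⟪G v, x⟫) • v = x
  mem_iff : ∀ x, x ∈ simplex s ↔ ∀ v ∈ s, 0 ≤ c v + ⟪G v, x⟫

/-- The vertices are `d + 1` affinely independent points, hence an affine basis; the linear parts of
its coordinates are represented by vectors through Riesz. Off `s` the values are an irrelevant `0`.
-/
theorem exists_isBary {s : Finset (Pt d)} (hc : s.card = d + 1)
    (hi : AffineIndependent ℝ ((↑) : s → Pt d)) : ∃ c G, IsBary s c G := by
  classical
  have htop : affineSpan ℝ (range ((↑) : s → Pt d)) = ⊤ :=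
    hi.affineSpan_eq_top_iff_card_eq_finrank_add_one.2 (by simp [hc])
  let b : AffineBasis s ℝ (Pt d) := ⟨(↑), hi, htop⟩
  have hb : ∀ i : s, b i = (i : Pt d) := fun i => rfl
  have hrep : ∀ i : s, ∃ g : Pt d, ∀ x, b.coord i x = b.coord i 0 + ⟪g, x⟫ := fun i => by
    refine ⟨(InnerProductSpace.toDual ℝ (Pt d)).symm
      (LinearMap.toContinuousLinearMap (b.coord i).linear), fun x => ?_⟩
    rw [InnerProductSpace.toDual_symm_apply]
    have := (b.coord i).map_vadd 0 x
    simp only [vadd_eq_add, add_zero] at this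
    rw [this, add_comm]; rfl
  choose g hg using hrep
  let c' : Pt d → ℝ := fun v => if h : v ∈ s then b.coord ⟨v, h⟩ 0 else 0
  let G' : Pt d → Pt d := fun v => if h : v ∈ s then g ⟨v, h⟩ else 0
  have key : ∀ v (h : v ∈ s) x, c' v + ⟪G' v, x⟫ = b.coord ⟨v, h⟩ x := fun v h x => by
    simp only [c', G', dif_pos h]; rw [hg ⟨v, h⟩ x]
  refine ⟨c', G', ⟨fun v h => ?_, fun v h w hw hne => ?_, fun x => ?_, fun x => ?_, fun x => ?_⟩⟩
  · rw [key v h]; exact b.coord_apply_eq ⟨v, h⟩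
  · rw [key v h]; exact b.coord_apply_ne (i := ⟨v, h⟩) (j := ⟨w, hw⟩) (by simpa using hne)
  · rw [← s.sum_coe_sort, ← b.sum_coord_apply_eq_one x]
    exact Finset.sum_congr rfl fun i _ => key i i.2 x
  · rw [← s.sum_coe_sort]
    conv_rhs => rw [← b.linear_combination_coord_eq_self x]
    exact Finset.sum_congr rfl fun i _ => by rw [key i i.2 x, hb]
  · have := b.convexHull_eq_nonneg_coord
    have hr : range b = (s : Set (Pt d)) := by
      change range ((↑) : s → Pt d) = _; simp
    rw [hr] at this
    rw [simplex, this, mem_ofPred_eq]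
    exact ⟨fun h v hv => by rw [key v hv]; exact h _, fun h i => by
      rw [← key i i.2]; exact h i i.2⟩

theorem eq_of_affine_eq {c c' : ℝ} {g g' : Pt d} (h : ∀ x, c + ⟪g, x⟫ = c' + ⟪g', x⟫) : g = g' := by
  have h0 := h 0
  simp only [inner_zero_right, add_zero] at h0
  refine ext_inner_right ℝ fun x => ?_
  have := h x
  linarith

namespace IsBary
variable {s : Finset (Pt d)} {c : Pt d → ℝ} {G : Pt d → Pt d}

theorem affine_eq (h : IsBary s c G) (a : ℝ) (g x : Pt d) :
    a + ⟪g, x⟫ = ∑ v ∈ s, (c v + ⟪G v, x⟫) * (a + ⟪g, v⟫) := by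
  simp_rw [mul_add, Finset.sum_add_distrib, ← Finset.sum_mul, h.sum_eq, one_mul]
  congr 1
  conv_lhs => rw [← h.sum_smul x, inner_sum]
  exact Finset.sum_congr rfl fun v _ => by rw [inner_smul_right]

/-- An affine function is determined by its vertex values. This is how neighbors are compared:
whatever vanishes on their common facet is a multiple of one barycentric coordinate. -/
theorem affine_eq_of_vanish (h : IsBary s c G) {v : Pt d} (hv : v ∈ s) {a : ℝ} {g : Pt d}
    (h0 : ∀ w ∈ s, w ≠ v → a + ⟪g, w⟫ = 0) (x : Pt d) :
    a + ⟪g, x⟫ = (a + ⟪g, v⟫) * (c v + ⟪G v, x⟫) := by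
  rw [h.affine_eq a g x, Finset.sum_eq_single_of_mem v hv fun w hw hne => by
    rw [h0 w hw hne, mul_zero], mul_comm]

theorem grad_eq_of_vanish (h : IsBary s c G) {v : Pt d} (hv : v ∈ s) {a : ℝ} {g : Pt d}
    (h0 : ∀ w ∈ s, w ≠ v → a + ⟪g, w⟫ = 0) : g = (a + ⟪g, v⟫) • G v :=
  eq_of_affine_eq (c := a) (c' := (a + ⟪g, v⟫) * c v) fun x => by
    rw [h.affine_eq_of_vanish hv h0 x, inner_smul_left]; simp; ring

theorem le_one (h : IsBary s c G) {v x : Pt d} (hv : v ∈ s) (hx : x ∈ simplex s) :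
    c v + ⟪G v, x⟫ ≤ 1 := by
  rw [← h.sum_eq x]
  exact Finset.single_le_sum (f := fun v => c v + ⟪G v, x⟫) ((h.mem_iff x).1 hx) hv

/-- A barycentric coordinate stays in `[0, 1]` on the simplex, yet along the diameter of the ball
parallel to `G v` it varies by `‖G v‖ ρ`. -/
theorem norm_mul_le (h : IsBary s c G) {v : Pt d} (hv : v ∈ s) {z : Pt d} {ρ : ℝ} (hρ : 0 < ρ)
    (hb : Metric.closedBall z (ρ / 2) ⊆ simplex s) : ‖G v‖ * ρ ≤ 1 := by
  rcases eq_or_ne (G v) 0 with h0 | h0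
  · simp [h0]
  have hn : 0 < ‖G v‖ := norm_pos_iff.2 h0
  set e : Pt d := (ρ / 2 * ‖G v‖⁻¹) • G v with he
  have hen : ‖e‖ = ρ / 2 := by
    rw [he, norm_smul, Real.norm_of_nonneg (by positivity)]; field_simp
  have h1 : z + e ∈ simplex s := hb (by simp [hen])
  have h2 : z - e ∈ simplex s := hb (by simp [hen])
  have h3 := h.le_one hv h1
  have h4 := (h.mem_iff _).1 h2 v hv
  have h5 : ⟪G v, e⟫ = ρ / 2 * ‖G v‖ := by
    rw [he, inner_smul_right, real_inner_self_eq_norm_sq]; field_simp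
  rw [inner_add_right, h5] at h3
  rw [inner_sub_right, h5] at h4
  linarith

/-- The coordinate of `u` falls from `1` at `u` to `0` at `w` with slope at most `1 / ρ`, so no edge
is shorter than the inscribed ball. Through a common edge this compares the sizes of neighbors. -/
theorem le_dist (h : IsBary s c G) {z : Pt d} {ρ : ℝ} (hρ : 0 < ρ)
    (hb : Metric.closedBall z (ρ / 2) ⊆ simplex s) {u w : Pt d} (hu : u ∈ s) (hw : w ∈ s)
    (hne : u ≠ w) : ρ ≤ dist u w := by
  have h1 := h.self u hu
  have h2 := h.other u hu w hw hne
  have h3 := h.norm_mul_le hu hρ hb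
  have h4 : 1 ≤ ‖G u‖ * dist u w := by
    have : ⟪G u, u - w⟫ = 1 := by rw [inner_sub_right]; linarith
    rw [← this, dist_eq_norm]
    exact real_inner_le_norm _ _
  have h5 : 0 < ‖G u‖ := by
    rcases (norm_nonneg (G u)).eq_or_lt with h0 | h0
    · rw [← h0, zero_mul] at h4; linarith
    · exact h0
  exact le_of_mul_le_mul_left (h3.trans h4) h5

theorem grad_ne_zero (h : IsBary s c G) {v w : Pt d} (hv : v ∈ s) (hw : w ∈ s) (hne : v ≠ w) :
    G v ≠ 0 := fun h0 => by
  have h1 := h.self v hv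
  have h2 := h.other v hv w hw hne
  simp only [h0, inner_zero_left] at h1 h2
  linarith

end IsBary

/-- The barycenter of the facet of the simplex with vertices `s` opposite to `v`. -/
def facetCenter (F : Finset (Pt d)) : Pt d := (d : ℝ)⁻¹ • ∑ u ∈ F, u

theorem affine_facetCenter {F : Finset (Pt d)} (hF : F.card = d) (hd : 0 < d) (a : ℝ) (g : Pt d) :
    a + ⟪g, facetCenter F⟫ = (d : ℝ)⁻¹ * ∑ u ∈ F, (a + ⟪g, u⟫) := by
  have : (d : ℝ) ≠ 0 := by positivity
  rw [facetCenter, inner_smul_right, inner_sum, Finset.sum_add_distrib]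
  simp [hF]; field_simp

open scoped Classical in
/-- The elements `s`, `t` share the facet with vertices `F`. -/
structure IsFacetPair (s t F : Finset (Pt d)) (v w : Pt d) : Prop where
  mem_left : v ∈ s
  mem_right : w ∈ t
  erase_left : s.erase v = F
  erase_right : t.erase w = F
  not_mem_left : w ∉ s
  not_mem_right : v ∉ t
  card : F.card = d

theorem IsFacetPair.symm {s t F : Finset (Pt d)} {v w : Pt d} (h : IsFacetPair s t F v w) :
    IsFacetPair t s F w v :=
  ⟨h.mem_right, h.mem_left, h.erase_right, h.erase_left, h.not_mem_right, h.not_mem_left, h.card⟩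

theorem IsFacetPair.mem_left_iff {s t F : Finset (Pt d)} {v w : Pt d} (h : IsFacetPair s t F v w)
    {u : Pt d} : u ∈ F ↔ u ∈ s ∧ u ≠ v := by
  classical
  rw [← h.erase_left, Finset.mem_erase, and_comm]

theorem IsFacetPair.inter_eq {s t F : Finset (Pt d)} {v w : Pt d} (h : IsFacetPair s t F v w) :
    (s : Set (Pt d)) ∩ t = F := by
  ext u
  simp only [mem_inter_iff, Finset.mem_coe]
  constructor
  · rintro ⟨h1, h2⟩
    exact h.mem_left_iff.2 ⟨h1, fun h3 => h.not_mem_right (h3 ▸ h2)⟩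
  · exact fun hu => ⟨(h.mem_left_iff.1 hu).1, (h.symm.mem_left_iff.1 hu).1⟩

theorem exists_isFacetPair {s t : Finset (Pt d)} (hs : s.card = d + 1) (ht : t.card = d + 1)
    (h : ((s : Set (Pt d)) ∩ t).ncard = d) : ∃ F v w, IsFacetPair s t F v w := by
  classical
  have hF : (s ∩ t).card = d := by
    rw [← Set.ncard_coe_finset, Finset.coe_inter, h]
  have h1 : (s \ t).card = 1 := by
    have := Finset.card_sdiff_add_card_inter s t; omega
  have h2 : (t \ s).card = 1 := by
    have := Finset.card_sdiff_add_card_inter t s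
    rw [Finset.inter_comm] at this; omega
  obtain ⟨v, hv⟩ := Finset.card_eq_one.1 h1
  obtain ⟨w, hw⟩ := Finset.card_eq_one.1 h2
  have hv' : ∀ u, u ∈ s ∧ u ∉ t ↔ u = v := fun u => by
    rw [← Finset.mem_sdiff, hv, Finset.mem_singleton]
  have hw' : ∀ u, u ∈ t ∧ u ∉ s ↔ u = w := fun u => by
    rw [← Finset.mem_sdiff, hw, Finset.mem_singleton]
  refine ⟨s ∩ t, v, w, ((hv' v).2 rfl).1, ((hw' w).2 rfl).1, ?_, ?_, ((hw' w).2 rfl).2,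
    ((hv' v).2 rfl).2, hF⟩
  · ext u
    have := hv' u
    simp only [Finset.mem_erase, Finset.mem_inter]; tauto
  · ext u
    have := hw' u
    simp only [Finset.mem_erase, Finset.mem_inter]; tauto

section Facet
variable {s t F : Finset (Pt d)} {v w : Pt d} {c c' : Pt d → ℝ} {G G' : Pt d → Pt d}

theorem IsFacetPair.coord_center (hd : 0 < d) (h : IsFacetPair s t F v w) (hs : IsBary s c G) :
    c v + ⟪G v, facetCenter F⟫ = 0 := by
  rw [affine_facetCenter h.card hd, Finset.sum_eq_zero fun u hu => ?_, mul_zero]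
  obtain ⟨h1, h2⟩ := h.mem_left_iff.1 hu
  exact hs.other v h.mem_left u h1 h2.symm

theorem IsFacetPair.coord_center_of_mem (hd : 0 < d) (h : IsFacetPair s t F v w)
    (hs : IsBary s c G) {u : Pt d} (hu : u ∈ F) : c u + ⟪G u, facetCenter F⟫ = (d : ℝ)⁻¹ := by
  obtain ⟨h1, h2⟩ := h.mem_left_iff.1 hu
  rw [affine_facetCenter h.card hd, Finset.sum_eq_single_of_mem u hu fun u' hu' hne =>
    hs.other u h1 u' (h.mem_left_iff.1 hu').1 hne.symm, hs.self u h1, mul_one]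

/-- Near the barycenter of a facet, a simplex is a half-space. -/
theorem IsFacetPair.mem_simplex_iff (hd : 0 < d) (h : IsFacetPair s t F v w) (hs : IsBary s c G)
    {z : Pt d} {ρ r : ℝ} (hρ : 0 < ρ) (hb : Metric.closedBall z (ρ / 2) ⊆ simplex s)
    (hr : d * r ≤ ρ) {x : Pt d} (hx : x ∈ Metric.closedBall (facetCenter F) r) :
    x ∈ simplex s ↔ 0 ≤ c v + ⟪G v, x⟫ := by
  refine ⟨fun hx' => (hs.mem_iff x).1 hx' v h.mem_left, fun hx' => (hs.mem_iff x).2 fun u hu => ?_⟩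
  rcases eq_or_ne u v with rfl | hne
  · exact hx'
  -- The coordinates of the facet vertices equal `1 / d` at the center and change by at most `r / ρ
  -- ≤ 1 / d` on the ball, so only the coordinate of `v` can become negative.
  have h1 := h.coord_center_of_mem hd hs (h.mem_left_iff.2 ⟨hu, hne⟩)
  have h2 := hs.norm_mul_le hu hρ hb
  have h3 : |⟪G u, x - facetCenter F⟫| ≤ ‖G u‖ * r := by
    refine (abs_real_inner_le_norm _ _).trans ?_
    gcongr
    rwa [← dist_eq_norm]
  have hd' : (0 : ℝ) < d := by exact_mod_cast hd
  have h4 : ‖G u‖ * r ≤ (d : ℝ)⁻¹ := by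
    rw [← one_div, le_div_iff₀ hd', mul_assoc, mul_comm r]
    exact (mul_le_mul_of_nonneg_left hr (norm_nonneg _)).trans h2
  rw [inner_sub_right] at h3
  have := (abs_le.1 h3).1
  linarith

/-- Both coordinates vanish at the vertices of the common facet, so they are proportional;
evaluation at `v` gives the factor. -/
theorem IsFacetPair.coord_eq (h : IsFacetPair s t F v w) (hs : IsBary s c G) (ht : IsBary t c' G')
    (x : Pt d) : c' w + ⟪G' w, x⟫ = (c' w + ⟪G' w, v⟫) * (c v + ⟪G v, x⟫) :=
  hs.affine_eq_of_vanish h.mem_left (fun u hu hne => by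
    have hu' := h.symm.mem_left_iff.1 (h.mem_left_iff.2 ⟨hu, hne⟩)
    exact ht.other w h.mem_right u hu'.1 hu'.2.symm) x

theorem IsFacetPair.grad_eq (h : IsFacetPair s t F v w) (hs : IsBary s c G) (ht : IsBary t c' G') :
    G' w = (c' w + ⟪G' w, v⟫) • G v :=
  hs.grad_eq_of_vanish h.mem_left (fun u hu hne => by
    have hu' := h.symm.mem_left_iff.1 (h.mem_left_iff.2 ⟨hu, hne⟩)
    exact ht.other w h.mem_right u hu'.1 hu'.2.symm)

theorem IsFacetPair.coord_eq_zero_of_mem_side (h : IsFacetPair s t F v w) (hs : IsBary s c G)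
    {x : Pt d} (hx : x ∈ side s t) : c v + ⟪G v, x⟫ = 0 := by
  rw [side, h.inter_eq] at hx
  have hlin : convexHull ℝ (F : Set (Pt d)) ⊆ {x | (innerSL ℝ (G v)) x = -c v} := by
    refine convexHull_min (fun u hu => ?_) (convex_hyperplane (innerSL ℝ (G v)).isLinear _)
    obtain ⟨h1, h2⟩ := h.mem_left_iff.1 hu
    have := hs.other v h.mem_left u h1 h2.symm
    simp only [mem_ofPred_eq, innerSL_apply_apply]; linarith
  have := hlin hx
  simp only [mem_ofPred_eq, innerSL_apply_apply] at this
  linarith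

/-- Two elements that share a facet lie on opposite sides of it. -/
theorem IsFacetPair.coord_neg (hd : 2 ≤ d) (h : IsFacetPair s t F v w) (hs : IsBary s c G)
    (ht : IsBary t c' G') (hconf : simplex s ∩ simplex t = side s t)
    {z z' : Pt d} {ρ ρ' : ℝ} (hρ : 0 < ρ) (hb : Metric.closedBall z (ρ / 2) ⊆ simplex s)
    (hρ' : 0 < ρ') (hb' : Metric.closedBall z' (ρ' / 2) ⊆ simplex t) :
    c' w + ⟪G' w, v⟫ < 0 := by
  have hd0 : 0 < d := by omega
  -- A zero factor would make the coordinate of `w` vanish identically, although it is `1` at `w`.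
  -- With a positive factor, a point pushed off the facet into `s` also lies in `t`, against
  -- conformity.
  by_contra! hk
  rcases hk.eq_or_lt with h0 | hk
  · have := h.coord_eq hs ht w
    rw [← h0, zero_mul, ht.self w h.mem_right] at this
    exact one_ne_zero this
  obtain ⟨u, hu⟩ : F.Nonempty := by rw [← Finset.card_pos, h.card]; exact hd0
  obtain ⟨hu1, hu2⟩ := h.mem_left_iff.1 hu
  have hG := norm_pos_iff.2 (hs.grad_ne_zero h.mem_left hu1 hu2.symm)
  set r : ℝ := min ρ ρ' / d with hr
  have hd' : (0 : ℝ) < d := by exact_mod_cast hd0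
  have hr0 : 0 < r := by positivity
  have hdr : d * r = min ρ ρ' := by rw [hr]; field_simp
  set x : Pt d := facetCenter F + (r * ‖G v‖⁻¹) • G v with hx
  have hxb : x ∈ Metric.closedBall (facetCenter F) r := by
    rw [hx, mem_closedBall_iff_norm, add_sub_cancel_left, norm_smul,
      Real.norm_of_nonneg (by positivity)]
    field_simp; rfl
  have hpos : 0 < c v + ⟪G v, x⟫ := by
    rw [hx, inner_add_right, ← add_assoc, h.coord_center hd0 hs, inner_smul_right,
      real_inner_self_eq_norm_sq]
    positivity
  have hxs : x ∈ simplex s :=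
    (h.mem_simplex_iff hd0 hs hρ hb (hdr.trans_le (min_le_left _ _)) hxb).2 hpos.le
  have hxt : x ∈ simplex t := by
    refine (h.symm.mem_simplex_iff hd0 ht hρ' hb' (hdr.trans_le (min_le_right _ _)) hxb).2 ?_
    rw [h.coord_eq hs ht]; positivity
  have := h.coord_eq_zero_of_mem_side hs (hconf.subset ⟨hxs, hxt⟩)
  exact hpos.ne' this

theorem side_comm (s t : Finset (Pt d)) : side s t = side t s := by
  rw [side, side, inter_comm]

/-- The balls centered at the barycenter of a common facet are covered by the two elements. -/
theorem IsFacetPair.closedBall_subset (hd : 2 ≤ d) (h : IsFacetPair s t F v w) (hs : IsBary s c G)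
    (ht : IsBary t c' G') (hconf : simplex s ∩ simplex t = side s t)
    {z z' : Pt d} {ρ ρ' r : ℝ} (hρ : 0 < ρ) (hb : Metric.closedBall z (ρ / 2) ⊆ simplex s)
    (hρ' : 0 < ρ') (hb' : Metric.closedBall z' (ρ' / 2) ⊆ simplex t)
    (hr : d * r ≤ ρ) (hr' : d * r ≤ ρ') :
    Metric.closedBall (facetCenter F) r ⊆ simplex s ∪ simplex t := fun x hx => by
  have hd0 : 0 < d := by omega
  rcases le_total 0 (c v + ⟪G v, x⟫) with h0 | h0
  · exact Or.inl ((h.mem_simplex_iff hd0 hs hρ hb hr hx).2 h0)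
  · refine Or.inr ((h.symm.mem_simplex_iff hd0 ht hρ' hb' hr' hx).2 ?_)
    rw [h.coord_eq hs ht]
    exact mul_nonneg_of_nonpos_of_nonpos (h.coord_neg hd hs ht hconf hρ hb hρ' hb').le h0

/-- `outerNormal` is a choice, so an arbitrary admissible `ν` has to be identified: the inequalities
between facet vertices make `⟪ν, ·⟫` constant on the facet, hence `ν` is a multiple of `G v`. The
vertex `v` fixes the sign and `‖ν‖ = 1` the length. -/
theorem IsFacetPair.outerNormal_eq (hd : 2 ≤ d) (h : IsFacetPair s t F v w) (hs : IsBary s c G) :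
    outerNormal (simplex s) (side s t) = -(‖G v‖⁻¹ • G v) := by
  have hF : F.Nonempty := by rw [← Finset.card_pos, h.card]; omega
  obtain ⟨u, hu⟩ := hF
  obtain ⟨hu1, hu2⟩ := h.mem_left_iff.1 hu
  have hG := norm_pos_iff.2 (hs.grad_ne_zero h.mem_left hu1 hu2.symm)
  have hside : ∀ u ∈ F, u ∈ side s t := fun u hu => by
    rw [side, h.inter_eq]; exact subset_convexHull ℝ _ hu
  have hsimp : ∀ u ∈ s, u ∈ simplex s := fun u hu => subset_convexHull ℝ _ hu
  have hex : ∃ ν, IsOuterUnitNormal (simplex s) (side s t) ν := by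
    refine ⟨-(‖G v‖⁻¹ • G v), ?_, fun x hx y hy => ?_⟩
    · rw [norm_neg, norm_smul, norm_inv, norm_norm, inv_mul_cancel₀ hG.ne']
    · have h1 := h.coord_eq_zero_of_mem_side hs hx
      have h2 := (hs.mem_iff y).1 hy v h.mem_left
      rw [inner_neg_left, inner_smul_left, inner_sub_right, neg_nonpos]
      exact mul_nonneg (by simp) (by linarith)
  rw [outerNormal, dif_pos hex]
  obtain ⟨h1, h2⟩ := hex.choose_spec
  set ν := hex.choose
  have hv0 : ∀ u' ∈ s, u' ≠ v → -⟪ν, u⟫ + ⟪ν, u'⟫ = 0 := fun u' hu' hne => by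
    have h3 := h2 u (hside u hu) u' (hsimp u' hu')
    have h4 := h2 u' (hside u' (h.mem_left_iff.2 ⟨hu', hne⟩)) u (hsimp u hu1)
    rw [inner_sub_right] at h3 h4
    linarith
  have h5 := hs.grad_eq_of_vanish h.mem_left hv0
  have h6 := h2 u (hside u hu) v (hsimp v h.mem_left)
  rw [inner_sub_right] at h6
  set k := -⟪ν, u⟫ + ⟪ν, v⟫
  have hk : k ≤ 0 := by simp only [k]; linarith
  have h7 : -k * ‖G v‖ = 1 := by
    rw [h5, norm_smul, Real.norm_of_nonpos hk] at h1; exact h1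
  rw [h5, ← neg_smul]
  congr 1
  field_simp
  linarith

end Facet

/-! ### Measure theory of meshes -/

theorem isCompact_simplex (s : Finset (Pt d)) : IsCompact (simplex s) :=
  s.finite_toSet.isCompact_convexHull (𝕜 := ℝ)

theorem convex_simplex (s : Finset (Pt d)) : Convex ℝ (simplex s) := convex_convexHull ℝ _

theorem measurableSet_simplex (s : Finset (Pt d)) : MeasurableSet (simplex s) :=
  (isCompact_simplex s).measurableSet

theorem size_nonneg (s : Finset (Pt d)) : 0 ≤ size s := Metric.diam_nonneg

/-- A Lipschitz domain has no slits. Just below a boundary point, in the direction `-e`, lies an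
open set of points under the graph that misses `Ω`, so a boundary point is not interior to the
closure. The Lipschitz boundary enters the proof only here; the mesh covers the closure, and this
puts the interiors of its elements inside `Ω`. -/
theorem interior_closure_eq (hΩ : IsOpen Ω) (hL : HasLipschitzBoundary Ω) :
    interior (closure Ω) = Ω := by
  refine subset_antisymm (fun x hx => ?_) (interior_maximal subset_closure hΩ)
  by_contra hxΩ
  have hxf : x ∈ frontier Ω := by
    rw [frontier, hΩ.interior_eq]; exact ⟨interior_subset hx, hxΩ⟩
  obtain ⟨e, g, L, r, he, hg, hr, h⟩ := hL x hxf
  obtain ⟨δ, hδ, hball⟩ := Metric.isOpen_iff.1 isOpen_interior x hx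
  set ε := min δ r / 2 with hε
  have hε0 : 0 < ε := by positivity
  have hεδ : ε < δ := by have := min_le_left δ r; have := lt_min hδ hr; linarith
  have hεr : ε < r := by have := min_le_right δ r; have := lt_min hδ hr; linarith
  set y := x - ε • e with hy
  have hyx : dist y x = ε := by
    rw [hy, dist_eq_norm, sub_sub_cancel_left, norm_neg, norm_smul, he,
      Real.norm_of_nonneg hε0.le, mul_one]
  have hycl : y ∈ closure Ω := interior_subset (hball (by rw [Metric.mem_ball, hyx]; exact hεδ))
  have hee : ⟪e, e⟫ = 1 := by rw [real_inner_self_eq_norm_sq, he]; norm_num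
  have hUopen : IsOpen {z : Pt d | ⟪e, z⟫ < g (z - ⟪e, z⟫ • e)} :=
    isOpen_lt (by fun_prop) (hg.continuous.comp (by fun_prop))
  have hyU : y ∈ {z : Pt d | ⟪e, z⟫ < g (z - ⟪e, z⟫ • e)} := by
    have h1 : ⟪e, y⟫ = ⟪e, x⟫ - ε := by
      rw [hy, inner_sub_right, inner_smul_right, hee, mul_one]
    have h2 : y - ⟪e, y⟫ • e = x - ⟪e, x⟫ • e := by
      rw [h1, hy, sub_smul]; abel
    have h3 := mt (h x (Metric.mem_ball_self hr)).2 hxΩ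
    change ⟪e, y⟫ < g (y - ⟪e, y⟫ • e)
    rw [h2, h1]
    linarith
  obtain ⟨z, ⟨hz1, hz2⟩, hzΩ⟩ := mem_closure_iff.1 hycl _ (hUopen.inter Metric.isOpen_ball)
    ⟨hyU, show y ∈ Metric.ball x r by rw [Metric.mem_ball, hyx]; exact hεr⟩
  exact lt_asymm hz1 ((h z hz2).1 hzΩ)

theorem hyperplane_null {a : ℝ} {g : Pt d} (hg : g ≠ 0) : volume {x : Pt d | a + ⟪g, x⟫ = 0} = 0 := by
  rcases eq_empty_or_nonempty {x : Pt d | a + ⟪g, x⟫ = 0} with h | ⟨p, hp⟩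
  · rw [h, measure_empty]
  have hQ : AffineSubspace.mk' p (ℝ ∙ g)ᗮ ≠ ⊤ := fun h => by
    have : p + g ∈ AffineSubspace.mk' p (ℝ ∙ g)ᗮ := h ▸ AffineSubspace.mem_top ℝ _ _
    rw [AffineSubspace.mem_mk', vsub_eq_sub, add_sub_cancel_left,
      Submodule.mem_orthogonal_singleton_iff_inner_right] at this
    exact hg (inner_self_eq_zero.1 this)
  refine measure_mono_null (fun x hx => ?_) (Measure.addHaar_affineSubspace volume _ hQ)
  change a + ⟪g, p⟫ = 0 at hp
  change a + ⟪g, x⟫ = 0 at hx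
  rw [SetLike.mem_coe, AffineSubspace.mem_mk', vsub_eq_sub,
    Submodule.mem_orthogonal_singleton_iff_inner_right, inner_sub_right]
  linarith

namespace Mesh
variable (T : Mesh Ω) {s t : Finset (Pt d)}

theorem exists_isBary (hs : s ∈ T.elements) : ∃ c G, IsBary s c G :=
  SparseControl.exists_isBary (T.card_eq s hs) (T.indep s hs)

theorem simplex_subset (hs : s ∈ T.elements) : simplex s ⊆ closure Ω := by
  rw [← T.covers]; exact subset_biUnion_of_mem (u := simplex) hs

theorem interior_simplex_subset (hΩ : IsOpen Ω) (hL : HasLipschitzBoundary Ω)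
    (hs : s ∈ T.elements) : interior (simplex s) ⊆ Ω := by
  rw [← interior_closure_eq hΩ hL]; exact interior_mono (T.simplex_subset hs)

/-- Nothing about the measure of `∂Ω` is needed: the part of the simplex outside `Ω` lies in the
frontier of the simplex, which is null by convexity. -/
theorem simplex_ae_le (hΩ : IsOpen Ω) (hL : HasLipschitzBoundary Ω) (hs : s ∈ T.elements) :
    simplex s ≤ᵐ[volume] Ω := by
  rw [ae_le_set]
  refine measure_mono_null (fun x hx => ?_) ((convex_simplex s).addHaar_frontier volume)
  rw [(isCompact_simplex s).isClosed.frontier_eq]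
  exact ⟨hx.1, fun h => hx.2 (T.interior_simplex_subset hΩ hL hs h)⟩

theorem restrict_le (hΩ : IsOpen Ω) (hL : HasLipschitzBoundary Ω) (hs : s ∈ T.elements) :
    volume.restrict (simplex s) ≤ volume.restrict Ω :=
  Measure.restrict_mono_ae (T.simplex_ae_le hΩ hL hs)

theorem ae_eq_iUnion (hΩ : IsOpen Ω) (hL : HasLipschitzBoundary Ω) :
    Ω =ᵐ[volume] ⋃ s : T.elements, simplex (s : Finset (Pt d)) := by
  have h : ⋃ s : T.elements, simplex (s : Finset (Pt d)) = closure Ω := by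
    rw [← T.covers, iUnion_subtype]
  refine Filter.EventuallyLE.antisymm (LE.le.eventuallyLE (h ▸ subset_closure)) ?_
  rw [ae_le_set, iUnion_sdiff]
  exact measure_iUnion_null fun s => ae_le_set.1 (T.simplex_ae_le hΩ hL s.2)

/-- Some vertex `v` of `s` is not in `t`. By conformity the intersection is spanned by other
vertices of `s`, hence lies in the null hyperplane where the coordinate of `v` vanishes. If `G v =
0`, there are no other vertices and the intersection is empty. -/
theorem aedisjoint (hs : s ∈ T.elements) (ht : t ∈ T.elements) (hne : s ≠ t) :
    AEDisjoint volume (simplex s) (simplex t) := by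
  have hns : ¬ s ⊆ t := fun h =>
    hne (Finset.eq_of_subset_of_card_le h (by rw [T.card_eq s hs, T.card_eq t ht]))
  obtain ⟨v, hv, hvt⟩ := Finset.not_subset.1 hns
  obtain ⟨c, G, hB⟩ := T.exists_isBary hs
  rw [AEDisjoint, T.conforming s hs t ht]
  rcases eq_or_ne (G v) 0 with h0 | h0
  · suffices h : (s : Set (Pt d)) ∩ t = ∅ by rw [h, convexHull_empty, measure_empty]
    rw [eq_empty_iff_forall_notMem]
    rintro u ⟨h1, h2⟩
    have h3 := hB.other v hv u h1 fun h => hvt (h ▸ h2)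
    have h4 := hB.self v hv
    simp only [h0, inner_zero_left] at h3 h4
    linarith
  refine measure_mono_null (convexHull_min ?_ ?_) (hyperplane_null (a := c v) h0)
  · rintro u ⟨h1, h2⟩
    exact hB.other v hv u h1 fun h => hvt (h ▸ h2)
  · have := convex_hyperplane (innerSL ℝ (G v)).isLinear (-c v)
    have he : {x : Pt d | c v + ⟪G v, x⟫ = 0} = {x | innerSL ℝ (G v) x = -c v} := by
      ext x
      simp only [mem_ofPred_eq, innerSL_apply_apply]
      constructor <;> intro h <;> linarith
    rwa [he]

theorem sum_lpNorm_sq {E : Type*} [NormedAddCommGroup E] (hΩ : IsOpen Ω)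
    (hL : HasLipschitzBoundary Ω) {f : Pt d → E} (hf : MemLp f 2 (volume.restrict Ω)) :
    ∑ s ∈ T.elements, lpNorm f 2 (volume.restrict (simplex s)) ^ 2 =
      lpNorm f 2 (volume.restrict Ω) ^ 2 := by
  have h1 : ∀ s ∈ T.elements, lpNorm f 2 (volume.restrict (simplex s)) ^ 2 =
      ∫ x in simplex s, ‖f x‖ ^ 2 := fun s hs =>
    lpNorm_two_sq (hf.mono_measure (T.restrict_le hΩ hL hs)).1
  rw [Finset.sum_congr rfl h1, lpNorm_two_sq hf.1, setIntegral_congr_set (T.ae_eq_iUnion hΩ hL),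
    integral_iUnion_ae (fun s => (measurableSet_simplex _).nullMeasurableSet)
      (fun s t hne => T.aedisjoint s.2 t.2 fun h => hne (Subtype.ext h)), tsum_fintype,
    Finset.sum_coe_sort T.elements fun s => ∫ x in simplex s, ‖f x‖ ^ 2]
  rw [← integrableOn_congr_set_ae (T.ae_eq_iUnion hΩ hL)]
  exact hf.norm.integrable_sq

theorem size_le (hb : Bornology.IsBounded Ω) (hs : s ∈ T.elements) :
    size s ≤ Metric.diam (closure Ω) :=
  Metric.diam_mono (T.simplex_subset hs) hb.closure

end Mesh

theorem lpNorm_sq_le_of_subset_union {E : Type*} [NormedAddCommGroup E] {f : Pt d → E}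
    {A B D : Set (Pt d)} (hA : MemLp f 2 (volume.restrict A))
    (hB : MemLp f 2 (volume.restrict B)) (h : D ⊆ A ∪ B) :
    lpNorm f 2 (volume.restrict D) ^ 2 ≤
      lpNorm f 2 (volume.restrict A) ^ 2 + lpNorm f 2 (volume.restrict B) ^ 2 := by
  have hle : volume.restrict D ≤ volume.restrict A + volume.restrict B :=
    (Measure.restrict_mono h le_rfl).trans (Measure.restrict_union_le A B)
  have hm : MemLp f 2 (volume.restrict A + volume.restrict B) := by
    rw [memLp_two_iff_integrable_sq_norm (aestronglyMeasurable_add_measure_iff.2 ⟨hA.1, hB.1⟩),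
      integrable_add_measure]
    exact ⟨hA.norm.integrable_sq, hB.norm.integrable_sq⟩
  rw [lpNorm_two_sq hA.1, lpNorm_two_sq hB.1, lpNorm_two_sq (hm.mono_measure hle).1,
    ← integral_add_measure hA.norm.integrable_sq hB.norm.integrable_sq]
  exact integral_mono_measure hle (.of_forall fun x => sq_nonneg _) hm.norm.integrable_sq

theorem subset_closedBall_of_mem {s : Finset (Pt d)} {A : Set (Pt d)} (hA : A ⊆ simplex s)
    {p : Pt d} (hp : p ∈ simplex s) : A ⊆ Metric.closedBall p (size s) := fun _ hx =>
  Metric.dist_le_diam_of_mem (isCompact_simplex s).isBounded (hA hx) hp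

/-- The volume of the unit ball. -/
def ballVol (d : ℕ) : ℝ := volume.real (Metric.closedBall (0 : Pt d) 1)

theorem ballVol_nonneg (d : ℕ) : 0 ≤ ballVol d := measureReal_nonneg

theorem volume_closedBall (p : Pt d) {r : ℝ} (hr : 0 ≤ r) :
    volume.real (Metric.closedBall p r) = r ^ d * ballVol d := by
  have := Measure.addHaar_real_closedBall' (volume : Measure (Pt d)) p hr
  simpa [ballVol, Measure.addHaar_real_closedBall_eq_addHaar_real_ball] using this

theorem volume_simplex_le {s : Finset (Pt d)} (hs : (simplex s).Nonempty) :
    volume.real (simplex s) ≤ size s ^ d * ballVol d := by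
  obtain ⟨p, hp⟩ := hs
  rw [← volume_closedBall p (size_nonneg s)]
  exact measureReal_mono (subset_closedBall_of_mem subset_rfl hp)
    measure_closedBall_lt_top.ne

/-! ### Surface measure -/

/-- The hyperplane through `p` is an isometric copy of `ℝⁿ` in which `A` sits inside a ball of
radius `r`. Isometries preserve the Hausdorff measure, which is the volume on `ℝⁿ`. -/
theorem euclideanHausdorffMeasure_hyperplane_le {n : ℕ} {a : ℝ} {g p : Pt (n + 1)} (hg : g ≠ 0)
    {r : ℝ} (hr : 0 ≤ r) (hp : a + ⟪g, p⟫ = 0) {A : Set (Pt (n + 1))}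
    (hA : ∀ x ∈ A, a + ⟪g, x⟫ = 0) (hAr : A ⊆ Metric.closedBall p r) :
    Measure.euclideanHausdorffMeasure n A ≤ ENNReal.ofReal (r ^ n * ballVol n) := by
  have : Fact (Module.finrank ℝ (Pt (n + 1)) = n + 1) := ⟨by simp⟩
  let b := OrthonormalBasis.fromOrthogonalSpanSingleton (𝕜 := ℝ) n hg
  let φ : Pt n → Pt (n + 1) := fun x => p + (b.repr.symm x : Pt (n + 1))
  have hφ : Isometry φ := by
    refine Isometry.of_dist_eq fun x y => ?_
    simp only [φ, dist_add_left]
    rw [← Subtype.dist_eq, b.repr.symm.dist_map]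
  have hsub : A ⊆ φ '' Metric.closedBall 0 r := fun x hx => by
    have hmem : x - p ∈ (ℝ ∙ g)ᗮ := by
      rw [Submodule.mem_orthogonal_singleton_iff_inner_right, inner_sub_right]
      have := hA x hx; linarith
    refine ⟨b.repr ⟨x - p, hmem⟩, ?_, by simp [φ]⟩
    rw [mem_closedBall_zero_iff, LinearIsometryEquiv.norm_map, Submodule.coe_norm, ← dist_eq_norm]
    exact hAr hx
  calc Measure.euclideanHausdorffMeasure n A
      ≤ Measure.euclideanHausdorffMeasure n (φ '' Metric.closedBall 0 r) := measure_mono hsub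
    _ = volume (Metric.closedBall (0 : Pt n) r) := by
        rw [hφ.euclideanHausdorffMeasure_image, EuclideanSpace.euclideanHausdorffMeasure_eq_volume]
    _ = ENNReal.ofReal (r ^ n * ballVol n) := by
        rw [← volume_closedBall 0 hr, ofReal_measureReal measure_closedBall_lt_top.ne]

/-! ### Lipschitz continuity of finite element functions -/

/-- Induction on the number of sets: from `x ∈ A i` follow the segment to its last point in `A i`;
the rest is covered by the other sets. Distances add up along a segment, so the constant `C` does
not grow. -/
theorem dist_le_of_segment_subset {E ι : Type*} [NormedAddCommGroup E] [NormedSpace ℝ E]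
    {A : ι → Set E} (hA : ∀ i, IsClosed (A i)) {f : E → ℝ} {C : ℝ≥0}
    (hf : ∀ i, LipschitzOnWith C f (A i)) (S : Finset ι) :
    ∀ x y, segment ℝ x y ⊆ ⋃ i ∈ S, A i → dist (f x) (f y) ≤ C * dist x y := by
  classical
  induction S using Finset.strongInduction with
  | H S ih =>
  intro x y hxy
  obtain ⟨i, hi, hxi⟩ : ∃ i ∈ S, x ∈ A i := by simpa using hxy (left_mem_segment ℝ x y)
  let γ : ℝ →ᵃ[ℝ] E := AffineMap.lineMap x y
  have hγ : Continuous γ := AffineMap.lineMap_continuous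
  have hseg : ∀ t ∈ Icc (0 : ℝ) 1, γ t ∈ segment ℝ x y := fun t ht => by
    rw [segment_eq_image_lineMap]; exact mem_image_of_mem _ ht
  have hK : IsCompact (Icc (0 : ℝ) 1 ∩ γ ⁻¹' A i) :=
    isCompact_Icc.inter_right ((hA i).preimage hγ)
  obtain ⟨τ, ⟨hτ, hτA⟩, hmax⟩ := hK.exists_isGreatest ⟨0, ⟨le_rfl, zero_le_one⟩, by simpa [γ]⟩
  have h1 := (hf i).dist_le_mul x hxi (γ τ) hτA
  rcases hτ.2.eq_or_lt with h | h
  · simpa [γ, h] using h1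
  have hcl : Icc τ 1 ⊆ γ ⁻¹' ⋃ j ∈ S.erase i, A j := by
    -- Beyond `τ` the segment avoids `A i`; as the remaining sets are closed, they also cover the
    -- point at `τ`.
    rw [← closure_Ioc h.ne]
    refine closure_minimal (fun u hu => ?_)
      (((S.erase i).finite_toSet.isClosed_biUnion fun j _ => hA j).preimage hγ)
    have hu01 : u ∈ Icc (0 : ℝ) 1 := ⟨hτ.1.trans hu.1.le, hu.2⟩
    obtain ⟨j, hj, huj⟩ : ∃ j ∈ S, γ u ∈ A j := by simpa using hxy (hseg u hu01)
    have hji : j ≠ i := fun hji => hu.1.not_ge (hmax ⟨hu01, hji ▸ huj⟩)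
    simp only [mem_preimage, mem_iUnion]
    exact ⟨j, Finset.mem_erase.2 ⟨hji, hj⟩, huj⟩
  have h2 := ih _ (Finset.erase_ssubset hi) (γ τ) y (by
    rw [segment_eq_image_lineMap]
    rintro _ ⟨θ, hθ, rfl⟩
    have hy : y = γ 1 := by simp [γ]
    rw [hy, ← AffineMap.apply_lineMap]
    refine hcl ?_
    rw [AffineMap.lineMap_apply_ring']
    constructor <;> nlinarith [hθ.1, hθ.2])
  have h3 : dist x (γ τ) + dist (γ τ) y = dist x y := by
    simp only [γ, dist_left_lineMap, dist_lineMap_right, Real.norm_of_nonneg hτ.1,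
      Real.norm_of_nonneg (sub_nonneg.2 hτ.2)]
    ring
  calc dist (f x) (f y) ≤ dist (f x) (f (γ τ)) + dist (f (γ τ)) (f y) := dist_triangle _ _ _
    _ ≤ C * dist x (γ τ) + C * dist (γ τ) y := add_le_add h1 h2
    _ = C * dist x y := by rw [← mul_add, h3]

theorem lipschitzWith_of_finite_closed_cover {E ι : Type*} [NormedAddCommGroup E]
    [NormedSpace ℝ E] [Fintype ι] {A : ι → Set E} (hA : ∀ i, IsClosed (A i))
    (hU : ⋃ i, A i = univ) {f : E → ℝ} {C : ℝ≥0} (hf : ∀ i, LipschitzOnWith C f (A i)) :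
    LipschitzWith C f :=
  LipschitzWith.of_dist_le_mul fun x y =>
    dist_le_of_segment_subset hA hf Finset.univ x y (by simp [hU])

/-- A finite element function extends by zero to a Lipschitz function on the whole space. -/
theorem Mesh.MemV.exists_lipschitz (T : Mesh Ω) (hΩ : IsOpen Ω) {v : Pt d → ℝ} (hv : T.MemV v) :
    ∃ (w : Pt d → ℝ) (C : ℝ≥0), LipschitzWith C w ∧ (∀ x ∉ Ω, w x = 0) ∧
      ∀ x ∈ closure Ω, w x = v x := by
  classical
  obtain ⟨-, hpoly, h0⟩ := hv
  have hpoly' : ∀ s : T.elements, ∃ (a : ℝ) (g : Pt d), ∀ x ∈ simplex (s : Finset (Pt d)),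
      v x = a + ⟪g, x⟫ := fun s => by
    obtain ⟨q, ⟨a, g, -, hq⟩, hvq⟩ := hpoly s s.2
    exact ⟨a, g, fun x hx => (hvq hx).trans (hq x)⟩
  choose a g hag using hpoly'
  let w : Pt d → ℝ := Ω.indicator v
  have hw : ∀ x ∈ closure Ω, w x = v x := fun x hx => by
    by_cases hxΩ : x ∈ Ω
    · exact indicator_of_mem hxΩ v
    · rw [show w x = 0 from indicator_of_notMem hxΩ v, h0 x ⟨hx, by rwa [hΩ.interior_eq]⟩]
  have hw0 : ∀ x ∉ Ω, w x = 0 := fun x hx => indicator_of_notMem hx v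
  -- The closed cover consists of the complement of `Ω`, where the extension is zero, and of the
  -- elements, where it is affine because `v` vanishes on `∂Ω`.
  let A : Option T.elements → Set (Pt d) := fun i => i.elim Ωᶜ fun s => simplex (s : Finset (Pt d))
  refine ⟨w, ∑ s, ‖g s‖₊, lipschitzWith_of_finite_closed_cover (A := A) ?_ ?_ ?_, hw0, hw⟩
  · rintro (_ | s)
    · exact hΩ.isClosed_compl
    · exact (isCompact_simplex _).isClosed
  · refine eq_univ_of_forall fun x => ?_
    by_cases hx : x ∈ Ω
    · have : x ∈ ⋃ s ∈ T.elements, simplex s := T.covers ▸ subset_closure hx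
      simp only [mem_iUnion] at this
      obtain ⟨s, hs, hxs⟩ := this
      exact mem_iUnion.2 ⟨some ⟨s, hs⟩, hxs⟩
    · exact mem_iUnion.2 ⟨none, hx⟩
  · rintro (_ | s)
    · refine LipschitzOnWith.of_dist_le_mul fun x hx y hy => ?_
      rw [hw0 x hx, hw0 y hy, dist_self]; positivity
    · refine LipschitzOnWith.weaken (K := ‖g s‖₊) ?_
        (Finset.single_le_sum (f := fun s => ‖g s‖₊) (fun _ _ => zero_le) (Finset.mem_univ s))
      refine LipschitzOnWith.of_dist_le_mul fun x hx y hy => ?_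
      rw [hw x (T.simplex_subset s.2 hx), hw y (T.simplex_subset s.2 hy), hag s x hx, hag s y hy,
        Real.dist_eq, add_sub_add_left_eq_sub, ← inner_sub_right, dist_eq_norm]
      exact abs_real_inner_le_norm _ _

theorem hasGradientAt_affine (a : ℝ) (g x : Pt d) : HasGradientAt (fun x => a + ⟪g, x⟫) g x := by
  rw [hasGradientAt_iff_hasFDerivAt]
  exact ((innerSL ℝ g).hasFDerivAt (x := x)).const_add a

theorem gradient_ae_eq_of_affine {s : Finset (Pt d)} {w : Pt d → ℝ} {a : ℝ} {g : Pt d}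
    (h : ∀ x ∈ simplex s, w x = a + ⟪g, x⟫) :
    ∀ᵐ x ∂volume.restrict (simplex s), gradient w x = g := by
  have hfr : ∀ᵐ x ∂volume.restrict (simplex s), x ∉ frontier (simplex s) :=
    ae_restrict_of_ae (measure_eq_zero_iff_ae_notMem.1 ((convex_simplex s).addHaar_frontier volume))
  filter_upwards [hfr, ae_restrict_mem (measurableSet_simplex s)] with x h1 h2
  have hx : x ∈ interior (simplex s) := by
    by_contra h3
    exact h1 ⟨subset_closure h2, h3⟩
  have : w =ᶠ[𝓝 x] fun x => a + ⟪g, x⟫ := by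
    filter_upwards [isOpen_interior.mem_nhds hx] with y hy
    exact h y (interior_subset hy)
  exact ((hasGradientAt_affine a g x).congr_of_eventuallyEq this).gradient

theorem gradientWithin_eq_of_affine {s : Finset (Pt d)} (hs : (interior (simplex s)).Nonempty)
    {w : Pt d → ℝ} {a : ℝ} {g : Pt d} (h : ∀ x ∈ simplex s, w x = a + ⟪g, x⟫) {x : Pt d}
    (hx : x ∈ simplex s) : gradientWithin w (simplex s) x = g := by
  have hu : UniqueDiffWithinAt ℝ (simplex s) x := uniqueDiffOn_convex (convex_simplex s) hs x hx
  have h1 : HasFDerivWithinAt w (InnerProductSpace.toDual ℝ (Pt d) g) (simplex s) x :=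
    ((hasGradientAt_affine a g x).hasFDerivAt.hasFDerivWithinAt).congr h (h x hx)
  rw [gradientWithin, h1.fderivWithin hu, LinearIsometryEquiv.symm_apply_apply]

/-! ### Neighbors -/

theorem Mesh.exists_isFacetPair (T : Mesh Ω) {s t : Finset (Pt d)} (hs : s ∈ T.elements)
    (ht : t ∈ T.neighbors s) : t ∈ T.elements ∧ ∃ F v w, IsFacetPair s t F v w := by
  classical
  rw [Mesh.neighbors, Finset.mem_filter] at ht
  exact ⟨ht.1, SparseControl.exists_isFacetPair (T.card_eq s hs) (T.card_eq t ht.1) ht.2⟩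

theorem Mesh.mem_neighbors_comm (T : Mesh Ω) {s t : Finset (Pt d)} (hs : s ∈ T.elements)
    (ht : t ∈ T.neighbors s) : s ∈ T.neighbors t := by
  classical
  rw [Mesh.neighbors, Finset.mem_filter] at ht ⊢
  exact ⟨hs, by rw [inter_comm]; exact ht.2⟩

/-- A simplex has `d + 1` facets, and no facet carries two neighbors: these would both lie opposite
to `s`, hence on the same side, while they themselves share the facet and must lie on opposite
sides. -/
theorem Mesh.card_neighbors_le (T : Mesh Ω) (hd : 2 ≤ d) {σ : ℝ} (hT : T.ShapeRegular σ)
    {s : Finset (Pt d)} (hs : s ∈ T.elements) : (T.neighbors s).card ≤ d + 1 := by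
  classical
  have hmaps : ∀ t ∈ T.neighbors s, s ∩ t ∈ s.powersetCard d := fun t ht => by
    rw [Finset.mem_powersetCard]
    rw [Mesh.neighbors, Finset.mem_filter] at ht
    refine ⟨Finset.inter_subset_left, ?_⟩
    rw [← Set.ncard_coe_finset, Finset.coe_inter, ht.2]
  have hcard : (s.powersetCard d).card = d + 1 := by
    rw [Finset.card_powersetCard, T.card_eq s hs, Nat.choose_succ_self_right]
  rw [← hcard]
  refine Finset.card_le_card_of_injOn (fun t => s ∩ t) hmaps fun t ht t' ht' hF => ?_
  by_contra hne
  obtain ⟨ht1, F, v, w, hp⟩ := T.exists_isFacetPair hs ht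
  obtain ⟨ht1', F', v', w', hp'⟩ := T.exists_isFacetPair hs ht'
  have hFF : F' = F := by
    rw [← Finset.coe_inj, ← hp.inter_eq, ← hp'.inter_eq]
    have := congrArg (fun A : Finset (Pt d) => (A : Set (Pt d))) hF
    simpa using this.symm
  subst hFF
  have hvv : v' = v := by
    by_contra h
    exact (hp'.mem_left_iff.1 (hp.mem_left_iff.2 ⟨hp'.mem_left, h⟩)).2 rfl
  subst hvv
  have hww : w ≠ w' := fun h => hne (by
    rw [← Finset.insert_erase hp.mem_right, ← Finset.insert_erase hp'.mem_right, hp.erase_right,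
      hp'.erase_right, h])
  have hq : IsFacetPair t t' F' w w' := by
    refine ⟨hp.mem_right, hp'.mem_right, hp.erase_right, hp'.erase_right, fun h => ?_, fun h => ?_,
      hp.card⟩
    · exact hp'.not_mem_left (hp.mem_left_iff.1 (hp.symm.mem_left_iff.2 ⟨h, hww.symm⟩)).1
    · exact hp.not_mem_left (hp.mem_left_iff.1 (hp'.symm.mem_left_iff.2 ⟨h, hww⟩)).1
  obtain ⟨c, G, hB⟩ := T.exists_isBary hs
  obtain ⟨c1, G1, hB1⟩ := T.exists_isBary ht1
  obtain ⟨c2, G2, hB2⟩ := T.exists_isBary ht1'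
  obtain ⟨z, ρ, hρ, hb, -⟩ := hT s hs
  obtain ⟨z1, ρ1, hρ1, hb1, -⟩ := hT t ht1
  obtain ⟨z2, ρ2, hρ2, hb2, -⟩ := hT t' ht1'
  have e1 := hp.symm.coord_neg hd hB1 hB (T.conforming t ht1 s hs) hρ1 hb1 hρ hb
  have e2 := hp'.coord_neg hd hB hB2 (T.conforming s hs t' ht1') hρ hb hρ2 hb2
  have e3 := hq.coord_neg hd hB1 hB2 (T.conforming t ht1 t' ht1') hρ1 hb1 hρ2 hb2
  -- The factor from `t` to `t'` is the product of those from `t` to `s` and from `s` to `t'`; two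
  -- negative numbers cannot have a negative product.
  rw [hp'.coord_eq hB hB2] at e3
  nlinarith [mul_pos_of_neg_of_neg e2 e1]

/-! ### Radial bump functions -/

/-- A smooth radial function supported in the unit ball. -/
def unitBump (x : Pt d) : ℝ := Real.smoothTransition (1 - ‖x‖ ^ 2)

theorem unitBump_contDiff : ContDiff ℝ ∞ (unitBump : Pt d → ℝ) :=
  Real.smoothTransition.contDiff.comp (contDiff_const.sub (contDiff_norm_sq ℝ))

theorem gradient_unitBump (x : Pt d) :
    gradient unitBump x = (-2 * deriv Real.smoothTransition (1 - ‖x‖ ^ 2)) • x := by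
  have h1 : HasDerivAt Real.smoothTransition (deriv Real.smoothTransition (1 - ‖x‖ ^ 2))
      (1 - ‖x‖ ^ 2) :=
    (Real.smoothTransition.contDiff (n := 1)).differentiable (by simp) |>.differentiableAt.hasDerivAt
  have h2 : HasFDerivAt (fun x : Pt d => 1 - ‖x‖ ^ 2) (-(2 • innerSL ℝ x)) x :=
    ((hasStrictFDerivAt_norm_sq x).hasFDerivAt).const_sub 1
  have h3 := h1.comp_hasFDerivAt x h2
  have h4 : HasGradientAt (unitBump : Pt d → ℝ)
      ((-2 * deriv Real.smoothTransition (1 - ‖x‖ ^ 2)) • x) x := by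
    rw [hasGradientAt_iff_hasFDerivAt]
    refine h3.congr_fderiv ?_
    ext y
    simp; ring
  exact h4.gradient

theorem deriv_smoothTransition_nonneg (t : ℝ) : 0 ≤ deriv Real.smoothTransition t :=
  Real.smoothTransition.monotone.deriv_nonneg

theorem deriv_smoothTransition_of_neg {t : ℝ} (ht : t < 0) : deriv Real.smoothTransition t = 0 := by
  have : Real.smoothTransition =ᶠ[𝓝 t] fun _ => 0 := by
    filter_upwards [Iio_mem_nhds ht] with x hx
    exact Real.smoothTransition.zero_of_nonpos (le_of_lt hx)
  rw [this.deriv_eq, deriv_const]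

theorem continuous_deriv_smoothTransition : Continuous (deriv Real.smoothTransition) :=
  (Real.smoothTransition.contDiff (n := 1)).continuous_deriv (by simp)

theorem exists_deriv_smoothTransition_pos :
    ∃ t ∈ Ioo (0 : ℝ) 1, 0 < deriv Real.smoothTransition t := by
  obtain ⟨t, ht, h⟩ := exists_deriv_eq_slope Real.smoothTransition (zero_lt_one' ℝ)
    Real.smoothTransition.continuous.continuousOn
    ((Real.smoothTransition.contDiff (n := 1)).differentiable (by simp)).differentiableOn
  exact ⟨t, ht, by rw [h]; simp⟩

/-- The density of the flux of `-∇unitBump / 2` through a half-space. -/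
def fluxDensity (ν x : Pt d) : ℝ := deriv Real.smoothTransition (1 - ‖x‖ ^ 2) * max ⟪ν, x⟫ 0

theorem fluxDensity_continuous (ν : Pt d) : Continuous (fluxDensity ν) :=
  (continuous_deriv_smoothTransition.comp (by fun_prop)).mul (by fun_prop)

/-- The smooth transition climbs from `0` to `1`, so its derivative is positive at some `t` by the
mean value theorem; the density is positive at the point of the ray through `ν` with `1 - ‖x‖² = t`.
-/
theorem integral_fluxDensity_pos {ν : Pt d} (hν : ‖ν‖ = 1) : 0 < ∫ x, fluxDensity ν x := by
  obtain ⟨t, ht, h⟩ := exists_deriv_smoothTransition_pos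
  have hs : 0 < √(1 - t) := Real.sqrt_pos.2 (by linarith [ht.2])
  refine (fluxDensity_continuous ν).integral_pos_of_hasCompactSupport_nonneg_nonzero
    (HasCompactSupport.intro (isCompact_closedBall (0 : Pt d) 1) fun x hx => ?_)
    (fun x => mul_nonneg (deriv_smoothTransition_nonneg _) (le_max_right _ _))
    (x := √(1 - t) • ν) (ne_of_gt ?_)
  · rw [mem_closedBall_zero_iff, not_le] at hx
    rw [fluxDensity, deriv_smoothTransition_of_neg (by nlinarith), zero_mul]
  · have h1 : 1 - ‖√(1 - t) • ν‖ ^ 2 = t := by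
      rw [norm_smul, hν, mul_one, Real.norm_of_nonneg hs.le, Real.sq_sqrt (by linarith [ht.2])]
      ring
    have h2 : ⟪ν, √(1 - t) • ν⟫ = √(1 - t) := by
      rw [inner_smul_right, real_inner_self_eq_norm_sq, hν]; ring
    rw [fluxDensity, h1, h2]
    exact mul_pos h (lt_max_of_lt_left hs)

/-- The reflection exchanging `ν` and `μ` preserves the volume and the radial factor. Thus `I₁` does
not depend on the orientation of the facet. -/
theorem integral_fluxDensity_eq {ν μ : Pt d} (hν : ‖ν‖ = 1) (hμ : ‖μ‖ = 1) :
    ∫ x, fluxDensity ν x = ∫ x, fluxDensity μ x := by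
  set R := (ℝ ∙ (ν - μ))ᗮ.reflection
  have hR : R ν = μ := Submodule.reflection_sub (by rw [hν, hμ])
  have := R.measurePreserving.integral_comp R.toHomeomorph.measurableEmbedding (fluxDensity μ)
  rw [← this]
  refine integral_congr_ae (.of_forall fun x => ?_)
  simp only [fluxDensity, ← hR, LinearIsometryEquiv.norm_map, LinearIsometryEquiv.inner_map_map]

theorem integral_comp_scale {E : Type*} [NormedAddCommGroup E] [NormedSpace ℝ E] (f : Pt d → E)
    (c : Pt d) {r : ℝ} (hr : 0 < r) : ∫ x, f (r⁻¹ • (x - c)) = r ^ d • ∫ x, f x := by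
  rw [integral_sub_right_eq_self (fun x => f (r⁻¹ • x)) c,
    Measure.integral_comp_inv_smul_of_nonneg _ _ hr.le]
  simp

/-- `η` is a smooth bump function on the ball of radius `r` about `c`, with gradient of size `Λ / r`,
mass `r ^ d * I₀`, and flux `r ^ (d - 1) * I₁` through half-balls. -/
structure IsBump (Λ I₀ I₁ : ℝ) (c : Pt d) (r : ℝ) (η : Pt d → ℝ) : Prop where
  contDiff : ContDiff ℝ ∞ η
  tsupport_subset : tsupport η ⊆ Metric.closedBall c r
  nonneg : ∀ x, 0 ≤ η x
  le_one : ∀ x, η x ≤ 1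
  norm_gradient_le : ∀ x, ‖gradient η x‖ ≤ Λ / r
  integral_eq : ∫ x, η x = r ^ d * I₀
  integral_gradient : ∫ x, gradient η x = 0
  flux : ∀ ν, ‖ν‖ = 1 → ∫ x in {x | 0 < ⟪ν, x - c⟫}, ⟪ν, gradient η x⟫ = -(r ^ d / r * I₁)

/-- The constants are fixed before `c` and `r`, since every `η` is a translate and dilate of
`unitBump`. The gradient of a radial function is odd, hence has mean zero. On a half-space its
normal component is `-2` times `fluxDensity`, which explains the factor in `I₁`. -/
theorem exists_bump (hd : 0 < d) : ∃ Λ I₀ I₁ : ℝ, 0 ≤ Λ ∧ 0 < I₀ ∧ 0 < I₁ ∧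
    ∀ (c : Pt d) (r : ℝ), 0 < r → ∃ η : Pt d → ℝ, IsBump Λ I₀ I₁ c r η := by
  have hsupp : ∀ x : Pt d, x ∉ Metric.closedBall 0 1 → unitBump x = 0 := fun x hx => by
    rw [mem_closedBall_zero_iff, not_le] at hx
    exact Real.smoothTransition.zero_of_nonpos (by nlinarith)
  have hcs : HasCompactSupport (unitBump : Pt d → ℝ) :=
    HasCompactSupport.intro (isCompact_closedBall 0 1) hsupp
  obtain ⟨Λ, hΛ⟩ := (gradient_continuous unitBump_contDiff).bounded_above_of_compact_support
    (hasCompactSupport_gradient hcs)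
  set e : Pt d := EuclideanSpace.single ⟨0, hd⟩ 1 with he
  have hen : ‖e‖ = 1 := by simp [he]
  have hI0 : 0 < ∫ x : Pt d, unitBump x :=
    unitBump_contDiff.continuous.integral_pos_of_hasCompactSupport_nonneg_nonzero hcs
      (fun x => Real.smoothTransition.nonneg _) (x := 0) (by simp [unitBump])
  refine ⟨Λ, ∫ x : Pt d, unitBump x, 2 * ∫ x, fluxDensity e x, (norm_nonneg _).trans (hΛ 0), hI0,
    mul_pos two_pos (integral_fluxDensity_pos hen), fun c r hr => ?_⟩
  have hmap : ContDiff ℝ ∞ fun x : Pt d => r⁻¹ • (x - c) :=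
    (contDiff_id.sub contDiff_const).const_smul r⁻¹
  have hgrad : ∀ x, gradient (fun x => unitBump (r⁻¹ • (x - c))) x =
      r⁻¹ • gradient unitBump (r⁻¹ • (x - c)) := fun x => by
    have h1 : HasGradientAt unitBump (gradient unitBump (r⁻¹ • (x - c))) (r⁻¹ • (x - c)) :=
      (unitBump_contDiff.differentiable (by simp)).differentiableAt.hasGradientAt
    have h2 : HasFDerivAt (fun x : Pt d => r⁻¹ • (x - c)) (r⁻¹ • ContinuousLinearMap.id ℝ (Pt d)) x :=
      ((hasFDerivAt_id x).sub_const c).const_smul r⁻¹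
    have h3 := h1.hasFDerivAt.comp x h2
    refine HasGradientAt.gradient ?_
    rw [hasGradientAt_iff_hasFDerivAt]
    refine h3.congr_fderiv ?_
    ext y
    simp
  refine ⟨fun x => unitBump (r⁻¹ • (x - c)), unitBump_contDiff.comp hmap, ?_,
    fun x => Real.smoothTransition.nonneg _, fun x => Real.smoothTransition.le_one _, fun x => ?_,
    ?_, ?_, fun ν hν => ?_⟩
  · refine closure_minimal (fun x hx => ?_) Metric.isClosed_closedBall
    by_contra h
    refine hx (hsupp _ fun h' => h ?_)
    rw [mem_closedBall_zero_iff, norm_smul, norm_inv, Real.norm_of_nonneg hr.le,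
      inv_mul_le_iff₀ hr, mul_one] at h'
    rwa [mem_closedBall_iff_norm]
  · rw [hgrad, norm_smul, norm_inv, Real.norm_of_nonneg hr.le, inv_mul_eq_div]
    gcongr
    exact hΛ _
  · rw [integral_comp_scale unitBump c hr, smul_eq_mul]
  · simp_rw [hgrad]
    rw [integral_smul, integral_comp_scale (gradient unitBump) c hr]
    suffices h : ∫ x : Pt d, gradient unitBump x = 0 by rw [h, smul_zero, smul_zero]
    have h1 := integral_neg_eq_self (gradient (unitBump : Pt d → ℝ)) volume
    have h2 : ∀ x : Pt d, gradient unitBump (-x) = -gradient unitBump x := fun x => by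
      rw [gradient_unitBump, gradient_unitBump, norm_neg, smul_neg]
    simp_rw [h2] at h1
    rw [integral_neg] at h1
    have h3 := add_eq_zero_iff_neg_eq.2 h1
    rw [← two_smul ℝ] at h3
    exact (smul_eq_zero.1 h3).resolve_left two_ne_zero
  · have hmeas : MeasurableSet {x : Pt d | 0 < ⟪ν, x - c⟫} :=
      (isOpen_lt continuous_const (by fun_prop)).measurableSet
    rw [← integral_indicator hmeas]
    have hpt : ∀ x, {x : Pt d | 0 < ⟪ν, x - c⟫}.indicator
        (fun x => ⟪ν, gradient (fun x => unitBump (r⁻¹ • (x - c))) x⟫) x =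
        r⁻¹ * (-2 * fluxDensity ν (r⁻¹ • (x - c))) := fun x => by
      by_cases hx : 0 < ⟪ν, x - c⟫
      · rw [indicator_of_mem (show x ∈ {x : Pt d | 0 < ⟪ν, x - c⟫} from hx), hgrad,
          gradient_unitBump, fluxDensity, max_eq_left (by rw [inner_smul_right]; positivity)]
        simp only [inner_smul_right]; ring
      · rw [indicator_of_notMem (show x ∉ {x : Pt d | 0 < ⟪ν, x - c⟫} from hx), fluxDensity,
          max_eq_right (by
            rw [inner_smul_right]
            exact mul_nonpos_of_nonneg_of_nonpos (by positivity) (not_lt.1 hx))]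
        ring
    simp_rw [hpt]
    rw [integral_const_mul, integral_const_mul, integral_comp_scale (fluxDensity ν) c hr,
      integral_fluxDensity_eq hν hen, smul_eq_mul]
    ring

theorem IsBump.hasCompactSupport {Λ I₀ I₁ : ℝ} {c : Pt d} {r : ℝ} {η : Pt d → ℝ}
    (h : IsBump Λ I₀ I₁ c r η) : HasCompactSupport η :=
  (isCompact_closedBall c r).of_isClosed_subset (isClosed_tsupport η) h.tsupport_subset

/-! ### Efficiency of the residual indicators of Poisson problems -/

/-- `z` is a weak solution of `-Δz = g` in `Ω`, with finite element approximation `zT` and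
approximate source `gT`. -/
structure IsPoissonPair (T : Mesh Ω) (z zT g gT : Pt d → ℝ) : Prop where
  memH1 : MemH1 Ω z
  weak : ∀ φ, IsTestFunction Ω φ →
    ∫ x in Ω, ⟪weakGrad Ω z x, gradient φ x⟫ = ∫ x in Ω, g x * φ x
  memV : T.MemV zT
  memL2 : MemL2 Ω g
  memL2_approx : MemL2 Ω gT

theorem Mesh.MemV.memH1 (T : Mesh Ω) (hΩ : IsOpen Ω) (hb : Bornology.IsBounded Ω)
    {v : Pt d → ℝ} (hv : T.MemV v) : MemH1 Ω v := by
  obtain ⟨w, C, hw, -, hwv⟩ := hv.exists_lipschitz T hΩ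
  have hwv' : ∀ x ∈ Ω, w x = v x := fun x hx => hwv x (subset_closure hx)
  refine ⟨?_, _, (hasWeakGradient_of_lipschitz hb hw).congr hΩ.measurableSet hwv'⟩
  exact (memLp_congr_ae ((ae_restrict_iff' hΩ.measurableSet).2 (.of_forall hwv'))).1
    (memL2_of_lipschitz hb hw)

/-- The weak gradient of a finite element function is its piecewise gradient. -/
theorem Mesh.MemV.weakGrad_ae_eq (T : Mesh Ω) (hΩ : IsOpen Ω) (hL : HasLipschitzBoundary Ω)
    (hb : Bornology.IsBounded Ω) {v : Pt d → ℝ} (hv : T.MemV v) {s : Finset (Pt d)}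
    (hs : s ∈ T.elements) {a : ℝ} {g : Pt d} (h : ∀ x ∈ simplex s, v x = a + ⟪g, x⟫) :
    ∀ᵐ x ∂volume.restrict (simplex s), weakGrad Ω v x = g := by
  obtain ⟨w, C, hw, -, hwv⟩ := hv.exists_lipschitz T hΩ
  have hwv' : ∀ x ∈ Ω, w x = v x := fun x hx => hwv x (subset_closure hx)
  have h1 := ((hasWeakGradient_of_lipschitz hb hw).congr hΩ.measurableSet hwv').weakGrad_ae_eq hΩ
  have h2 : weakGrad Ω v =ᵐ[volume.restrict (simplex s)] gradient w :=
    ae_mono (T.restrict_le hΩ hL hs) h1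
  have h3 := gradient_ae_eq_of_affine (s := s) (w := w) (a := a) (g := g) fun x hx =>
    (hwv x (T.simplex_subset hs hx)).trans (h x hx)
  filter_upwards [h2, h3] with x h4 h5
  rw [h4, h5]

section Poisson
variable {T : Mesh Ω} {z zT g gT : Pt d → ℝ}

theorem IsPoissonPair.memLp_weakGrad (h : IsPoissonPair T z zT g gT) (hΩ : IsOpen Ω)
    (hb : Bornology.IsBounded Ω) :
    MemLp (weakGrad Ω (z - zT)) 2 (volume.restrict Ω) ∧
      weakGrad Ω (z - zT) =ᵐ[volume.restrict Ω] weakGrad Ω z - weakGrad Ω zT := by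
  have hV := h.memV.memH1 T hΩ hb
  have h1 := HasWeakGradient.sub h.memH1.1 hV.1 h.memH1.hasWeakGradient hV.hasWeakGradient
  have h2 := h1.weakGrad_ae_eq hΩ
  exact ⟨(memLp_congr_ae h2).2 h1.1, h2⟩

theorem setIntegral_eq_of_tsupport {E : Type*} [NormedAddCommGroup E] [NormedSpace ℝ E]
    {B : Set (Pt d)} (hB : B ⊆ Ω) (hm : MeasurableSet Ω) {η : Pt d → ℝ} (hη : tsupport η ⊆ B)
    {F : Pt d → E} (hF : ∀ x, η x = 0 → gradient η x = 0 → F x = 0) :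
    ∫ x in Ω, F x = ∫ x in B, F x := by
  refine setIntegral_eq_of_subset_of_forall_sdiff_eq_zero hm hB fun x hx => ?_
  have h1 : x ∉ tsupport η := fun h => hx.2 (hη h)
  refine hF x (image_eq_zero_of_notMem_tsupport h1) ?_
  by_contra h
  exact h1 (support_gradient_subset η h)

theorem lpNorm_ball_le {E : Type*} [NormedAddCommGroup E] {f : Pt d → E} {c : Pt d} {r M : ℝ}
    (hr : 0 ≤ r) (hM : 0 ≤ M) (h : ∀ x, ‖f x‖ ≤ M) :
    lpNorm f 2 (volume.restrict (Metric.closedBall c r)) ≤ M * √(ballVol d * r ^ d) := by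
  have : IsFiniteMeasure (volume.restrict (Metric.closedBall c r)) :=
    ⟨by simpa using measure_closedBall_lt_top⟩
  have h1 := lpNorm_two_le_of_bound (f := f) (μ := volume.restrict (Metric.closedBall c r))
    (.of_forall h)
  rw [measureReal_restrict_apply_univ, volume_closedBall c hr] at h1
  refine (sq_le_sq₀ lpNorm_nonneg (by positivity)).1 ?_
  rw [mul_pow, Real.sq_sqrt (mul_nonneg (ballVol_nonneg d) (by positivity)), mul_comm (ballVol d)]
  exact h1

/-- Subtracting the weak equation for `z` replaces the residual by `∫ ∇(z - zT)·∇η - ∫ (g - gT) η`.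
Cauchy–Schwarz on the ball, with `|η| ≤ 1` and `|∇η| ≤ Λ / r`, gives the bound. -/
theorem IsPoissonPair.abs_residual_le (h : IsPoissonPair T z zT g gT) (hΩ : IsOpen Ω)
    (hb : Bornology.IsBounded Ω) {c : Pt d} {r Λ : ℝ} (hr : 0 < r) (hΛ : 0 ≤ Λ)
    (hB : Metric.closedBall c r ⊆ Ω) {I₀ I₁ : ℝ} {η : Pt d → ℝ} (hη : IsBump Λ I₀ I₁ c r η) :
    |(∫ x in Ω, gT x * η x) - ∫ x in Ω, ⟪weakGrad Ω zT x, gradient η x⟫| ≤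
      (lpNorm (g - gT) 2 (volume.restrict (Metric.closedBall c r)) +
        Λ / r * lpNorm (weakGrad Ω (z - zT)) 2 (volume.restrict (Metric.closedBall c r))) *
        √(ballVol d * r ^ d) := by
  have hsupp := hη.tsupport_subset
  have hφ : IsTestFunction Ω η := ⟨hη.contDiff, hη.hasCompactSupport, hsupp.trans hB⟩
  obtain ⟨hE, hEeq⟩ := h.memLp_weakGrad hΩ hb
  have hV := h.memV.memH1 T hΩ hb
  have i1 := (memLp_of_test hφ 2 (volume.restrict Ω))
  have i2 := (memLp_gradient_of_test hφ 2 (volume.restrict Ω))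
  have j1 : ∀ {u : Pt d → ℝ}, MemL2 Ω u → Integrable (fun x => u x * η x) (volume.restrict Ω) :=
    fun hu => hu.integrable_mul i1
  have j2 : ∀ {u : Pt d → Pt d}, MemLp u 2 (volume.restrict Ω) →
      Integrable (fun x => ⟪u x, gradient η x⟫) (volume.restrict Ω) := fun hu => integrable_inner_of_memLp hu i2
  have key : (∫ x in Ω, gT x * η x) - ∫ x in Ω, ⟪weakGrad Ω zT x, gradient η x⟫ =
      (∫ x in Ω, ⟪weakGrad Ω (z - zT) x, gradient η x⟫) - ∫ x in Ω, (g - gT) x * η x := by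
    have e1 : ∫ x in Ω, ⟪weakGrad Ω (z - zT) x, gradient η x⟫ =
        (∫ x in Ω, ⟪weakGrad Ω z x, gradient η x⟫) - ∫ x in Ω, ⟪weakGrad Ω zT x, gradient η x⟫ := by
      rw [← integral_sub (j2 h.memH1.hasWeakGradient.1) (j2 hV.hasWeakGradient.1)]
      refine integral_congr_ae (hEeq.mono fun x hx => ?_)
      simp only [hx, Pi.sub_apply, inner_sub_left]
    have e2 : ∫ x in Ω, (g - gT) x * η x = (∫ x in Ω, g x * η x) - ∫ x in Ω, gT x * η x := by
      rw [← integral_sub (j1 h.memL2) (j1 h.memL2_approx)]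
      simp only [Pi.sub_apply, sub_mul]
    rw [e1, e2, h.weak η hφ]; ring
  have hBle : volume.restrict (Metric.closedBall c r) ≤ volume.restrict Ω :=
    Measure.restrict_mono hB le_rfl
  rw [key, setIntegral_eq_of_tsupport hB hΩ.measurableSet hsupp fun x _ hx => by
      rw [hx, inner_zero_right],
    setIntegral_eq_of_tsupport hB hΩ.measurableSet hsupp fun x hx _ => by rw [hx, mul_zero]]
  refine (abs_sub _ _).trans ?_
  have a1 := abs_integral_inner_le (hE.mono_measure hBle) (i2.mono_measure hBle)
  have a2 := abs_integral_mul_le ((h.memL2.sub h.memL2_approx).mono_measure hBle)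
    (i1.mono_measure hBle)
  have a3 := lpNorm_ball_le (c := c) hr.le (by positivity) hη.norm_gradient_le
  have a4 := lpNorm_ball_le (c := c) (f := η) hr.le zero_le_one fun x => by
    rw [Real.norm_of_nonneg (hη.nonneg x)]; exact hη.le_one x
  rw [one_mul] at a4
  have n1 := lpNorm_nonneg (f := weakGrad Ω (z - zT)) (p := 2)
    (μ := volume.restrict (Metric.closedBall c r))
  have n2 := lpNorm_nonneg (f := g - gT) (p := 2) (μ := volume.restrict (Metric.closedBall c r))
  nlinarith [mul_le_mul_of_nonneg_left a3 n1, mul_le_mul_of_nonneg_left a4 n2]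

/-- The squared local error of a Poisson problem on an element, with source error and the
distance of the approximate source from the affine function `P`. -/
def localErrorSq (Ω : Set (Pt d)) (z zT g gT P : Pt d → ℝ) (s : Finset (Pt d)) : ℝ :=
  lpNorm (weakGrad Ω (z - zT)) 2 (volume.restrict (simplex s)) ^ 2 +
    size s ^ 2 * normL2 (simplex s) (g - gT) ^ 2 + size s ^ 2 * normL2 (simplex s) (gT - P) ^ 2

theorem localErrorSq_nonneg (Ω : Set (Pt d)) (z zT g gT P : Pt d → ℝ) (s : Finset (Pt d)) :
    0 ≤ localErrorSq Ω z zT g gT P s := by unfold localErrorSq; positivity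

/-- Moving from `p` by `ρ / 4` in the direction in which the absolute value of the affine function
grows yields `|a + ⟪q, p⟫| + ‖q‖ρ / 4`, and a ball of radius `ρ / 8` loses at most `‖q‖ρ / 8`. What
is left is at least a quarter of the maximum over the ball of radius `ρ / 2` about `p`. This
replaces the equivalence of norms on a reference element. -/
theorem exists_ball_sign (hd : 0 < d) (a : ℝ) (q p : Pt d) {ρ : ℝ} (hρ : 0 < ρ) :
    ∃ (c : Pt d) (ε : ℝ), |ε| = 1 ∧ dist c p = ρ / 4 ∧ ∀ x ∈ Metric.closedBall c (ρ / 8),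
      (|a + ⟪q, p⟫| + ‖q‖ * ρ / 2) / 4 ≤ ε * (a + ⟪q, x⟫) := by
  obtain ⟨u, hu, hqu⟩ : ∃ u : Pt d, ‖u‖ = 1 ∧ ⟪q, u⟫ = ‖q‖ := by
    rcases eq_or_ne q 0 with rfl | hq
    · exact ⟨EuclideanSpace.single ⟨0, hd⟩ 1, by simp, by simp⟩
    · have := norm_pos_iff.2 hq
      refine ⟨‖q‖⁻¹ • q, by rw [norm_smul, norm_inv, norm_norm, inv_mul_cancel₀ this.ne'], ?_⟩
      rw [inner_smul_right, real_inner_self_eq_norm_sq]; field_simp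
  obtain ⟨ε, hε, hεp⟩ : ∃ ε : ℝ, |ε| = 1 ∧ ε * (a + ⟪q, p⟫) = |a + ⟪q, p⟫| := by
    rcases le_total 0 (a + ⟪q, p⟫) with h | h
    · exact ⟨1, by simp, by rw [abs_of_nonneg h, one_mul]⟩
    · exact ⟨-1, by simp, by rw [abs_of_nonpos h]; ring⟩
  refine ⟨p + (ε * (ρ / 4)) • u, ε, hε, ?_, fun x hx => ?_⟩
  · rw [dist_eq_norm, add_sub_cancel_left, norm_smul, hu, mul_one, Real.norm_eq_abs, abs_mul, hε,
      one_mul, abs_of_pos (by positivity)]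
  · rw [mem_closedBall_iff_norm] at hx
    set w := x - (p + (ε * (ρ / 4)) • u) with hw
    have hx' : x = p + (ε * (ρ / 4)) • u + w := by rw [hw]; abel
    have h1 : |ε * ⟪q, w⟫| ≤ ‖q‖ * (ρ / 8) := by
      rw [abs_mul, hε, one_mul]
      exact (abs_real_inner_le_norm q w).trans (by gcongr)
    have h2 : ε * ε = 1 := by rw [← abs_mul_abs_self, hε, one_mul]
    have h3 : ε * (a + ⟪q, x⟫) = |a + ⟪q, p⟫| + ε * ε * (ρ / 4 * ‖q‖) + ε * ⟪q, w⟫ := by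
      rw [hx', inner_add_right, inner_add_right, inner_smul_right, hqu, ← hεp]; ring
    rw [h3, h2]
    have := (abs_le.1 h1).1
    have := abs_nonneg (a + ⟪q, p⟫)
    linarith

end Poisson

/-- The algebra common to both residuals: square, cancel `r ^ n` and multiply by `r ^ 2`. It is
applied with `A` a quarter of the size of `P`, and with `A = |J| / r`. -/
theorem sq_mul_le_of_residual {n : ℕ} {A r I a b c Λ V : ℝ} (hA : 0 ≤ A) (hr : 0 < r)
    (hI : 0 ≤ I) (hV : 0 ≤ V)
    (h : A * (r ^ n * I) ≤ (a + b + Λ / r * c) * √(V * r ^ n)) :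
    A ^ 2 * r ^ (n + 2) * I ^ 2 ≤ 3 * V * (r ^ 2 * a ^ 2 + r ^ 2 * b ^ 2 + Λ ^ 2 * c ^ 2) := by
  have hrn : 0 < r ^ n := by positivity
  have h1 := pow_le_pow_left₀ (by positivity) h 2
  rw [mul_pow (a + b + Λ / r * c), Real.sq_sqrt (by positivity)] at h1
  have h2 : A ^ 2 * r ^ n * I ^ 2 ≤ (a + b + Λ / r * c) ^ 2 * V := by
    refine le_of_mul_le_mul_right ?_ hrn
    calc _ = (A * (r ^ n * I)) ^ 2 := by ring
      _ ≤ _ := h1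
      _ = _ := by ring
  calc A ^ 2 * r ^ (n + 2) * I ^ 2 = r ^ 2 * (A ^ 2 * r ^ n * I ^ 2) := by ring
    _ ≤ r ^ 2 * ((a + b + Λ / r * c) ^ 2 * V) := by gcongr
    _ = V * (r * a + r * b + Λ * c) ^ 2 := by field_simp
    _ ≤ V * (3 * (r ^ 2 * a ^ 2 + r ^ 2 * b ^ 2 + Λ ^ 2 * c ^ 2)) := by
        gcongr
        nlinarith [sq_nonneg (r * a - r * b), sq_nonneg (r * a - Λ * c), sq_nonneg (r * b - Λ * c)]
    _ = _ := by ring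

/-- The radius of an inscribed ball is controlled by the edges. -/
theorem Mesh.le_size_of_ball (T : Mesh Ω) (hd : 1 ≤ d) {s : Finset (Pt d)} (hs : s ∈ T.elements)
    {p : Pt d} {ρ : ℝ} (hρ : 0 < ρ) (hb : Metric.closedBall p (ρ / 2) ⊆ simplex s) :
    ρ ≤ size s := by
  obtain ⟨c, G, hB⟩ := T.exists_isBary hs
  obtain ⟨u, hu, w, hw, hne⟩ := Finset.one_lt_card.1 (show 1 < s.card by rw [T.card_eq s hs]; omega)
  exact (hB.le_dist hρ hb hu hw hne).trans
    (Metric.dist_le_diam_of_mem (isCompact_simplex s).isBounded (subset_convexHull ℝ _ hu)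
      (subset_convexHull ℝ _ hw))

theorem memLp_simplex_of_continuous {P : Pt d → ℝ} (hP : Continuous P) (s : Finset (Pt d)) :
    MemLp P 2 (volume.restrict (simplex s)) := by
  have : IsFiniteMeasure (volume.restrict (simplex s)) :=
    ⟨by simpa using (isCompact_simplex s).measure_lt_top⟩
  obtain ⟨M, hM⟩ := ((isCompact_simplex s).image hP).isBounded.exists_norm_le
  refine MemLp.of_bound hP.aestronglyMeasurable M ?_
  rw [ae_restrict_iff' (measurableSet_simplex s)]
  exact .of_forall fun x hx => hM _ (mem_image_of_mem P hx)

theorem IsPoissonPair.affine_source_le {T : Mesh Ω} {z zT g gT : Pt d → ℝ}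
    (h : IsPoissonPair T z zT g gT) (hΩ : IsOpen Ω) (hL : HasLipschitzBoundary Ω)
    (hb : Bornology.IsBounded Ω) {s : Finset (Pt d)} (hs : s ∈ T.elements) {c : Pt d}
    {r Λ I₀ I₁ m ε a : ℝ} {q : Pt d} {P η : Pt d → ℝ} (hr : 0 < r) (hΛ : 0 ≤ Λ)
    (hBs : Metric.closedBall c r ⊆ simplex s) (hBΩ : Metric.closedBall c r ⊆ Ω)
    (hη : IsBump Λ I₀ I₁ c r η) (hPq : ∀ x, P x = a + ⟪q, x⟫) (hε : |ε| = 1)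
    (hsign : ∀ x ∈ Metric.closedBall c r, m ≤ ε * P x) :
    m * (r ^ d * I₀) ≤ (lpNorm (gT - P) 2 (volume.restrict (Metric.closedBall c r)) +
      lpNorm (g - gT) 2 (volume.restrict (Metric.closedBall c r)) +
      Λ / r * lpNorm (weakGrad Ω (z - zT)) 2 (volume.restrict (Metric.closedBall c r))) *
      √(ballVol d * r ^ d) := by
  have hle : volume.restrict (Metric.closedBall c r) ≤ volume.restrict (simplex s) :=
    Measure.restrict_mono hBs le_rfl
  have hres := h.abs_residual_le hΩ hb hr hΛ hBΩ hη
  have η2 := hη.tsupport_subset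
  -- `∇zT` is constant on the ball and `∇η` has mean zero, so the stiffness term drops out.
  have hgrad0 : ∫ x in Ω, ⟪weakGrad Ω zT x, gradient η x⟫ = 0 := by
    obtain ⟨qT, ⟨aT, gr, -, hqT⟩, hzq⟩ := h.memV.2.1 s hs
    have haff : ∀ x ∈ simplex s, zT x = aT + ⟪gr, x⟫ := fun x hx => (hzq hx).trans (hqT x)
    have hae : ∀ᵐ x ∂volume.restrict (Metric.closedBall c r), weakGrad Ω zT x = gr :=
      ae_mono hle (h.memV.weakGrad_ae_eq T hΩ hL hb hs haff)
    rw [setIntegral_eq_of_tsupport hBΩ hΩ.measurableSet η2 fun x _ hx => by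
        rw [hx, inner_zero_right]]
    rw [integral_congr_ae (g := fun x => ⟪gr, gradient η x⟫)
        (hae.mono fun x hx => by simp only [hx]),
      ← setIntegral_eq_of_tsupport (Ω := univ) (subset_univ _) MeasurableSet.univ η2 fun x _ hx => by
        rw [hx, inner_zero_right], setIntegral_univ, integral_inner, hη.integral_gradient, inner_zero_right]
    exact (gradient_continuous hη.contDiff).integrable_of_hasCompactSupport 
      (hasCompactSupport_gradient hη.hasCompactSupport)
  rw [hgrad0, sub_zero] at hres
  have hgTs : MemLp gT 2 (volume.restrict (simplex s)) :=
    h.memL2_approx.mono_measure (T.restrict_le hΩ hL hs)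
  have hPc : Continuous P := by
    rw [show P = fun x => a + ⟪q, x⟫ from funext hPq]; fun_prop
  have hPs := memLp_simplex_of_continuous hPc s
  have hηm : ∀ μ : Measure (Pt d), [IsFiniteMeasureOnCompacts μ] → MemLp η 2 μ := fun μ _ =>
    hη.contDiff.continuous.memLp_of_hasCompactSupport hη.hasCompactSupport
  have hηB := lpNorm_ball_le (c := c) (f := η) hr.le zero_le_one fun x => by
    rw [Real.norm_of_nonneg (hη.nonneg x)]; exact hη.le_one x
  set o := lpNorm (gT - P) 2 (volume.restrict (Metric.closedBall c r))
  set k := lpNorm (g - gT) 2 (volume.restrict (Metric.closedBall c r))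
  set e := lpNorm (weakGrad Ω (z - zT)) 2 (volume.restrict (Metric.closedBall c r))
  have ho0 : 0 ≤ o := lpNorm_nonneg
  have s1 : m * (r ^ d * I₀) = ∫ x in Metric.closedBall c r, m * η x := by
    rw [integral_const_mul, ← hη.integral_eq, ← setIntegral_univ,
      setIntegral_eq_of_tsupport (subset_univ _) MeasurableSet.univ η2 fun x hx _ => hx]
  have i1 : Integrable (fun x => P x * η x) (volume.restrict (Metric.closedBall c r)) :=
    (hPs.mono_measure hle).integrable_mul (hηm _)
  have i2 : Integrable (fun x => gT x * η x) (volume.restrict (Metric.closedBall c r)) :=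
    (hgTs.mono_measure hle).integrable_mul (hηm _)
  have i3 : Integrable (fun x => (gT - P) x * η x) (volume.restrict (Metric.closedBall c r)) :=
    ((hgTs.sub hPs).mono_measure hle).integrable_mul (hηm _)
  have s2 : ∫ x in Metric.closedBall c r, m * η x ≤
      ε * ∫ x in Metric.closedBall c r, P x * η x := by
    rw [← integral_const_mul]
    refine setIntegral_mono_on ((hη.contDiff.continuous.integrable_of_hasCompactSupport hη.hasCompactSupport).restrict.const_mul _)
      (i1.const_mul ε) Metric.isClosed_closedBall.measurableSet fun x hx => ?_
    rw [← mul_assoc]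
    exact mul_le_mul_of_nonneg_right (hsign x hx) (hη.nonneg x)
  have s3 : ∫ x in Metric.closedBall c r, P x * η x = (∫ x in Ω, gT x * η x) -
      ∫ x in Metric.closedBall c r, (gT - P) x * η x := by
    rw [setIntegral_eq_of_tsupport hBΩ hΩ.measurableSet η2 fun x hx _ => by rw [hx, mul_zero],
      ← integral_sub i2 i3]
    refine integral_congr_ae (.of_forall fun x => ?_)
    simp only [Pi.sub_apply]; ring
  have s4 := abs_integral_mul_le ((hgTs.sub hPs).mono_measure hle)
    (hηm (volume.restrict (Metric.closedBall c r)))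
  have s5 : |∫ x in Metric.closedBall c r, (gT - P) x * η x| ≤ o * √(ballVol d * r ^ d) := by
    refine s4.trans ?_
    rw [one_mul] at hηB
    exact mul_le_mul_of_nonneg_left hηB ho0
  calc m * (r ^ d * I₀) ≤ ε * ∫ x in Metric.closedBall c r, P x * η x := s1.trans_le s2
    _ ≤ |ε * ∫ x in Metric.closedBall c r, P x * η x| := le_abs_self _
    _ = |(∫ x in Ω, gT x * η x) - ∫ x in Metric.closedBall c r, (gT - P) x * η x| := by
        rw [abs_mul, hε, one_mul, s3]
    _ ≤ |∫ x in Ω, gT x * η x| + |∫ x in Metric.closedBall c r, (gT - P) x * η x| := abs_sub _ _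
    _ ≤ (k + Λ / r * e) * √(ballVol d * r ^ d) + o * √(ballVol d * r ^ d) := add_le_add hres s5
    _ = _ := by ring

/-- Counterpart of `exists_ball_sign`: points of the simplex are within `σρ` of `p`, so an affine
function exceeds its maximum over the inscribed ball by at most the factor `1 + 2σ`. -/
theorem normL2_affine_sq_le {s : Finset (Pt d)} {p q : Pt d} {a ρ σ : ℝ} {P : Pt d → ℝ}
    (hρ : 0 < ρ) (hσ0 : 0 ≤ σ) (hball : Metric.closedBall p (ρ / 2) ⊆ simplex s)
    (hσ : size s ≤ σ * ρ) (hPq : ∀ x, P x = a + ⟪q, x⟫) :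
    normL2 (simplex s) P ^ 2 ≤
      ((1 + 2 * σ) * (|a + ⟪q, p⟫| + ‖q‖ * ρ / 2)) ^ 2 * (size s ^ d * ballVol d) := by
  have : IsFiniteMeasure (volume.restrict (simplex s)) :=
    ⟨by simpa using (isCompact_simplex s).measure_lt_top⟩
  have hps : p ∈ simplex s := hball (Metric.mem_closedBall_self (by positivity))
  have hbd : ∀ᵐ x ∂volume.restrict (simplex s), ‖P x‖ ≤ (1 + 2 * σ) * (|a + ⟪q, p⟫| + ‖q‖ * ρ / 2) := by
    rw [ae_restrict_iff' (measurableSet_simplex s)]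
    refine .of_forall fun x hx => ?_
    have hxp : ‖x - p‖ ≤ σ * ρ := by
      rw [← dist_eq_norm]
      exact (subset_closedBall_of_mem subset_rfl hps hx).trans hσ
    have h1 : P x = (a + ⟪q, p⟫) + ⟪q, x - p⟫ := by rw [hPq, inner_sub_right]; ring
    rw [h1, Real.norm_eq_abs]
    have h2 : |⟪q, x - p⟫| ≤ ‖q‖ * (σ * ρ) :=
      (abs_real_inner_le_norm _ _).trans (by gcongr)
    have h3 := abs_add_le (a + ⟪q, p⟫) ⟪q, x - p⟫
    have h4 : 0 ≤ σ * |a + ⟪q, p⟫| := by positivity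
    have h5 : 0 ≤ ‖q‖ * ρ := by positivity
    nlinarith
  refine (lpNorm_two_le_of_bound hbd).trans ?_
  rw [measureReal_restrict_apply_univ]
  gcongr
  exact volume_simplex_le ⟨p, hps⟩

set_option maxHeartbeats 400000 in
/-- Efficiency of the element residual. -/
theorem exists_element_residual_le (hd : 2 ≤ d) (hΩ : IsOpen Ω) (hL : HasLipschitzBoundary Ω)
    (hb : Bornology.IsBounded Ω) (σ : ℝ) : ∃ C : ℝ, 0 ≤ C ∧
    ∀ T : Mesh Ω, T.ShapeRegular σ → ∀ z zT g gT : Pt d → ℝ, IsPoissonPair T z zT g gT →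
    ∀ s ∈ T.elements, ∀ P : Pt d → ℝ, IsPoly 1 P →
      size s ^ 2 * normL2 (simplex s) gT ^ 2 ≤ C * localErrorSq Ω z zT g gT P s := by
  have hd0 : 0 < d := by omega
  obtain ⟨Λ, I₀, I₁, hΛ, hI₀, -, hbump⟩ := exists_bump hd0
  set V := ballVol d with hVdef
  have hV : 0 ≤ V := ballVol_nonneg d
  -- The factors come from the upper bound for `P` on the simplex, from `size s ≤ 8σr`, and from the
  -- bump estimate, where `48 = 3 · 4²` contains the quarter of `exists_ball_sign`. The absolute
  -- value is there because `σ ≥ 0` follows only once an element exists.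
  set K : ℝ := (1 + 2 * |σ|) ^ 2 * V * (8 * |σ|) ^ (d + 2) * (48 * V * (1 + Λ ^ 2) / I₀ ^ 2) with hK
  refine ⟨2 * K + 2, by positivity, fun T hT z zT g gT h s hs P hP => ?_⟩
  obtain ⟨a, q, -, hPq⟩ := hP
  obtain ⟨p, ρ, hρ, hball, hσ⟩ := hT s hs
  have hρs : ρ ≤ size s := T.le_size_of_ball (by omega) hs hρ hball
  have hσ0 : 0 ≤ σ := by
    by_contra! hneg
    nlinarith
  rw [abs_of_nonneg hσ0] at hK
  obtain ⟨c, ε, hε, hcp, hsign⟩ := exists_ball_sign hd0 a q p hρ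
  set M := |a + ⟪q, p⟫| + ‖q‖ * ρ / 2 with hM
  have hM0 : 0 ≤ M := by positivity
  -- The center is at distance `ρ / 4` from `p`, so this ball stays strictly inside the inscribed
  -- one, hence inside `Ω`.
  set r := ρ / 8 with hr
  have hr0 : 0 < r := by positivity
  obtain ⟨η, hη⟩ := hbump c r hr0
  have hBsub : Metric.closedBall c r ⊆ interior (simplex s) := by
    refine Subset.trans ?_ (interior_mono hball)
    refine Subset.trans (fun x hx => ?_) Metric.ball_subset_interior_closedBall
    rw [Metric.mem_closedBall] at hx
    rw [Metric.mem_ball]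
    calc dist x p ≤ dist x c + dist c p := dist_triangle _ _ _
      _ ≤ ρ / 8 + ρ / 4 := add_le_add hx hcp.le
      _ < ρ / 2 := by linarith
  have hBs : Metric.closedBall c r ⊆ simplex s := hBsub.trans interior_subset
  have hBΩ : Metric.closedBall c r ⊆ Ω := hBsub.trans (T.interior_simplex_subset hΩ hL hs)
  have hle : volume.restrict (Metric.closedBall c r) ≤ volume.restrict (simplex s) :=
    Measure.restrict_mono hBs le_rfl
  have hgTs : MemLp gT 2 (volume.restrict (simplex s)) :=
    h.memL2_approx.mono_measure (T.restrict_le hΩ hL hs)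
  have hPc : Continuous P := by
    rw [show P = fun x => a + ⟪q, x⟫ from funext hPq]; fun_prop
  have hPs := memLp_simplex_of_continuous hPc s
  have hmain := h.affine_source_le hΩ hL hb hs hr0 hΛ hBs hBΩ hη hPq hε
    fun x hx => (hPq x).symm ▸ hsign x hx
  set o := lpNorm (gT - P) 2 (volume.restrict (Metric.closedBall c r))
  set k := lpNorm (g - gT) 2 (volume.restrict (Metric.closedBall c r))
  set e := lpNorm (weakGrad Ω (z - zT)) 2 (volume.restrict (Metric.closedBall c r))
  have ho0 : 0 ≤ o := lpNorm_nonneg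
  have hsq := sq_mul_le_of_residual (by positivity) hr0 hI₀.le hV hmain
  set W := localErrorSq Ω z zT g gT P s with hW
  have hW0 : 0 ≤ W := localErrorSq_nonneg ..
  have hrs : r ≤ size s := by linarith
  have hEs := (h.memLp_weakGrad hΩ hb).1.mono_measure (T.restrict_le hΩ hL hs)
  have hks := (h.memL2.sub h.memL2_approx).mono_measure (T.restrict_le hΩ hL hs)
  have hsum : r ^ 2 * o ^ 2 + r ^ 2 * k ^ 2 + Λ ^ 2 * e ^ 2 ≤ (1 + Λ ^ 2) * W := by
    have t1 : o ≤ normL2 (simplex s) (gT - P) := lpNorm_two_mono_measure (hgTs.sub hPs) hle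
    have t2 : k ≤ normL2 (simplex s) (g - gT) := lpNorm_two_mono_measure hks hle
    have t3 : e ≤ lpNorm (weakGrad Ω (z - zT)) 2 (volume.restrict (simplex s)) :=
      lpNorm_two_mono_measure hEs hle
    have u1 : r ^ 2 * o ^ 2 ≤ size s ^ 2 * normL2 (simplex s) (gT - P) ^ 2 := by gcongr
    have u2 : r ^ 2 * k ^ 2 ≤ size s ^ 2 * normL2 (simplex s) (g - gT) ^ 2 := by
      have : 0 ≤ k := lpNorm_nonneg
      gcongr
    have u3 : e ^ 2 ≤ lpNorm (weakGrad Ω (z - zT)) 2 (volume.restrict (simplex s)) ^ 2 := by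
      have : 0 ≤ e := lpNorm_nonneg
      gcongr
    have v1 : r ^ 2 * o ^ 2 + r ^ 2 * k ^ 2 + e ^ 2 ≤ W := by
      rw [hW, localErrorSq]; linarith
    have v2 : 0 ≤ r ^ 2 * o ^ 2 + r ^ 2 * k ^ 2 := by positivity
    calc _ ≤ (1 + Λ ^ 2) * (r ^ 2 * o ^ 2 + r ^ 2 * k ^ 2 + e ^ 2) := by
          have := mul_nonneg (sq_nonneg Λ) v2
          have := sq_nonneg e
          linarith
      _ ≤ _ := by gcongr
  have hMbound : M ^ 2 * r ^ (d + 2) ≤ 48 * V * (1 + Λ ^ 2) / I₀ ^ 2 * W := by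
    rw [div_mul_eq_mul_div, le_div_iff₀ (by positivity)]
    calc M ^ 2 * r ^ (d + 2) * I₀ ^ 2 = 16 * ((M / 4) ^ 2 * r ^ (d + 2) * I₀ ^ 2) := by ring
      _ ≤ 16 * (3 * V * ((1 + Λ ^ 2) * W)) := by
          exact mul_le_mul_of_nonneg_left
            (hsq.trans (mul_le_mul_of_nonneg_left hsum (by positivity))) (by norm_num)
      _ = _ := by ring
  have hPnorm : normL2 (simplex s) P ^ 2 ≤ ((1 + 2 * σ) * M) ^ 2 * (size s ^ d * V) :=
    normL2_affine_sq_le hρ hσ0 hball hσ hPq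
  have hsize : size s ≤ 8 * σ * r := by rw [hr]; linarith
  have hs0 := size_nonneg s
  have hPfin : size s ^ 2 * normL2 (simplex s) P ^ 2 ≤ K * W := by
    calc size s ^ 2 * normL2 (simplex s) P ^ 2
        ≤ size s ^ 2 * (((1 + 2 * σ) * M) ^ 2 * (size s ^ d * V)) := by gcongr
      _ = (1 + 2 * σ) ^ 2 * V * M ^ 2 * size s ^ (d + 2) := by ring
      _ ≤ (1 + 2 * σ) ^ 2 * V * M ^ 2 * (8 * σ * r) ^ (d + 2) := by gcongr
      _ = (1 + 2 * σ) ^ 2 * V * (8 * σ) ^ (d + 2) * (M ^ 2 * r ^ (d + 2)) := by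
          rw [mul_pow (8 * σ) r]; ring
      _ ≤ (1 + 2 * σ) ^ 2 * V * (8 * σ) ^ (d + 2) *
          (48 * V * (1 + Λ ^ 2) / I₀ ^ 2 * W) := by gcongr
      _ = K * W := by rw [hK]; ring
  have htri : normL2 (simplex s) gT ≤ normL2 (simplex s) P + normL2 (simplex s) (gT - P) :=
    lpNorm_le_lpNorm_add_lpNorm_sub' hPs (by norm_num)
  have hgT0 : 0 ≤ normL2 (simplex s) gT := lpNorm_nonneg
  have htri2 : normL2 (simplex s) gT ^ 2 ≤
      2 * normL2 (simplex s) P ^ 2 + 2 * normL2 (simplex s) (gT - P) ^ 2 := by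
    nlinarith [pow_le_pow_left₀ hgT0 htri 2,
      sq_nonneg (normL2 (simplex s) P - normL2 (simplex s) (gT - P))]
  have hosc : size s ^ 2 * normL2 (simplex s) (gT - P) ^ 2 ≤ W := by
    rw [hW, localErrorSq]
    have : 0 ≤ lpNorm (weakGrad Ω (z - zT)) 2 (volume.restrict (simplex s)) ^ 2 +
        size s ^ 2 * normL2 (simplex s) (g - gT) ^ 2 := by positivity
    linarith
  calc size s ^ 2 * normL2 (simplex s) gT ^ 2
      ≤ size s ^ 2 * (2 * normL2 (simplex s) P ^ 2 + 2 * normL2 (simplex s) (gT - P) ^ 2) := by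
        gcongr
    _ = 2 * (size s ^ 2 * normL2 (simplex s) P ^ 2) +
        2 * (size s ^ 2 * normL2 (simplex s) (gT - P) ^ 2) := by ring
    _ ≤ 2 * (K * W) + 2 * W := by gcongr
    _ = (2 * K + 2) * W := by ring

/-- The jump of the normal derivative of a finite element function is constant on a side, and
is the flux of its weak gradient tested with a bump function. -/
theorem IsFacetPair.exists_jump_eq {T : Mesh Ω} (hd : 2 ≤ d) (hΩ : IsOpen Ω)
    (hL : HasLipschitzBoundary Ω) (hb : Bornology.IsBounded Ω) {v : Pt d → ℝ} (hv : T.MemV v)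
    {s t F : Finset (Pt d)} {v₁ v₂ : Pt d} (h : IsFacetPair s t F v₁ v₂) (hs : s ∈ T.elements)
    (ht : t ∈ T.elements) {p p' : Pt d} {ρ ρ' r : ℝ} (hρ : 0 < ρ)
    (hball : Metric.closedBall p (ρ / 2) ⊆ simplex s) (hρ' : 0 < ρ')
    (hball' : Metric.closedBall p' (ρ' / 2) ⊆ simplex t) (hr : d * r ≤ ρ) (hr' : d * r ≤ ρ')
    (hBΩ : Metric.closedBall (facetCenter F) r ⊆ Ω) {Λ I₀ I₁ : ℝ} {η : Pt d → ℝ}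
    (hη : IsBump Λ I₀ I₁ (facetCenter F) r η) :
    ∃ J : ℝ, (∀ x ∈ side s t, jump v s t x = J) ∧
      ∫ x in Ω, ⟪weakGrad Ω v x, gradient η x⟫ = J * (r ^ d / r * I₁) := by
  have hd0 : 0 < d := by omega
  obtain ⟨c, G, hB⟩ := T.exists_isBary hs
  obtain ⟨c', G', hB'⟩ := T.exists_isBary ht
  obtain ⟨qs, ⟨as, gs, -, hqs⟩, hvs⟩ := hv.2.1 s hs
  obtain ⟨qt, ⟨at', gt', -, hqt⟩, hvt⟩ := hv.2.1 t ht
  have has : ∀ x ∈ simplex s, v x = as + ⟪gs, x⟫ := fun x hx => (hvs hx).trans (hqs x)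
  have hat : ∀ x ∈ simplex t, v x = at' + ⟪gt', x⟫ := fun x hx => (hvt hx).trans (hqt x)
  obtain ⟨u, hu⟩ : F.Nonempty := by rw [← Finset.card_pos, h.card]; exact hd0
  obtain ⟨hu1, hu2⟩ := h.mem_left_iff.1 hu
  have hG := norm_pos_iff.2 (hB.grad_ne_zero h.mem_left hu1 hu2.symm)
  have hk := h.coord_neg hd hB hB' (T.conforming s hs t ht) hρ hball hρ' hball'
  have hgrad := h.grad_eq hB hB'
  -- The two affine pieces agree at the common vertices, so their gradients differ by a multiple of
  -- `G v₁`: tangential derivatives do not jump.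
  have hvan : ∀ w ∈ s, w ≠ v₁ → (at' - as) + ⟪gt' - gs, w⟫ = 0 := fun w hw hne => by
    have hwF := h.mem_left_iff.2 ⟨hw, hne⟩
    have h1 := has w (subset_convexHull ℝ _ hw)
    have h2 := hat w (subset_convexHull ℝ _ (h.symm.mem_left_iff.1 hwF).1)
    rw [inner_sub_left]; linarith
  have hdiff := hB.grad_eq_of_vanish h.mem_left hvan
  set m := (at' - as) + ⟪gt' - gs, v₁⟫
  set ν : Pt d := -(‖G v₁‖⁻¹ • G v₁) with hν
  have hνn : ‖ν‖ = 1 := by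
    rw [hν, norm_neg, norm_smul, norm_inv, norm_norm, inv_mul_cancel₀ hG.ne']
  have hGν : G v₁ = -(‖G v₁‖ • ν) := by
    rw [hν, smul_neg, neg_neg, smul_smul, mul_inv_cancel₀ hG.ne', one_smul]
  have hdiffν : gt' - gs = (-(m * ‖G v₁‖)) • ν := by
    rw [hdiff]; nth_rewrite 1 [hGν]; rw [smul_neg, smul_smul, neg_smul]
  have hns : outerNormal (simplex s) (side s t) = ν := h.outerNormal_eq hd hB
  -- The gradients of the two coordinates are opposite by `coord_neg`, hence so are the outer
  -- normals.
  have hnt : outerNormal (simplex t) (side s t) = -ν := by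
    rw [side_comm, h.symm.outerNormal_eq hd hB', hgrad, norm_smul, Real.norm_of_nonpos hk.le, hν,
      neg_neg, smul_smul, ← neg_smul]
    congr 1
    field_simp
    exact div_self hk.ne
  have hints : (interior (simplex s)).Nonempty := ⟨p, interior_mono hball
    (Metric.ball_subset_interior_closedBall (Metric.mem_ball_self (by positivity)))⟩
  have hintt : (interior (simplex t)).Nonempty := ⟨p', interior_mono hball'
    (Metric.ball_subset_interior_closedBall (Metric.mem_ball_self (by positivity)))⟩
  clear_value ν
  refine ⟨m * ‖G v₁‖, fun x hx => ?_, ?_⟩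
  · have hx' : x ∈ simplex s ∩ simplex t := (T.conforming s hs t ht).symm.subset hx
    rw [jump, hns, hnt, gradientWithin_eq_of_affine hints has hx'.1,
      gradientWithin_eq_of_affine hintt hat hx'.2, inner_neg_left, ← sub_eq_add_neg,
      ← inner_sub_right, ← neg_sub, hdiffν, neg_smul, neg_neg, inner_smul_right,
      real_inner_self_eq_norm_sq, hνn]
    ring
  · set B := Metric.closedBall (facetCenter F) r
    set H : Set (Pt d) := {x | 0 < ⟪ν, x - facetCenter F⟫} with hH
    have hHm : MeasurableSet H := (isOpen_lt continuous_const (by fun_prop)).measurableSet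
    have hmemH : ∀ x, x ∈ H ↔ c v₁ + ⟪G v₁, x⟫ < 0 := fun x => by
      have h0 := h.coord_center hd0 hB
      have h1 : c v₁ + ⟪G v₁, x⟫ = -(‖G v₁‖ * ⟪ν, x - facetCenter F⟫) := by
        have : c v₁ + ⟪G v₁, x⟫ = ⟪G v₁, x - facetCenter F⟫ := by rw [inner_sub_right]; linarith
        rw [this]; nth_rewrite 1 [hGν]; rw [inner_neg_left, inner_smul_left]; simp
      rw [h1, neg_lt_zero, mul_pos_iff_of_pos_left hG]; rfl
    have hsub := h.closedBall_subset hd hB hB' (T.conforming s hs t ht) hρ hball hρ' hball' hr hr'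
    have hBm : MeasurableSet B := Metric.isClosed_closedBall.measurableSet
    have ae1 := (ae_restrict_iff' (measurableSet_simplex s)).1 (hv.weakGrad_ae_eq T hΩ hL hb hs has)
    have ae2 := (ae_restrict_iff' (measurableSet_simplex t)).1 (hv.weakGrad_ae_eq T hΩ hL hb ht hat)
    -- On the ball `∇v` is the constant `gs` plus a multiple of `ν` on the half-ball in `t`. The
    -- constant part integrates to zero and the other part yields the flux, so no surface integral
    -- is needed.
    have hae : ∀ᵐ x ∂volume.restrict B, ⟪weakGrad Ω v x, gradient η x⟫ =
        ⟪gs, gradient η x⟫ + -(m * ‖G v₁‖) * H.indicator (fun x => ⟪ν, gradient η x⟫) x := by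
      rw [ae_restrict_iff' hBm]
      filter_upwards [ae1, ae2] with x h1 h2 hx
      by_cases hxH : x ∈ H
      · have hxs : x ∉ simplex s := fun hxs =>
          ((hmemH x).1 hxH).not_ge ((h.mem_simplex_iff hd0 hB hρ hball hr hx).1 hxs)
        rw [h2 ((hsub hx).resolve_left hxs), indicator_of_mem hxH, ← sub_add_cancel gt' gs, hdiffν,
          inner_add_left, inner_smul_left]
        simp only [conj_trivial]; ring
      · have hxs : x ∈ simplex s := (h.mem_simplex_iff hd0 hB hρ hball hr hx).2
          (not_lt.1 fun hlt => hxH ((hmemH x).2 hlt))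
        rw [h1 hxs, indicator_of_notMem hxH, mul_zero, add_zero]
    have hgi : Integrable (gradient η) :=
      (gradient_continuous hη.contDiff).integrable_of_hasCompactSupport
        (hasCompactSupport_gradient hη.hasCompactSupport)
    have i1 : Integrable fun x => ⟪gs, gradient η x⟫ := hgi.const_inner gs
    have i2 : Integrable fun x => ⟪ν, gradient η x⟫ := hgi.const_inner ν
    rw [setIntegral_eq_of_tsupport hBΩ hΩ.measurableSet hη.tsupport_subset fun x _ hx => by
        rw [hx, inner_zero_right], integral_congr_ae hae,
      ← setIntegral_eq_of_tsupport (Ω := univ) (subset_univ _) MeasurableSet.univ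
        hη.tsupport_subset fun x _ hx => ?_, setIntegral_univ,
      integral_add i1 ((i2.indicator hHm).const_mul _), integral_inner hgi, hη.integral_gradient,
      inner_zero_right, zero_add, integral_const_mul, integral_indicator hHm, hη.flux ν hνn]
    · ring
    · by_cases hxH : x ∈ H
      · rw [indicator_of_mem hxH, hx, inner_zero_right, inner_zero_right]; ring
      · rw [indicator_of_notMem hxH, hx, inner_zero_right]; ring

/-- The jump is constant, and the side lies in a hyperplane and in a ball of radius `size s`; an
upper bound for its surface measure suffices. -/
theorem IsFacetPair.lpNorm_jump_le {z : Pt d → ℝ} (hd : 2 ≤ d) {s t F : Finset (Pt d)}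
    {v w : Pt d} (h : IsFacetPair s t F v w) {c : Pt d → ℝ} {G : Pt d → Pt d} (hB : IsBary s c G)
    {J : ℝ} (hJ : ∀ x ∈ side s t, jump z s t x = J) :
    lpNorm (jump z s t) 2 ((Measure.euclideanHausdorffMeasure (d - 1)).restrict (side s t)) ^ 2 ≤
      J ^ 2 * (size s ^ (d - 1) * ballVol (d - 1)) := by
  obtain ⟨n, rfl⟩ : ∃ n, d = n + 1 := ⟨d - 1, by omega⟩
  rw [Nat.add_sub_cancel]
  obtain ⟨u, hu⟩ : F.Nonempty := by rw [← Finset.card_pos, h.card]; omega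
  obtain ⟨hu1, hu2⟩ := h.mem_left_iff.1 hu
  have hus : u ∈ side s t := by rw [side, h.inter_eq]; exact subset_convexHull ℝ _ hu
  have hsub : side s t ⊆ simplex s := convexHull_mono inter_subset_left
  have hm := euclideanHausdorffMeasure_hyperplane_le
    (hB.grad_ne_zero h.mem_left hu1 hu2.symm) (size_nonneg s)
    (h.coord_eq_zero_of_mem_side hB hus) (fun x hx => h.coord_eq_zero_of_mem_side hB hx)
    (subset_closedBall_of_mem hsub (hsub hus))
  have hfin : IsFiniteMeasure ((Measure.euclideanHausdorffMeasure n).restrict (side s t)) :=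
    ⟨by rw [Measure.restrict_apply_univ]; exact hm.trans_lt ENNReal.ofReal_lt_top⟩
  have hms : MeasurableSet (side s t) := by
    have : ((s : Set (Pt (n + 1))) ∩ t).Finite := s.finite_toSet.inter_of_left _
    exact (this.isCompact_convexHull (𝕜 := ℝ)).measurableSet
  refine (lpNorm_two_le_of_bound (M := |J|) ?_).trans ?_
  · exact (ae_restrict_iff' hms).2 (.of_forall fun x hx => by rw [hJ x hx, Real.norm_eq_abs])
  · rw [sq_abs, measureReal_restrict_apply_univ]
    gcongr
    exact ENNReal.toReal_le_of_le_ofReal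
      (mul_nonneg (pow_nonneg (size_nonneg s) _) (ballVol_nonneg _)) hm

/-- Efficiency of the jump residual. -/
theorem exists_jump_residual_le (hd : 2 ≤ d) (hΩ : IsOpen Ω) (hL : HasLipschitzBoundary Ω)
    (hb : Bornology.IsBounded Ω) (σ : ℝ) : ∃ C : ℝ, 0 ≤ C ∧
    ∀ T : Mesh Ω, T.ShapeRegular σ → ∀ z zT g gT : Pt d → ℝ, IsPoissonPair T z zT g gT →
    ∀ s ∈ T.elements, ∀ t ∈ T.neighbors s,
      size s * lpNorm (jump zT s t) 2
        ((Measure.euclideanHausdorffMeasure (d - 1)).restrict (side s t)) ^ 2 ≤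
      C * (localErrorSq Ω z zT g gT 0 s + localErrorSq Ω z zT g gT 0 t) := by
  have hd0 : 0 < d := by omega
  have hd' : (0 : ℝ) < d := by exact_mod_cast hd0
  obtain ⟨Λ, I₀, I₁, hΛ, -, hI₁, hbump⟩ := exists_bump hd0
  set V := ballVol d with hVdef
  have hV : 0 ≤ V := ballVol_nonneg d
  have hV' := ballVol_nonneg (d - 1)
  set K : ℝ := 3 * V * (1 + Λ ^ 2) / I₁ ^ 2 with hK
  -- `size s ≤ 2dσ²r`: one `σ` from shape regularity of `s`, one from comparing `ρ` with `min ρ ρ'`,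
  -- and `2d` from the choice of `r`.
  refine ⟨ballVol (d - 1) * (2 * d * σ ^ 2) ^ d * K, by positivity,
    fun T hT z zT g gT h s hs t htn => ?_⟩
  obtain ⟨ht, F, v, w, hp⟩ := T.exists_isFacetPair hs htn
  obtain ⟨c, G, hB⟩ := T.exists_isBary hs
  obtain ⟨c', G', hB'⟩ := T.exists_isBary ht
  obtain ⟨p, ρ, hρ, hball, hσ⟩ := hT s hs
  obtain ⟨p', ρ', hρ', hball', hσ'⟩ := hT t ht
  have hρs : ρ ≤ size s := T.le_size_of_ball (by omega) hs hρ hball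
  have hρt : ρ' ≤ size t := T.le_size_of_ball (by omega) ht hρ' hball'
  have hσ1 : 1 ≤ σ := by
    by_contra! hlt
    nlinarith
  -- As `d ≥ 2`, the facet contains an edge common to both elements; it is at least `ρ` long and at
  -- most `size t`.
  have hρst : ρ ≤ size t := by
    obtain ⟨u, hu, u', hu', hne⟩ := Finset.one_lt_card.1 (show 1 < F.card by rw [hp.card]; omega)
    exact (hB.le_dist hρ hball (hp.mem_left_iff.1 hu).1 (hp.mem_left_iff.1 hu').1 hne).trans
      (Metric.dist_le_diam_of_mem (isCompact_simplex t).isBounded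
        (subset_convexHull ℝ _ (hp.symm.mem_left_iff.1 hu).1)
        (subset_convexHull ℝ _ (hp.symm.mem_left_iff.1 hu').1))
  set δ := min ρ ρ' with hδ
  have hδ0 : 0 < δ := lt_min hρ hρ'
  have hρδ : ρ ≤ σ * δ := by
    rw [hδ, mul_min_of_nonneg _ _ (by linarith)]
    exact le_min (by nlinarith) (hρst.trans hσ')
  -- Half the radius at which the two elements still cover the ball, so that the closed ball lies in
  -- the interior of the closure of `Ω`, which is `Ω`.
  set r := δ / (2 * d) with hr
  have hr0 : 0 < r := by positivity
  have hdr : 2 * d * r = δ := by rw [hr]; field_simp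
  have hdr1 : d * r ≤ δ := by nlinarith
  have hrδ : r ≤ δ := by
    have : (1 : ℝ) ≤ d := by exact_mod_cast hd0
    nlinarith
  have hsub2 := hp.closedBall_subset (r := 2 * r) hd hB hB' (T.conforming s hs t ht) hρ hball hρ'
    hball' (by have := min_le_left ρ ρ'; linarith) (by have := min_le_right ρ ρ'; linarith)
  have hBs : Metric.closedBall (facetCenter F) r ⊆ simplex s ∪ simplex t :=
    (Metric.closedBall_subset_closedBall (by linarith)).trans hsub2
  have hBΩ : Metric.closedBall (facetCenter F) r ⊆ Ω := by
    rw [← interior_closure_eq hΩ hL]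
    refine (Metric.closedBall_subset_ball (by linarith : r < 2 * r)).trans ?_
    exact interior_maximal (Metric.ball_subset_closedBall.trans (hsub2.trans
      (union_subset (T.simplex_subset hs) (T.simplex_subset ht)))) Metric.isOpen_ball
  obtain ⟨η, hη⟩ := hbump (facetCenter F) r hr0
  obtain ⟨J, hJ, hflux⟩ := hp.exists_jump_eq hd hΩ hL hb h.memV hs ht hρ hball hρ' hball'
    (hdr1.trans (min_le_left _ _)) (hdr1.trans (min_le_right _ _)) hBΩ hη
  have hres := h.abs_residual_le hΩ hb hr0 hΛ hBΩ hη
  rw [hflux] at hres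
  set B := Metric.closedBall (facetCenter F) r
  have hleB : volume.restrict B ≤ volume.restrict Ω := Measure.restrict_mono hBΩ le_rfl
  have hηB := lpNorm_ball_le (c := facetCenter F) (f := η) hr0.le zero_le_one fun x => by
    rw [Real.norm_of_nonneg (hη.nonneg x)]; exact hη.le_one x
  have hsrc : |∫ x in Ω, gT x * η x| ≤ lpNorm gT 2 (volume.restrict B) * √(V * r ^ d) := by
    rw [setIntegral_eq_of_tsupport hBΩ hΩ.measurableSet hη.tsupport_subset fun x hx _ => by
      rw [hx, mul_zero]]
    refine (abs_integral_mul_le (h.memL2_approx.mono_measure hleB)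
      (hη.contDiff.continuous.memLp_of_hasCompactSupport hη.hasCompactSupport)).trans ?_
    rw [one_mul] at hηB
    exact mul_le_mul_of_nonneg_left hηB lpNorm_nonneg
  set γ := lpNorm gT 2 (volume.restrict B)
  set k := lpNorm (g - gT) 2 (volume.restrict B)
  set e := lpNorm (weakGrad Ω (z - zT)) 2 (volume.restrict B)
  -- The source term is moved to the right, so the whole norm of `gT` appears there; the element
  -- estimate controls it later.
  have hmain : |J| / r * (r ^ d * I₁) ≤ (γ + k + Λ / r * e) * √(V * r ^ d) := by
    calc |J| / r * (r ^ d * I₁) = |J * (r ^ d / r * I₁)| := by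
          rw [abs_mul, abs_of_nonneg (show 0 ≤ r ^ d / r * I₁ by positivity)]; ring
      _ ≤ |∫ x in Ω, gT x * η x| + |(∫ x in Ω, gT x * η x) - J * (r ^ d / r * I₁)| := by
          have := abs_sub (∫ x in Ω, gT x * η x) ((∫ x in Ω, gT x * η x) - J * (r ^ d / r * I₁))
          rwa [sub_sub_cancel] at this
      _ ≤ γ * √(V * r ^ d) + (k + Λ / r * e) * √(V * r ^ d) := add_le_add hsrc hres
      _ = _ := by ring
  have hsq := sq_mul_le_of_residual (by positivity) hr0 hI₁.le hV hmain
  set W := localErrorSq Ω z zT g gT 0 s + localErrorSq Ω z zT g gT 0 t with hW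
  have hsum : r ^ 2 * γ ^ 2 + r ^ 2 * k ^ 2 + Λ ^ 2 * e ^ 2 ≤ (1 + Λ ^ 2) * W := by
    have hls := T.restrict_le hΩ hL hs
    have hlt := T.restrict_le hΩ hL ht
    have hE := (h.memLp_weakGrad hΩ hb).1
    have hD := h.memL2.sub h.memL2_approx
    have t1 := lpNorm_sq_le_of_subset_union (h.memL2_approx.mono_measure hls)
      (h.memL2_approx.mono_measure hlt) hBs
    have t2 := lpNorm_sq_le_of_subset_union (hD.mono_measure hls) (hD.mono_measure hlt) hBs
    have t3 := lpNorm_sq_le_of_subset_union (hE.mono_measure hls) (hE.mono_measure hlt) hBs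
    have hrs : r ^ 2 ≤ size s ^ 2 := pow_le_pow_left₀ hr0.le
      ((hrδ.trans (min_le_left _ _)).trans hρs) 2
    have hrt : r ^ 2 ≤ size t ^ 2 := pow_le_pow_left₀ hr0.le
      ((hrδ.trans (min_le_right _ _)).trans hρt) 2
    have comb : ∀ {x a b : ℝ}, x ^ 2 ≤ a ^ 2 + b ^ 2 →
        r ^ 2 * x ^ 2 ≤ size s ^ 2 * a ^ 2 + size t ^ 2 * b ^ 2 := fun {x a b} hx =>
      calc r ^ 2 * x ^ 2 ≤ r ^ 2 * (a ^ 2 + b ^ 2) := by gcongr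
        _ = r ^ 2 * a ^ 2 + r ^ 2 * b ^ 2 := by ring
        _ ≤ _ := by gcongr
    have u1 := comb t1
    have u2 := comb t2
    have v1 : r ^ 2 * γ ^ 2 + r ^ 2 * k ^ 2 + e ^ 2 ≤ W := by
      simp only [hW, localErrorSq, sub_zero, normL2]
      linarith
    calc _ ≤ (1 + Λ ^ 2) * (r ^ 2 * γ ^ 2 + r ^ 2 * k ^ 2 + e ^ 2) := by
          have : 0 ≤ Λ ^ 2 * (r ^ 2 * γ ^ 2 + r ^ 2 * k ^ 2) := by positivity
          have := sq_nonneg e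
          linarith
      _ ≤ _ := by gcongr
  have hJW : J ^ 2 * r ^ d ≤ K * W := by
    rw [hK, div_mul_eq_mul_div, le_div_iff₀ (by positivity)]
    calc J ^ 2 * r ^ d * I₁ ^ 2 = (|J| / r) ^ 2 * r ^ (d + 2) * I₁ ^ 2 := by
          rw [div_pow |J| r, sq_abs]; field_simp; ring
      _ ≤ 3 * V * ((1 + Λ ^ 2) * W) := hsq.trans (mul_le_mul_of_nonneg_left hsum (by positivity))
      _ = _ := by ring
  have hsize : size s ≤ 2 * d * σ ^ 2 * r := by
    calc size s ≤ σ * ρ := hσ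
      _ ≤ σ * (σ * δ) := by gcongr
      _ = _ := by rw [← hdr]; ring
  have hs0 := size_nonneg s
  calc size s * lpNorm (jump zT s t) 2
        ((Measure.euclideanHausdorffMeasure (d - 1)).restrict (side s t)) ^ 2
      ≤ size s * (J ^ 2 * (size s ^ (d - 1) * ballVol (d - 1))) :=
        mul_le_mul_of_nonneg_left (hp.lpNorm_jump_le hd hB hJ) hs0
    _ = ballVol (d - 1) * J ^ 2 * size s ^ d := by
        obtain ⟨n, rfl⟩ : ∃ n, d = n + 1 := ⟨d - 1, by omega⟩
        rw [Nat.add_sub_cancel, pow_succ]; ring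
    _ ≤ ballVol (d - 1) * J ^ 2 * (2 * d * σ ^ 2 * r) ^ d := by gcongr
    _ = ballVol (d - 1) * (2 * d * σ ^ 2) ^ d * (J ^ 2 * r ^ d) := by
        rw [mul_pow (2 * d * σ ^ 2) r]; ring
    _ ≤ ballVol (d - 1) * (2 * d * σ ^ 2) ^ d * (K * W) := by gcongr
    _ = _ := by ring

/-- The neighbor relation is symmetric, so the terms `R t` regroup into terms `R s`, each counted at
most `d + 1` times. -/
theorem Mesh.sum_neighbors_le (T : Mesh Ω) (hd : 2 ≤ d) {σ : ℝ} (hT : T.ShapeRegular σ)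
    {R : Finset (Pt d) → ℝ} (hR : ∀ s, 0 ≤ R s) :
    ∑ s ∈ T.elements, ∑ t ∈ T.neighbors s, (R s + R t) ≤
      2 * (d + 1) * ∑ s ∈ T.elements, R s := by
  have h1 : ∑ s ∈ T.elements, ∑ t ∈ T.neighbors s, R t =
      ∑ s ∈ T.elements, ∑ t ∈ T.neighbors s, R s := by
    refine Finset.sum_comm' fun s t => ⟨fun h => ?_, fun h => ?_⟩
    · exact ⟨T.mem_neighbors_comm h.1 h.2, (T.exists_isFacetPair h.1 h.2).1⟩
    · exact ⟨(T.exists_isFacetPair h.2 h.1).1, T.mem_neighbors_comm h.2 h.1⟩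
  have h2 : ∑ s ∈ T.elements, ∑ t ∈ T.neighbors s, R s ≤ (d + 1) * ∑ s ∈ T.elements, R s := by
    rw [Finset.mul_sum]
    refine Finset.sum_le_sum fun s hs => ?_
    rw [Finset.sum_const, nsmul_eq_mul]
    exact mul_le_mul_of_nonneg_right (by exact_mod_cast T.card_neighbors_le hd hT hs) (hR s)
  simp_rw [Finset.sum_add_distrib]
  rw [h1]
  linarith

/-- Global efficiency of the residual indicators of a Poisson problem. -/
theorem exists_sum_residualSq_le (hd : 2 ≤ d) (hΩ : IsOpen Ω) (hL : HasLipschitzBoundary Ω)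
    (hb : Bornology.IsBounded Ω) (σ : ℝ) : ∃ C : ℝ, 0 ≤ C ∧
    ∀ T : Mesh Ω, T.ShapeRegular σ → ∀ z zT g gT : Pt d → ℝ, IsPoissonPair T z zT g gT →
    ∀ P : Finset (Pt d) → Pt d → ℝ, (∀ s ∈ T.elements, IsPoly 1 (P s)) →
      ∑ s ∈ T.elements, T.residualSq gT zT s ≤ C * (seminormH1 Ω (z - zT) ^ 2 +
        normL2 Ω (g - gT) ^ 2 +
        ∑ s ∈ T.elements, size s ^ 2 * normL2 (simplex s) (gT - P s) ^ 2) := by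
  obtain ⟨C₁, hC₁, h₁⟩ := exists_element_residual_le hd hΩ hL hb σ
  obtain ⟨C₂, hC₂, h₂⟩ := exists_jump_residual_le hd hΩ hL hb σ
  set D := Metric.diam (closure Ω) with hD
  have hD0 : 0 ≤ D := Metric.diam_nonneg
  refine ⟨(C₁ + C₂ * (2 * (d + 1)) * (1 + C₁)) * (1 + D ^ 2), by positivity,
    fun T hT z zT g gT h P hP => ?_⟩
  set Q : Finset (Pt d) → ℝ := fun s => localErrorSq Ω z zT g gT (P s) s with hQ
  set R : Finset (Pt d) → ℝ := fun s => localErrorSq Ω z zT g gT 0 s with hR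
  have hR0 : ∀ s, 0 ≤ R s := fun s => localErrorSq_nonneg ..
  -- With `P = 0` the last term of the local error is the element residual, which has already been
  -- bounded.
  have hRQ : ∑ s ∈ T.elements, R s ≤ (1 + C₁) * ∑ s ∈ T.elements, Q s := by
    rw [Finset.mul_sum]
    refine Finset.sum_le_sum fun s hs => ?_
    have e1 := h₁ T hT z zT g gT h s hs (P s) (hP s hs)
    have e2 : 0 ≤ size s ^ 2 * normL2 (simplex s) (gT - P s) ^ 2 := by positivity
    simp only [hR, hQ, localErrorSq, sub_zero] at e1 ⊢
    linarith
  have hres : ∀ s ∈ T.elements, T.residualSq gT zT s ≤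
      C₁ * Q s + C₂ * ∑ t ∈ T.neighbors s, (R s + R t) := fun s hs => by
    refine add_le_add (h₁ T hT z zT g gT h s hs (P s) (hP s hs)) ?_
    rw [Mesh.jumpSq, Finset.mul_sum, Finset.mul_sum]
    exact Finset.sum_le_sum fun t ht => h₂ T hT z zT g gT h s hs t ht
  have hQsum : ∑ s ∈ T.elements, Q s ≤ (1 + D ^ 2) * (seminormH1 Ω (z - zT) ^ 2 +
      normL2 Ω (g - gT) ^ 2 +
      ∑ s ∈ T.elements, size s ^ 2 * normL2 (simplex s) (gT - P s) ^ 2) := by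
    have e1 := T.sum_lpNorm_sq hΩ hL (h.memLp_weakGrad hΩ hb).1
    have e2 := T.sum_lpNorm_sq hΩ hL (h.memL2.sub h.memL2_approx)
    -- Here the source error gives up its mesh weight, `size s ≤ diam Ω`; this is one way in which
    -- the constant depends on `Ω`.
    have e3 : ∑ s ∈ T.elements, size s ^ 2 * normL2 (simplex s) (g - gT) ^ 2 ≤
        D ^ 2 * normL2 Ω (g - gT) ^ 2 := by
      rw [normL2, ← e2, Finset.mul_sum]
      refine Finset.sum_le_sum fun s hs => ?_
      have := T.size_le hb hs
      have := size_nonneg s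
      rw [normL2]; gcongr
    simp only [hQ, localErrorSq, Finset.sum_add_distrib]
    rw [e1]
    have p1 : 0 ≤ D ^ 2 * seminormH1 Ω (z - zT) ^ 2 := by positivity
    have p2 : 0 ≤ D ^ 2 * ∑ s ∈ T.elements, size s ^ 2 * normL2 (simplex s) (gT - P s) ^ 2 :=
      mul_nonneg (sq_nonneg _) (Finset.sum_nonneg fun s _ => by positivity)
    have p3 : 0 ≤ normL2 Ω (g - gT) ^ 2 := by positivity
    rw [seminormH1] at *
    linarith
  calc ∑ s ∈ T.elements, T.residualSq gT zT s
      ≤ ∑ s ∈ T.elements, (C₁ * Q s + C₂ * ∑ t ∈ T.neighbors s, (R s + R t)) :=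
        Finset.sum_le_sum hres
    _ = C₁ * ∑ s ∈ T.elements, Q s +
        C₂ * ∑ s ∈ T.elements, ∑ t ∈ T.neighbors s, (R s + R t) := by
        rw [Finset.sum_add_distrib, Finset.mul_sum, Finset.mul_sum]
    _ ≤ C₁ * ∑ s ∈ T.elements, Q s +
        C₂ * (2 * (d + 1) * ((1 + C₁) * ∑ s ∈ T.elements, Q s)) := by
        gcongr
        exact (T.sum_neighbors_le hd hT hR0).trans (by gcongr)
    _ = (C₁ + C₂ * (2 * (d + 1)) * (1 + C₁)) * ∑ s ∈ T.elements, Q s := by ring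
    _ ≤ (C₁ + C₂ * (2 * (d + 1)) * (1 + C₁)) * ((1 + D ^ 2) * _) := by gcongr
    _ = _ := by ring

/-! ### Pointwise form of the optimality system -/

theorem proj_le {a b : ℝ} (t : ℝ) : proj a b t ≤ b := min_le_left _ _

theorem le_proj {a b : ℝ} (hab : a ≤ b) (t : ℝ) : a ≤ proj a b t :=
  le_min hab (le_max_left _ _)

theorem abs_proj_sub_le (a b s t : ℝ) : |proj a b s - proj a b t| ≤ |s - t| := by
  unfold proj
  refine (abs_min_sub_min_le_max _ _ _ _).trans ?_
  rw [sub_self, abs_zero]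
  refine max_le (abs_nonneg _) ((abs_max_sub_max_le_max _ _ _ _).trans ?_)
  rw [sub_self, abs_zero]
  exact max_le (abs_nonneg _) le_rfl

theorem continuous_proj (a b : ℝ) : Continuous (proj a b) := by unfold proj; fun_prop

theorem abs_proj_le {a b : ℝ} (hab : a ≤ b) (t : ℝ) : |proj a b t| ≤ |a| + |b| := by
  have h1 := le_proj hab t
  have h2 := proj_le (a := a) (b := b) t
  rw [abs_le]
  constructor <;> linarith [neg_abs_le a, le_abs_self b, abs_nonneg a, abs_nonneg b]

/-- The variational inequality of the projection onto an interval. -/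
theorem mul_proj_sub_le {a b u q : ℝ} (hu : a ≤ u ∧ u ≤ b) :
    q * (proj a b (u - q) - u) ≤ -(u - proj a b (u - q)) ^ 2 := by
  unfold proj
  rcases le_total a (u - q) with h1 | h1
  · rw [max_eq_right h1]
    rcases le_total b (u - q) with h2 | h2
    · rw [min_eq_left h2]; nlinarith
    · rw [min_eq_right h2]; nlinarith
  · rw [max_eq_left h1, min_eq_right (hu.1.trans hu.2)]; nlinarith

/-- Either the residual `q` vanishes, or `u` sits at a bound and `q` has the matching sign. Since `a
< 0 < b`, at a bound `u ≠ 0`, so `l = ±1`, and the sign of `q` pushes `-p / β` further beyond that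
value. -/
theorem eq_proj_of_optimal {α β a b p u l : ℝ} (hα : 0 < α) (hβ : 0 < β) (ha : a < 0) (hb : 0 < b)
    (hl : |l| ≤ 1) (hlu : l * u = |u|) (hu : u = proj a b (u - (p + α * u + β * l))) :
    u = proj a b (-(1 / α) * (p + β * l)) ∧ l = proj (-1) 1 (-(1 / β) * p) := by
  obtain ⟨hl1, hl2⟩ := abs_le.1 hl
  set q := p + α * u + β * l with hq
  have hcase : (u = a ∧ 0 ≤ q) ∨ (u = b ∧ q ≤ 0) ∨ (a ≤ u ∧ u ≤ b ∧ q = 0) := by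
    unfold proj at hu
    rcases le_total a (u - q) with h1 | h1
    · rw [max_eq_right h1] at hu
      rcases le_total b (u - q) with h2 | h2
      · rw [min_eq_left h2] at hu; exact Or.inr (Or.inl ⟨hu, by linarith⟩)
      · rw [min_eq_right h2] at hu
        exact Or.inr (Or.inr ⟨by linarith, by linarith, by linarith⟩)
    · rw [max_eq_left h1, min_eq_right (ha.trans hb).le] at hu
      exact Or.inl ⟨hu, by linarith⟩
  -- The arguments of both projections are the desired values plus corrections whose signs are known
  -- in each case.
  have e1 : -(1 / α) * (p + β * l) = u - q / α := by rw [hq]; field_simp; ring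
  have e2 : -(1 / β) * p = l + (α * u - q) / β := by rw [hq]; field_simp; ring
  have hqα : 0 ≤ q → 0 ≤ q / α := fun h => div_nonneg h hα.le
  have hqα' : q ≤ 0 → q / α ≤ 0 := fun h => div_nonpos_of_nonpos_of_nonneg h hα.le
  rw [e1, e2]
  unfold proj
  rcases hcase with ⟨h1, h2⟩ | ⟨h1, h2⟩ | ⟨h1, h2, h3⟩
  · have hun : u < 0 := h1 ▸ ha
    have hl' : l = -1 := by
      rw [abs_of_neg hun] at hlu
      exact mul_right_cancel₀ hun.ne (by linarith)
    have h3 : (α * u - q) / β ≤ 0 := div_nonpos_of_nonpos_of_nonneg (by nlinarith) hβ.le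
    refine ⟨?_, ?_⟩
    · rw [max_eq_left (by linarith [hqα h2]), min_eq_right (by linarith)]; exact h1
    · rw [max_eq_left (by linarith), min_eq_right (by norm_num)]; exact hl'
  · have hun : 0 < u := h1 ▸ hb
    have hl' : l = 1 := by
      rw [abs_of_pos hun] at hlu
      exact mul_right_cancel₀ hun.ne' (by linarith)
    have h3 : 0 ≤ (α * u - q) / β := div_nonneg (by nlinarith) hβ.le
    refine ⟨?_, ?_⟩
    · rw [max_eq_right (by linarith [hqα' h2]), min_eq_left (by linarith [hqα' h2])]; exact h1
    · rw [max_eq_right (by linarith), min_eq_left (by linarith)]; exact hl'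
  · rw [h3, zero_div, sub_zero, sub_zero, max_eq_right h1, min_eq_right h2]
    refine ⟨rfl, ?_⟩
    rcases lt_trichotomy u 0 with hun | hun | hun
    · have hl' : l = -1 := by
        rw [abs_of_neg hun] at hlu
        exact mul_right_cancel₀ hun.ne (by linarith)
      have h4 : α * u / β ≤ 0 := div_nonpos_of_nonpos_of_nonneg (by nlinarith) hβ.le
      rw [max_eq_left (by linarith), min_eq_right (by norm_num)]; exact hl'
    · rw [hun, mul_zero, zero_div, add_zero, max_eq_right hl1, min_eq_right hl2]
    · have hl' : l = 1 := by
        rw [abs_of_pos hun] at hlu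
        exact mul_right_cancel₀ hun.ne' (by linarith)
      have h4 : 0 ≤ α * u / β := by positivity
      rw [max_eq_right (by linarith), min_eq_left (by linarith)]; exact hl'

/-- Testing with `u + v`, where `v` is the excess of `lam` over `[-1, 1]`, gives `∫ (lam v - |v|) ≤
0`; the integrand is nonnegative and vanishes only where `|lam| ≤ 1`. Testing with `0` then gives `∫
(|u| - lam u) ≤ 0`, again with a nonnegative integrand. -/
theorem IsSubgradient.pointwise [IsFiniteMeasure (volume.restrict Ω)] {lam u : Pt d → ℝ}
    (h : IsSubgradient Ω lam u) (hu : MemL2 Ω u) :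
    ∀ᵐ x ∂volume.restrict Ω, |lam x| ≤ 1 ∧ lam x * u x = |u x| := by
  have hlam2 : MemLp lam 2 (volume.restrict Ω) := h.1.mono_exponent le_top
  set v : Pt d → ℝ := fun x => lam x - proj (-1) 1 (lam x) with hv
  have hv2 : MemLp v 2 (volume.restrict Ω) :=
    hlam2.sub (MemLp.of_bound ((continuous_proj _ _).comp_aestronglyMeasurable hlam2.1) (|-1| + |1|)
      (.of_forall fun x => abs_proj_le (by norm_num) _))
  have hu1 : Integrable u (volume.restrict Ω) := hu.integrable (by norm_num)
  have hv1 : Integrable v (volume.restrict Ω) := hv2.integrable (by norm_num)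
  have hlv : Integrable (fun x => lam x * v x) (volume.restrict Ω) := hlam2.integrable_mul hv2
  have hlu : Integrable (fun x => lam x * u x) (volume.restrict Ω) := hlam2.integrable_mul hu
  have key1 : ∫ x in Ω, (lam x * v x - |v x|) ≤ 0 := by
    have := h.2 (u + v) (memLp_one_iff_integrable.2 (hu1.add hv1))
    simp only [innerL2, add_sub_cancel_left, Pi.add_apply] at this
    have h3 : ∫ x in Ω, |u x + v x| ≤ ∫ x in Ω, (|u x| + |v x|) :=
      integral_mono (hu1.add hv1).abs (hu1.abs.add hv1.abs) fun x => abs_add_le _ _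
    rw [integral_add hu1.abs hv1.abs] at h3
    rw [integral_sub hlv hv1.abs]
    linarith
  have hpt : ∀ x, 0 ≤ lam x * v x - |v x| ∧ (lam x * v x - |v x| = 0 → |lam x| ≤ 1) := fun x => by
    simp only [hv, proj]
    rcases le_total (-1) (lam x) with h1 | h1
    · rw [max_eq_right h1]
      rcases le_total 1 (lam x) with h2 | h2
      · rw [min_eq_left h2, abs_of_nonneg (by linarith : 0 ≤ lam x - 1)]
        refine ⟨by nlinarith, fun h3 => ?_⟩
        have : lam x = 1 := by nlinarith
        rw [this]; simp
      · rw [min_eq_right h2]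
        exact ⟨by simp, fun _ => abs_le.2 ⟨h1, h2⟩⟩
    · rw [max_eq_left h1, min_eq_right (by norm_num), abs_of_nonpos (by linarith)]
      refine ⟨by nlinarith, fun h3 => ?_⟩
      have : lam x = -1 := by nlinarith
      rw [this]; simp
  have hz1 := (integral_eq_zero_iff_of_nonneg (fun x => (hpt x).1) (hlv.sub hv1.abs)).1
    (le_antisymm key1 (integral_nonneg fun x => (hpt x).1))
  have hle : ∀ᵐ x ∂volume.restrict Ω, |lam x| ≤ 1 := hz1.mono fun x hx => (hpt x).2 hx
  have key2 : ∫ x in Ω, (|u x| - lam x * u x) ≤ 0 := by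
    have := h.2 0 MemLp.zero
    simp only [innerL2, zero_sub, Pi.neg_apply, mul_neg, Pi.zero_apply, abs_zero,
      integral_zero] at this
    rw [integral_neg] at this
    rw [integral_sub hu1.abs hlu]
    linarith
  have hnn : ∀ᵐ x ∂volume.restrict Ω, 0 ≤ |u x| - lam x * u x := hle.mono fun x hx => by
    have : |lam x * u x| ≤ |u x| := by
      rw [abs_mul]; exact mul_le_of_le_one_left (abs_nonneg _) hx
    linarith [le_abs_self (lam x * u x)]
  have hz2 := (integral_eq_zero_iff_of_nonneg_ae hnn (hu1.abs.sub hlu)).1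
    (le_antisymm key2 (integral_nonneg_of_ae hnn))
  filter_upwards [hle, hz2] with x h1 h2
  exact ⟨h1, (sub_eq_zero.1 h2).symm⟩

/-- The competitor `w`, the projection of `u - q` onto `[a, b]`, is admissible, and the variational
inequality with it reads `0 ≤ -‖u - w‖²`. Hence `u = w` almost everywhere and the scalar lemma
applies. -/
theorem IsOptimal.pointwise [IsFiniteMeasure (volume.restrict Ω)] {α β a b : ℝ}
    {f yΩ y p u lam : Pt d → ℝ} (hα : 0 < α) (hβ : 0 < β) (ha : a < 0) (hb : 0 < b)
    (h : IsOptimal Ω α β a b f yΩ y p u lam) :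
    ∀ᵐ x ∂volume.restrict Ω, u x = proj a b (-(1 / α) * (p x + β * lam x)) ∧
      lam x = proj (-1) 1 (-(1 / β) * p x) := by
  have hu := h.memU.1
  have hlam2 : MemLp lam 2 (volume.restrict Ω) := h.subgradient.1.mono_exponent le_top
  set q : Pt d → ℝ := p + α • u + β • lam with hq
  have hq2 : MemLp q 2 (volume.restrict Ω) :=
    (h.memP.1.1.add (hu.const_smul α)).add (hlam2.const_smul β)
  set w : Pt d → ℝ := fun x => proj a b (u x - q x) with hw
  have hab := (ha.trans hb).le
  have hw2 : MemLp w 2 (volume.restrict Ω) :=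
    MemLp.of_bound ((continuous_proj a b).comp_aestronglyMeasurable (hu.sub hq2).1) (|a| + |b|)
      (.of_forall fun x => abs_proj_le hab _)
  have hvar := h.variational w ⟨hw2, .of_forall fun x => ⟨le_proj hab _, proj_le _⟩⟩
  have hsq : Integrable (fun x => (u x - w x) ^ 2) (volume.restrict Ω) := (hu.sub hw2).integrable_sq
  have hle : innerL2 Ω q (w - u) ≤ ∫ x in Ω, -(u x - w x) ^ 2 :=
    integral_mono_ae (hq2.integrable_mul (hw2.sub hu)) hsq.neg
      (h.memU.2.mono fun x hx => mul_proj_sub_le hx)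
  rw [integral_neg] at hle
  have hz := (integral_eq_zero_iff_of_nonneg (fun x => sq_nonneg (u x - w x)) hsq).1
    (le_antisymm (by linarith) (integral_nonneg fun x => sq_nonneg _))
  filter_upwards [hz, h.subgradient.pointwise hu] with x h1 h2
  have h3 : u x = w x := sub_eq_zero.1 (pow_eq_zero_iff two_ne_zero |>.1 h1)
  exact eq_proj_of_optimal hα hβ ha hb h2.1 h2.2 h3

/-! ### Affine approximations and data oscillation. -/

theorem isPoly_polyProj (ℓ : Fin 2) (K : Set (Pt d)) (g : Pt d → ℝ) : IsPoly 1 (polyProj ℓ K g) := by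
  unfold polyProj
  split_ifs with h
  · obtain ⟨c, q, -, hq⟩ := h.choose_spec.1
    exact ⟨c, q, by simp, hq⟩
  · exact ⟨0, 0, by simp, by simp⟩

theorem IsPoly.one_of {ℓ : Fin 2} {q : Pt d → ℝ} (h : IsPoly ℓ q) : IsPoly 1 q := by
  obtain ⟨c, g, -, hq⟩ := h
  exact ⟨c, g, by simp, hq⟩

theorem IsPoly.add {q q' : Pt d → ℝ} (h : IsPoly 1 q) (h' : IsPoly 1 q') : IsPoly 1 (q + q') := by
  obtain ⟨c, g, -, hq⟩ := h
  obtain ⟨c', g', -, hq'⟩ := h'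
  exact ⟨c + c', g + g', by simp, fun x => by
    rw [Pi.add_apply, hq, hq', inner_add_left]; ring⟩

theorem IsPoly.sub {q q' : Pt d → ℝ} (h : IsPoly 1 q) (h' : IsPoly 1 q') : IsPoly 1 (q - q') := by
  obtain ⟨c, g, -, hq⟩ := h
  obtain ⟨c', g', -, hq'⟩ := h'
  exact ⟨c - c', g - g', by simp, fun x => by
    rw [Pi.sub_apply, hq, hq', inner_sub_left]; ring⟩

theorem osc_sq (ℓ : Fin 2) (g : Pt d → ℝ) (M : Finset (Finset (Pt d))) :
    osc 0 ℓ g M ^ 2 =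
      ∑ s ∈ M, size s ^ 2 * normL2 (simplex s) (g - polyProj ℓ (simplex s) g) ^ 2 := by
  rw [osc, Real.sq_sqrt (Finset.sum_nonneg fun s _ =>
    mul_nonneg (pow_nonneg (size_nonneg s) _) (sq_nonneg _))]

theorem dirichletForm_test (hΩ : IsOpen Ω) (hb : Bornology.IsBounded Ω) {z φ : Pt d → ℝ}
    (hφ : IsTestFunction Ω φ) :
    dirichletForm Ω z φ = ∫ x in Ω, ⟪weakGrad Ω z x, gradient φ x⟫ :=
  integral_congr_ae (((hφ.hasWeakGradient hb).weakGrad_ae_eq hΩ).mono fun x hx => by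
    simp only [hx])

theorem dirichletForm_comm (z w : Pt d → ℝ) : dirichletForm Ω z w = dirichletForm Ω w z := by
  simp only [dirichletForm, real_inner_comm]

/-! ### The two Poisson problems and the auxiliary variables of the optimality system. -/

section Optimality
variable {T : Mesh Ω} {α β a b : ℝ} {f yΩ y p u lam yT pT uT lamT : Pt d → ℝ}

theorem IsOptimal.state_pair (hΩ : IsOpen Ω) (hb : Bornology.IsBounded Ω) (hf : MemL2 Ω f)
    (h : IsOptimal Ω α β a b f yΩ y p u lam)
    (hT : T.IsDiscreteOptimal α β a b f yΩ yT pT uT lamT) :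
    IsPoissonPair T y yT (u + f) (uT + f) where
  memH1 := h.memY.1
  weak φ hφ := by
    rw [← dirichletForm_test hΩ hb hφ, h.state φ (hφ.memH10 hΩ hb)]; rfl
  memV := hT.memY
  memL2 := h.memU.1.add hf
  memL2_approx := hT.memUad.1.add hf

theorem IsOptimal.adjoint_pair (hΩ : IsOpen Ω) (hb : Bornology.IsBounded Ω) (hy : MemL2 Ω yΩ)
    (h : IsOptimal Ω α β a b f yΩ y p u lam)
    (hT : T.IsDiscreteOptimal α β a b f yΩ yT pT uT lamT) :
    IsPoissonPair T p pT (y - yΩ) (yT - yΩ) where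
  memH1 := h.memP.1
  weak φ hφ := by
    rw [← dirichletForm_test hΩ hb hφ, dirichletForm_comm, h.adjoint φ (hφ.memH10 hΩ hb)]; rfl
  memV := hT.memP
  memL2 := h.memY.1.1.sub hy
  memL2_approx := (hT.memY.memH1 T hΩ hb).1.sub hy

/-- As `uT` is constant on each element, it can be put into `P`, and only `f` minus its projection
remains. -/
theorem exists_state_source (hT : T.MemU0 uT) (ℓ : Fin 2) :
    ∃ P : Finset (Pt d) → Pt d → ℝ, (∀ s ∈ T.elements, IsPoly 1 (P s)) ∧
      ∑ s ∈ T.elements, size s ^ 2 * normL2 (simplex s) (uT + f - P s) ^ 2 =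
        osc 0 ℓ f T.elements ^ 2 := by
  have h : ∀ s, ∃ q, s ∈ T.elements →
      IsPoly 0 q ∧ ∀ᵐ x ∂volume.restrict (simplex s), uT x = q x := fun s => by
    by_cases hs : s ∈ T.elements
    · obtain ⟨q, hq⟩ := hT.2 s hs
      exact ⟨q, fun _ => hq⟩
    · exact ⟨0, fun h => absurd h hs⟩
  choose q hq using h
  refine ⟨fun s => q s + polyProj ℓ (simplex s) f,
    fun s hs => (hq s hs).1.one_of.add (isPoly_polyProj _ _ _), ?_⟩
  rw [osc_sq]
  refine Finset.sum_congr rfl fun s hs => ?_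
  rw [normL2, normL2, lpNorm_two_congr ((hq s hs).2.mono fun x hx => ?_)]
  simp only [Pi.sub_apply, Pi.add_apply, hx]; ring

/-- Here the affine function `yT` is put into `P`. This is why the element residual is compared with
affine functions even when `ℓ = 0`. -/
theorem exists_adjoint_source (hT : T.MemV yT) (ℓ : Fin 2) :
    ∃ P : Finset (Pt d) → Pt d → ℝ, (∀ s ∈ T.elements, IsPoly 1 (P s)) ∧
      ∑ s ∈ T.elements, size s ^ 2 * normL2 (simplex s) (yT - yΩ - P s) ^ 2 =
        osc 0 ℓ yΩ T.elements ^ 2 := by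
  have h : ∀ s, ∃ q, s ∈ T.elements → IsPoly 1 q ∧ EqOn yT q (simplex s) := fun s => by
    by_cases hs : s ∈ T.elements
    · obtain ⟨q, hq⟩ := hT.2.1 s hs
      exact ⟨q, fun _ => hq⟩
    · exact ⟨0, fun h => absurd h hs⟩
  choose q hq using h
  refine ⟨fun s => q s - polyProj ℓ (simplex s) yΩ,
    fun s hs => (hq s hs).1.sub (isPoly_polyProj _ _ _), ?_⟩
  rw [osc_sq]
  refine Finset.sum_congr rfl fun s hs => ?_
  rw [normL2, normL2, ← lpNorm_neg (yΩ - polyProj ℓ (simplex s) yΩ),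
    lpNorm_two_congr ((ae_restrict_mem (measurableSet_simplex s)).mono fun x hx => ?_)]
  simp only [Pi.sub_apply, Pi.neg_apply, (hq s hs).2 hx]; ring

theorem abs_lamTilde_sub_le (hβ : 0 < β) {x : Pt d} (hl : lam x = proj (-1) 1 (-(1 / β) * p x)) :
    |lamTilde β pT x - lam x| ≤ 1 / β * |p x - pT x| := by
  rw [lamTilde, hl]
  refine (abs_proj_sub_le _ _ _ _).trans ?_
  rw [← mul_sub, abs_mul, abs_neg, abs_of_pos (one_div_pos.2 hβ), abs_sub_comm]

/-- The factor `2` counts `p - pT` itself and the contribution of `λ̃ - lam`, where `β` cancels the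
Lipschitz constant `1 / β`. -/
theorem abs_uTilde_sub_le (hα : 0 < α) (hβ : 0 < β) {x : Pt d}
    (hu : u x = proj a b (-(1 / α) * (p x + β * lam x)))
    (hl : lam x = proj (-1) 1 (-(1 / β) * p x)) :
    |uTilde α β a b pT x - u x| ≤ 2 / α * |p x - pT x| := by
  have h1 := abs_lamTilde_sub_le (pT := pT) hβ hl
  rw [uTilde, hu]
  refine (abs_proj_sub_le _ _ _ _).trans ?_
  rw [← mul_sub, abs_mul, abs_neg, abs_of_pos (one_div_pos.2 hα)]
  have h2 : |pT x + β * lamTilde β pT x - (p x + β * lam x)| ≤ 2 * |p x - pT x| := by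
    have e : pT x + β * lamTilde β pT x - (p x + β * lam x) =
        (pT x - p x) + β * (lamTilde β pT x - lam x) := by ring
    rw [e]
    refine (abs_add_le _ _).trans ?_
    rw [abs_mul, abs_of_pos hβ, abs_sub_comm (pT x)]
    have h3 := mul_le_mul_of_nonneg_left h1 hβ.le
    rw [← mul_assoc, mul_one_div_cancel hβ.ne', one_mul] at h3
    linarith
  calc 1 / α * |pT x + β * lamTilde β pT x - (p x + β * lam x)|
      ≤ 1 / α * (2 * |p x - pT x|) := by gcongr
    _ = 2 / α * |p x - pT x| := by ring

theorem normL2_sub_le_of_abs_le {v w z e : Pt d → ℝ} {K : ℝ} (hK : 0 ≤ K) (hv : MemL2 Ω v)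
    (hw : MemL2 Ω w) (he : MemL2 Ω e)
    (h : ∀ᵐ x ∂volume.restrict Ω, |v x - w x| ≤ K * |e x|) :
    normL2 Ω (v - z) ≤ K * normL2 Ω e + normL2 Ω (w - z) := by
  refine (lpNorm_sub_le_lpNorm_sub_add_lpNorm_sub hv hw (by norm_num)).trans
    (add_le_add ?_ le_rfl)
  have h1 : lpNorm (v - w) 2 (volume.restrict Ω) ≤ lpNorm (K • e) 2 (volume.restrict Ω) :=
    lpNorm_two_mono_ae (he.const_smul K) (h.mono fun x hx => by
      simpa [abs_mul, abs_of_nonneg hK] using hx)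
  refine h1.trans ?_
  rw [lpNorm_const_smul, coe_nnnorm, Real.norm_of_nonneg hK]; rfl

theorem IsOptimal.normL2_lamTilde_sub_le [IsFiniteMeasure (volume.restrict Ω)] (hα : 0 < α)
    (hβ : 0 < β) (ha : a < 0) (hb : 0 < b) (h : IsOptimal Ω α β a b f yΩ y p u lam)
    (hpT : MemL2 Ω pT) :
    MemL2 Ω (lamTilde β pT) ∧ normL2 Ω (lamTilde β pT - lamT) ≤
      1 / β * normL2 Ω (p - pT) + normL2 Ω (lam - lamT) := by
  have hm : MemL2 Ω (lamTilde β pT) :=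
    MemLp.of_bound ((continuous_proj _ _).comp_aestronglyMeasurable
      (hpT.1.const_mul _)) (|-1| + |1|) (.of_forall fun x => abs_proj_le (by norm_num) _)
  refine ⟨hm, normL2_sub_le_of_abs_le (by positivity) hm (h.subgradient.1.mono_exponent le_top)
    (h.memP.1.1.sub hpT) ?_⟩
  filter_upwards [h.pointwise hα hβ ha hb] with x hx
  exact abs_lamTilde_sub_le hβ hx.2

theorem IsOptimal.normL2_uTilde_sub_le [IsFiniteMeasure (volume.restrict Ω)] (hα : 0 < α)
    (hβ : 0 < β) (ha : a < 0) (hb : 0 < b) (h : IsOptimal Ω α β a b f yΩ y p u lam)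
    (hpT : MemL2 Ω pT) :
    MemL2 Ω (uTilde α β a b pT) ∧ normL2 Ω (uTilde α β a b pT - uT) ≤
      2 / α * normL2 Ω (p - pT) + normL2 Ω (u - uT) := by
  have hl := (h.normL2_lamTilde_sub_le (lamT := 0) hα hβ ha hb hpT).1
  have hm : MemL2 Ω (uTilde α β a b pT) :=
    MemLp.of_bound ((continuous_proj _ _).comp_aestronglyMeasurable
      ((hpT.1.add (hl.1.const_mul β)).const_mul _)) (|a| + |b|)
      (.of_forall fun x => abs_proj_le (ha.trans hb).le _)
  refine ⟨hm, normL2_sub_le_of_abs_le (by positivity) hm h.memU.1 (h.memP.1.1.sub hpT) ?_⟩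
  filter_upwards [h.pointwise hα hβ ha hb] with x hx
  exact abs_uTilde_sub_le hα hβ hx.1 hx.2

end Optimality

/-! ### Assembly of the global bound. -/

theorem le_energyNorm (Ω : Set (Pt d)) (ey ep eu el : Pt d → ℝ) :
    seminormH1 Ω ey ≤ energyNorm Ω ey ep eu el ∧ seminormH1 Ω ep ≤ energyNorm Ω ey ep eu el ∧
      normL2 Ω eu ≤ energyNorm Ω ey ep eu el ∧ normL2 Ω el ≤ energyNorm Ω ey ep eu el := by
  unfold energyNorm
  have h1 := sq_nonneg (seminormH1 Ω ey)
  have h2 := sq_nonneg (seminormH1 Ω ep)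
  have h3 := sq_nonneg (normL2 Ω eu)
  have h4 := sq_nonneg (normL2 Ω el)
  refine ⟨?_, ?_, ?_, ?_⟩ <;> exact Real.le_sqrt_of_sq_le (by linarith)

/-- Global efficiency of the error estimator in any dimension at least two. -/
theorem estimator_le (hd : 2 ≤ d) (hΩ : IsOpen Ω) (hL : HasLipschitzBoundary Ω)
    (hbd : Bornology.IsBounded Ω) (σ : ℝ) {α β : ℝ} (hα : 0 < α) (hβ : 0 < β)
    {Cst Cad Cct Csg : ℝ} (hst : 0 ≤ Cst) (had : 0 ≤ Cad) (hct : 0 ≤ Cct) (hsg : 0 ≤ Csg) :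
    ∃ C : ℝ, 0 < C ∧ ∀ a b : ℝ, a < 0 → 0 < b → ∀ f yΩ : Pt d → ℝ, MemL2 Ω f → MemL2 Ω yΩ →
      ∀ (ℓ : Fin 2) (T : Mesh Ω), T.ShapeRegular σ → ∀ y p u lam yT pT uT lamT : Pt d → ℝ,
        IsOptimal Ω α β a b f yΩ y p u lam →
        T.IsDiscreteOptimal α β a b f yΩ yT pT uT lamT →
        T.estimator Cst Cad Cct Csg α β a b f yΩ yT pT uT lamT ≤
          C * (energyNorm Ω (y - yT) (p - pT) (u - uT) (lam - lamT) + osc 0 ℓ f T.elements +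
            osc 0 ℓ yΩ T.elements) := by
  have : IsFiniteMeasure (volume.restrict Ω) := ⟨by simpa using hbd.measure_lt_top⟩
  obtain ⟨C₁, hC₁, hres⟩ := exists_sum_residualSq_le hd hΩ hL hbd σ
  obtain ⟨D, hD0, hD⟩ := hbd.subset_closedBall_lt 0 (0 : Pt d)
  -- Each error quantity is at most `X`. The state residual has three such terms; in the adjoint one
  -- the source error `y - yT` costs the Poincaré constant `2D`, as `p - pT` does in the last two
  -- terms.
  set K := Cst * (C₁ * 3) + Cad * (C₁ * (2 + (2 * D) ^ 2)) + Cct * (2 / α * (2 * D) + 1) ^ 2 +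
    Csg * (1 / β * (2 * D) + 1) ^ 2 with hK
  have hK0 : 0 ≤ K := by positivity
  refine ⟨√K + 1, by positivity, fun a b ha hb f yΩ hf hy ℓ T hT y p u lam yT pT uT lamT h h' => ?_⟩
  set X := energyNorm Ω (y - yT) (p - pT) (u - uT) (lam - lamT) + osc 0 ℓ f T.elements +
    osc 0 ℓ yΩ T.elements with hX
  obtain ⟨ey, ep, eu, el⟩ := le_energyNorm Ω (y - yT) (p - pT) (u - uT) (lam - lamT)
  have of0 : 0 ≤ osc 0 ℓ f T.elements := Real.sqrt_nonneg _
  have oy0 : 0 ≤ osc 0 ℓ yΩ T.elements := Real.sqrt_nonneg _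
  have en0 : 0 ≤ energyNorm Ω (y - yT) (p - pT) (u - uT) (lam - lamT) := Real.sqrt_nonneg _
  have hX0 : 0 ≤ X := by positivity
  have hyX : seminormH1 Ω (y - yT) ≤ X := by linarith
  have hpX : seminormH1 Ω (p - pT) ≤ X := by linarith
  have huX : normL2 Ω (u - uT) ≤ X := by linarith
  have hlX : normL2 Ω (lam - lamT) ≤ X := by linarith
  have hofX : osc 0 ℓ f T.elements ≤ X := by linarith
  have hoyX : osc 0 ℓ yΩ T.elements ≤ X := by linarith
  have poinc : ∀ {z zT : Pt d → ℝ}, MemH10 Ω z → T.MemV zT → seminormH1 Ω (z - zT) ≤ X →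
      normL2 Ω (z - zT) ≤ 2 * D * X := fun {z zT} hz hzT hzX => by
    -- The Poincaré inequality needs a function on the whole space, so `zT` is replaced by its zero
    -- extension; norm and seminorm on `Ω` do not change.
    obtain ⟨w, C, hw, hw0, hwz⟩ := hzT.exists_lipschitz T hΩ
    have hwz' : ∀ x ∈ Ω, w x = zT x := fun x hx => hwz x (subset_closure hx)
    have h1 := poincare_sub (by omega) hΩ hD0.le hD hw hw0 hz
    have e1 : normL2 Ω (z - w) = normL2 Ω (z - zT) :=
      lpNorm_two_congr ((ae_restrict_iff' hΩ.measurableSet).2 (.of_forall fun x hx => by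
        simp only [Pi.sub_apply, hwz' x hx]))
    have g1 := hz.1.hasWeakGradient.sub hz.1.1 (memL2_of_lipschitz hbd hw)
      (hasWeakGradient_of_lipschitz hbd hw)
    have e2 : seminormH1 Ω (z - zT) = seminormH1 Ω (z - w) := by
      rw [seminormH1_eq hΩ g1, seminormH1_eq hΩ (g1.congr hΩ.measurableSet fun x hx => by
        simp only [Pi.sub_apply, hwz' x hx])]
    rw [← e1]
    rw [e2] at hzX
    exact h1.trans (by gcongr)
  have ny := poinc h.memY h'.memY hyX
  have np := poinc h.memP h'.memP hpX
  have hpT := (h'.memP.memH1 T hΩ hbd).1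
  have n0 : ∀ v : Pt d → ℝ, 0 ≤ normL2 Ω v := fun v => lpNorm_nonneg
  have s0 : ∀ v : Pt d → ℝ, 0 ≤ seminormH1 Ω v := fun v => lpNorm_nonneg
  have b1 : ∑ s ∈ T.elements, T.residualSq (uT + f) yT s ≤ C₁ * 3 * X ^ 2 := by
    obtain ⟨P, hP, hosc⟩ := exists_state_source (f := f) h'.memU0 ℓ
    refine (hres T hT y yT _ _ (h.state_pair hΩ hbd hf h') P hP).trans ?_
    rw [hosc, add_sub_add_right_eq_sub, mul_assoc]
    have := pow_le_pow_left₀ (s0 _) hyX 2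
    have := pow_le_pow_left₀ (n0 _) huX 2
    have := pow_le_pow_left₀ of0 hofX 2
    exact mul_le_mul_of_nonneg_left (by linarith) hC₁
  have b2 : ∑ s ∈ T.elements, T.residualSq (yT - yΩ) pT s ≤ C₁ * (2 + (2 * D) ^ 2) * X ^ 2 := by
    obtain ⟨P, hP, hosc⟩ := exists_adjoint_source (yΩ := yΩ) h'.memY ℓ
    refine (hres T hT p pT _ _ (h.adjoint_pair hΩ hbd hy h') P hP).trans ?_
    rw [hosc, sub_sub_sub_cancel_right, mul_assoc]
    have := pow_le_pow_left₀ (s0 _) hpX 2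
    have h2 := pow_le_pow_left₀ (n0 _) ny 2
    have := pow_le_pow_left₀ oy0 hoyX 2
    rw [mul_pow] at h2
    exact mul_le_mul_of_nonneg_left (by linarith) hC₁
  obtain ⟨mu, hu⟩ := h.normL2_uTilde_sub_le (uT := uT) hα hβ ha hb hpT
  obtain ⟨ml, hl⟩ := h.normL2_lamTilde_sub_le (lamT := lamT) hα hβ ha hb hpT
  have b3 : ∑ s ∈ T.elements, normL2 (simplex s) (uTilde α β a b pT - uT) ^ 2 ≤
      (2 / α * (2 * D) + 1) ^ 2 * X ^ 2 := by
    have e := T.sum_lpNorm_sq hΩ hL (mu.sub h'.memUad.1)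
    simp only [normL2] at hu ⊢
    rw [e, ← mul_pow]
    refine pow_le_pow_left₀ lpNorm_nonneg (hu.trans ?_) 2
    calc _ ≤ 2 / α * (2 * D * X) + X := by gcongr <;> assumption
      _ = _ := by ring
  have b4 : ∑ s ∈ T.elements, normL2 (simplex s) (lamTilde β pT - lamT) ^ 2 ≤
      (1 / β * (2 * D) + 1) ^ 2 * X ^ 2 := by
    have e := T.sum_lpNorm_sq hΩ hL (ml.sub h'.subgradient.1.1)
    simp only [normL2] at hl ⊢
    rw [e, ← mul_pow]
    refine pow_le_pow_left₀ lpNorm_nonneg (hl.trans ?_) 2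
    calc _ ≤ 1 / β * (2 * D * X) + X := by gcongr <;> assumption
      _ = _ := by ring
  have htot : ∑ s ∈ T.elements, T.indicatorSq Cst Cad Cct Csg α β a b f yΩ yT pT uT lamT s ≤
      K * X ^ 2 := by
    simp only [Mesh.indicatorSq, Finset.sum_add_distrib, ← Finset.mul_sum]
    calc _ ≤ Cst * (C₁ * 3 * X ^ 2) + Cad * (C₁ * (2 + (2 * D) ^ 2) * X ^ 2) +
          Cct * ((2 / α * (2 * D) + 1) ^ 2 * X ^ 2) +
          Csg * ((1 / β * (2 * D) + 1) ^ 2 * X ^ 2) := by gcongr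
      _ = _ := by rw [hK]; ring
  calc T.estimator Cst Cad Cct Csg α β a b f yΩ yT pT uT lamT ≤ √(K * X ^ 2) :=
        Real.sqrt_le_sqrt htot
    _ = √K * X := by rw [Real.sqrt_mul hK0, Real.sqrt_sq hX0]
    _ ≤ (√K + 1) * X := by gcongr; linarith

end SparseControl

end

theorem theorem5p7 (d : ℕ) (hd : d = 2 ∨ d = 3) (Ω : Set (SparseControl.Pt d))
    (hΩ : SparseControl.IsLipschitzPolytope Ω)
    (σ α β : ℝ) (hα : 0 < α) (hβ : 0 < β)
    (Cst Cad Cct Csg : ℝ) (hst : 0 ≤ Cst) (had : 0 ≤ Cad) (hct : 0 ≤ Cct) (hsg : 0 ≤ Csg) :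
    ∃ C : ℝ, 0 < C ∧
      ∀ (a b : ℝ), a < 0 → 0 < b →
      ∀ (f yΩ : SparseControl.Pt d → ℝ), SparseControl.MemL2 Ω f → SparseControl.MemL2 Ω yΩ →
      ∀ (ℓ : Fin 2) (T : SparseControl.Mesh Ω), T.ShapeRegular σ →
      ∀ (y p u lam yT pT uT lamT : SparseControl.Pt d → ℝ),
        SparseControl.IsOptimal Ω α β a b f yΩ y p u lam →
        T.IsDiscreteOptimal α β a b f yΩ yT pT uT lamT →
        T.estimator Cst Cad Cct Csg α β a b f yΩ yT pT uT lamT ≤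
          C * (SparseControl.energyNorm Ω (y - yT) (p - pT) (u - uT) (lam - lamT) +
            SparseControl.osc 0 ℓ f T.elements + SparseControl.osc 0 ℓ yΩ T.elements) := by
  exact SparseControl.estimator_le (by omega) hΩ.isOpen hΩ.lipschitz hΩ.isBounded σ hα hβ hst had hct hsg
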